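/- Let $f:\mathbb{C}\to\mathbb{P}^N(\mathbb{C})$ be an entire holomorphic curve, and let $\mathbb{P}(L)\cong\mathbb{P}^n(\mathbb{C})$, with $L\subset\mathbb{C}^{N+1}$ a linear subspace of dimension $n+1$, be the smallest linear projective subspace containing $f(\mathbb{C})$. Fix an integer $0\le k\le n$. Let $\widetilde f:\mathbb{C}\to\mathbb{C}^{N+1}\setminus\{0\}$ be a reduced representation of $f$, that is, a holomorphic lift without zeros, and write $\widetilde f\wedge\widetilde f'\wedge\dots\wedge\widetilde f^{(k)}=g\,G$, where $g\not\equiv0$ is an entire function and $G:\mathbb{C}\to\Lambda^{k+1}(\mathbb{C}^{N+1})\setminus\{0\}$ is holomorphic without zeros. The $k$-th derived curve of $f$ is $F_k=[G]:\mathbb{C}\to\mathbb{P}(\Lambda^{k+1}(\mathbb{C}^{N+1}))$. Let $G$ be any reduced representation of $F_k$ and put, for $r>1$, $$T_{F_k}(r)=\frac1{2\pi}\int_0^{2\pi}\log\|G(re^{i\theta})\|_{\max}\,d\theta ,$$ where $\|\cdot\|_{\max}$ is the maximum of the absolute values of the coordinates in the basis $e_{i_0}\wedge\dots\wedge e_{i_k}$,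 $0\le i_0<\dots<i_k\le N$. A decomposable hyperplane is the zero locus in $\mathbb{P}(\Lambda^{k+1}(\mathbb{C}^{N+1}))$ of a nonzero linear form $A^*=a_0\wedge\dots\wedge a_k$ with $a_0,\dots,a_k\in(\mathbb{C}^{N+1})^\vee$. Let $A_1,\dots,A_q$ be decomposable hyperplanes in general position, i.e. any $\binom{N+1}{k+1}$ of them have empty intersection in $\mathbb{P}(\Lambda^{k+1}(\mathbb{C}^{N+1}))$, and assume that none of them contains $\mathbb{P}(\Lambda^{k+1}L)$. For $m\in\mathbb{N}$ and $r>1$ put $$N^{[m]}_{F_k}(r,A_i)=\int_1^r\Big(\sum_{|a|<t}\min\{m,\operatorname{ord}_a(A_i^*\circ G)\}\Big)\frac{dt}{t}.$$ Then there is a function $S_{F_k}$ such that for all $r>1$ $$\Big(q-2\binom{N+1}{k+1}+\binom{n+1}{k+1}\Big)T_{F_k}(r)\le\sum_{i=1}^qN^{[(k+1)(n-k)]}_{F_k}(r,A_i)+S_{F_k}(r),$$ and such that there is a constant $C$ for which, for every $\varepsilon>0$, the bound $S_{F_k}(r)\le C\log T_{F_k}(r)+\varepsilon\log r$ holds for all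 $r>1$ outside a set (depending on $\varepsilon$) of finite Lebesgue measure; moreover, if $F_k$ is rational (i.e. has polynomial homogeneous coordinates), then $S_{F_k}$ is bounded. -/

import Mathlib

open scoped LinearAlgebra.Projectivization

noncomputable section

namespace DerivedCurve

/-- `Ft` is a reduced representation of the curve `f : ℂ → ℙ(W)` (with `W` finite dimensional):
`Ft` is holomorphic (that is, its coordinates, or equivalently its compositions with linear
functionals, are entire), it has no zero, and it lifts `f`. -/
def IsReducedRep {W : Type*} [AddCommGroup W] [Module ℂ W] (f : ℂ → ℙ ℂ W) (Ft : ℂ → W) : Prop :=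
  (∀ φ : Module.Dual ℂ W, Differentiable ℂ fun z => φ (Ft z)) ∧
    ∀ z, ∃ h : Ft z ≠ 0, f z = Projectivization.mk ℂ (Ft z) h

/-- Entire holomorphic curves in `ℙ(W)`: maps that have a reduced representation. -/
def IsEntireCurve {W : Type*} [AddCommGroup W] [Module ℂ W] (f : ℂ → ℙ ℂ W) : Prop :=
  ∃ Ft : ℂ → W, IsReducedRep f Ft

/-- The curve `f` is rational: its homogeneous coordinates can be chosen to be polynomials in `z`
(without a common zero). -/
def IsRationalCurve {W : Type*} [AddCommGroup W] [Module ℂ W] (f : ℂ → ℙ ℂ W) : Prop :=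
  ∃ (d : ℕ) (c : ℕ → W), ∀ z : ℂ, ∃ h : (∑ j ∈ Finset.range (d + 1), z ^ j • c j) ≠ 0,
    f z = Projectivization.mk ℂ (∑ j ∈ Finset.range (d + 1), z ^ j • c j) h

/-- The Cartan order function
`(1/2π) ∫_0^{2π} log ‖Ft(r e^{iθ})‖_max dθ`, where `‖ ‖_max` is the largest modulus of the
coordinates in the basis `b`. -/
def orderFunction {ι W : Type*} [Fintype ι] [AddCommGroup W] [Module ℂ W]
    (b : Module.Basis ι ℂ W) (Ft : ℂ → W) (r : ℝ) : ℝ :=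
  Real.circleAverage (fun z => Real.log ‖(fun i => b.repr (Ft z) i : ι → ℂ)‖) 0 r

/-- The degree on the disk of radius `t`, truncated at level `m`, of the zero divisor of `h`. -/
def truncatedDegree (m : ℕ) (h : ℂ → ℂ) (t : ℝ) : ℕ :=
  ∑ᶠ a ∈ Metric.ball (0 : ℂ) t, min m (analyticOrderNatAt h a)

/-- The counting function, truncated at level `m`, of the zero divisor of `h`. -/
def countingFunction (m : ℕ) (h : ℂ → ℂ) (r : ℝ) : ℝ :=
  ∫ t in (1 : ℝ)..r, (truncatedDegree m h t : ℝ) / t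

/-- `S` is an admissible error term for a curve `F` with order function `T`. For every `ε > 0`,
`S r ≤ O(log (T r)) + ε log r` outside a set of finite Lebesgue measure (depending on `ε`);
moreover `S` is bounded if `F` is rational. -/
def IsErrorTerm {W : Type*} [AddCommGroup W] [Module ℂ W] (F : ℂ → ℙ ℂ W) (T S : ℝ → ℝ) : Prop :=
  (∃ C : ℝ, ∀ ε : ℝ, 0 < ε → ∃ E : Set ℝ, MeasureTheory.volume E < ⊤ ∧
    ∀ r : ℝ, 1 < r → r ∉ E → S r ≤ C * Real.log (T r) + ε * Real.log r) ∧
  (IsRationalCurve F → ∃ C : ℝ, ∀ r : ℝ, 1 < r → |S r| ≤ C)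

/-- The space `Λ^{k+1}(ℂ^{N+1})`. -/
abbrev KVec (N k : ℕ) : Type := ⋀[ℂ]^(k + 1) (Fin (N + 1) → ℂ)

/-- The basis `e_{i_0} ∧ ⋯ ∧ e_{i_k}` (`i_0 < ⋯ < i_k`) of `Λ^{k+1}(ℂ^{N+1})`. -/
def pluckerBasis (N k : ℕ) :
    Module.Basis (Set.powersetCard (Fin (N + 1)) (k + 1)) ℂ (KVec N k) :=
  (Pi.basisFun ℂ (Fin (N + 1))).exteriorPower (k + 1)

/-- `Ft ∧ Ft' ∧ ⋯ ∧ Ft^{(k)}`. -/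
def wronskianLift {N : ℕ} (k : ℕ) (Ft : ℂ → Fin (N + 1) → ℂ) (z : ℂ) : KVec N k :=
  exteriorPower.ιMulti ℂ (k + 1) fun l : Fin (k + 1) => iteratedDeriv (l : ℕ) Ft z

/-- `F` is the `k`-th derived curve of `f`: for a reduced representation `Ft` of `f` one has
`Ft ∧ Ft' ∧ ⋯ ∧ Ft^{(k)} = g • G` with `g ≢ 0` entire and `G` a reduced representation of `F`.
As `G` has no zero, the zero divisor of `g` is the minimum of the zero divisors of the Plücker
coordinates `W(f_{i_0}, …, f_{i_k})`. -/
def IsDerivedCurve {N : ℕ} (k : ℕ) (f : ℂ → ℙ ℂ (Fin (N + 1) → ℂ)) (F : ℂ → ℙ ℂ (KVec N k)) :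
    Prop :=
  ∃ (Ft : ℂ → Fin (N + 1) → ℂ) (g : ℂ → ℂ) (G : ℂ → KVec N k),
    IsReducedRep f Ft ∧ Differentiable ℂ g ∧ (∃ z, g z ≠ 0) ∧ IsReducedRep F G ∧
      ∀ z, wronskianLift k Ft z = g z • G z

/-- The linear form `A` on `Λ^{k+1}(ℂ^{N+1})` defines a decomposable hyperplane: it is nonzero and
equal to `a_0 ∧ ⋯ ∧ a_k` for linear forms `a_i` on `ℂ^{N+1}`. -/
def IsDecomposableForm {N k : ℕ} (A : Module.Dual ℂ (KVec N k)) : Prop :=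
  A ≠ 0 ∧ ∃ a : Fin (k + 1) → Module.Dual ℂ (Fin (N + 1) → ℂ),
    A = exteriorPower.pairingDual ℂ (Fin (N + 1) → ℂ) (k + 1) (exteriorPower.ιMulti ℂ (k + 1) a)

/-- Hyperplanes `{A i = 0}` of `ℙ(W)` are in general position: any `dim W` of them have no common
point in `ℙ(W)`. -/
def InGeneralPosition {W : Type*} [AddCommGroup W] [Module ℂ W] {q : ℕ}
    (A : Fin q → Module.Dual ℂ W) : Prop :=
  ∀ s : Finset (Fin q), s.card = Module.finrank ℂ W → ∀ x : W, (∀ i ∈ s, A i x = 0) → x = 0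

/-- `ℙ(L)` is the smallest linear projective subspace containing the image of `f`. -/
def IsLinearSpan {W : Type*} [AddCommGroup W] [Module ℂ W] (f : ℂ → ℙ ℂ W)
    (L : Submodule ℂ W) : Prop :=
  IsLeast {M : Submodule ℂ W | ∀ z, (f z).submodule ≤ M} L

end DerivedCurve

end

/-! Write `p = k + 1`, `d` for the binomial coefficient of `n + 1` over `p`, and `D` for that of `N
+ 1` over `p`. Inside its linear span the curve is given by `n + 1` linearly independent entire
functions, and its Plücker coordinates are their Wronskians of order `p` divided by a common factor
`g`. Restricted to `Λ^p L`, which has dimension `d`, the given forms are nonzero and any `D` of them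
span the dual space. Cartan's method with Nochka weights would compare products of `d` independent
forms with the Wronskian of the Plücker coordinates. Those coordinates may be linearly dependent
over `ℂ`, and then this Wronskian vanishes identically.

The substitute is the determinant `Δ` of the `p`-th compound of the Wronskian matrix of the `n + 1`
functions (`compoundWronskian`). Linear independence keeps it nonzero. A decomposable form
corresponds to `p` linear combinations of these functions, and the Wronskian `W_b` of the
combinations is `g` times the form along the curve. For `d` independent forms, Cauchy-Binet
identifies `Δ`, up to a nonzero constant, with the determinant of all generalized Wronskians of the
`d` families; its rows are the sets `J` of orders of differentiation. Two properties of `Δ` carry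
the theorem.

The analytic one: after column `b` is divided by `W_b`, every entry lies in a ring of functions with
small proximity function, so `Δ / ∏ W_b` has small proximity function
(`det_compound_div_prod_wronskianDet_mem`, `isSmall_proximity_compoundWronskian_div`). No
determinant is expanded for this. The functions are annihilated by a monic differential operator
with coefficients in that ring, so all higher derivative rows are combinations of the first ones
over the ring.

The local one (`sum_max_order_wronskian_le`): at each point the orders of the `d` forms in excess of
`(k + 1) * (n - k)`, plus `d` times the order of `g`, add up to at most the order of `Δ`. Take a
basis with vanishing orders `e_0 < ... < e_n` at the point. A nonzero term in the determinant of
minors matches the `d` forms bijectively with the index sets `I`. The order of `W_b` is at most the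
sum of the `e_i` over its `I`, minus `0 + ... + k`, and the order of `Δ` is at least the sum of the
`e_i` over all `I` minus the sum of all indices. The discrepancy per form is the sum of `I` minus `0
+ ... + k`, which never exceeds `(k + 1) * (n - k)`: this is the truncation level.

Nochka weights (`exists_nochka_weights_of_span`) reduce both the `q` forms in the pointwise estimate
and their orders at a point to one basis at a time. Jensen's formula integrates the result, and
division by `Θ` gives `PluckerSystem.exists_secondMainEstimate`.

The error term has to be measured by the order function of the derived curve rather than by that of
`f`. Meromorphic functions of characteristic `O(T)` form a field closed under differentiation, by
the lemma on the logarithmic derivative (`exists_proximity_logDeriv_le`). In a differential field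
and for `k < n`, the ratios of the Wronskians of order `k + 1` determine the ratios of the functions
(`exists_ratio_mem`), so the latter have characteristic `O(T)` as well. The structure `GrowthScale`
lets the same argument run twice, once with `T` and exceptional sets of finite measure, once with
`log r` and bounded errors for rational curves. A nonpositive coefficient of `T`, and the case `k =
n` where `T` is bounded, are handled directly. -/

/-! ### Nochka weights for abstract rank functions. -/

section Nochka
open Finset

variable {α : Type*} [DecidableEq α]

/-- Integer-valued rank functions: monotone, submodular, of unit increase. -/
structure IsRankFunction (rk : Finset α → ℕ) : Prop where
  empty : rk ∅ = 0
  mono : ∀ S T, S ⊆ T → rk S ≤ rk T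
  submod : ∀ S T, rk (S ∪ T) + rk (S ∩ T) ≤ rk S + rk T
  insert_le : ∀ a S, rk (insert a S) ≤ rk S + 1

/-- Maximize the total weight over the compact set cut out by the box and the rank inequalities. By
submodularity there is a largest tight set `T`, and at a maximum every element outside `T` must
carry the full weight `Θ`. The total is then `rk T + Θ (#Γ - #T)`, which `hslope` bounds below by
`rk Γ`. -/
theorem exists_weight_sum_eq_rank {rk : Finset α → ℕ} (h : IsRankFunction rk)
    (Γ : Finset α) (Θ : ℝ) (hΘ : 0 ≤ Θ)
    (hslope : ∀ S ⊆ Γ, (rk Γ : ℝ) - rk S ≤ Θ * ((#Γ : ℝ) - #S)) :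
    ∃ ω : α → ℝ, (∀ i, 0 ≤ ω i ∧ ω i ≤ Θ) ∧ (∀ S ⊆ Γ, ∑ i ∈ S, ω i ≤ rk S) ∧
      ∑ i ∈ Γ, ω i = rk Γ := by
  let K : Set (α → ℝ) := Set.Icc (fun _ => 0) (fun _ => Θ) ∩
    {ω | ∀ S ⊆ Γ, ∑ i ∈ S, ω i ≤ rk S}
  have hclosed : IsClosed {ω : α → ℝ | ∀ S ⊆ Γ, ∑ i ∈ S, ω i ≤ rk S} := by
    simp only [Set.ofPred_forall]
    refine isClosed_iInter fun S => isClosed_iInter fun _ => isClosed_le ?_ continuous_const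
    fun_prop
  have hK : IsCompact K := isCompact_Icc.inter_right hclosed
  have hne : K.Nonempty := ⟨fun _ => 0, ⟨le_refl _, fun _ => hΘ⟩, fun S _ => by simp⟩
  obtain ⟨ω, ⟨⟨h0, h1⟩, hS⟩, hmax⟩ := hK.exists_isMaxOn hne
    (f := fun ω : α → ℝ => ∑ i ∈ Γ, ω i) (by fun_prop)
  refine ⟨ω, fun i => ⟨h0 i, h1 i⟩, hS, le_antisymm (hS Γ subset_rfl) ?_⟩
  -- a largest tight set
  let tight : Finset (Finset α) := {S ∈ Γ.powerset | ∑ i ∈ S, ω i = rk S}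
  have hte : tight.Nonempty := ⟨∅, by simp [tight, h.empty]⟩
  obtain ⟨T, hT, hTmax⟩ := exists_max_image tight card hte
  simp only [tight, mem_filter, mem_powerset] at hT hTmax
  -- Tight sets are stable under union: submodularity gives the lower bound, as the intersection
  -- still satisfies its own inequality.
  have hsub : ∀ S ⊆ Γ, ∑ i ∈ S, ω i = rk S → S ⊆ T := by
    intro S hSΓ hSt
    have hu : ∑ i ∈ T ∪ S, ω i = rk (T ∪ S) := by
      refine le_antisymm (hS _ (union_subset hT.1 hSΓ)) ?_
      have e1 := sum_union_inter (s₁ := T) (s₂ := S) (f := ω)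
      have e2 := hS (T ∩ S) (inter_subset_left.trans hT.1)
      have e3 : ((rk (T ∪ S) : ℝ)) + rk (T ∩ S) ≤ rk T + rk S := by exact_mod_cast h.submod T S
      linarith [hT.2]
    have := hTmax (T ∪ S) ⟨union_subset hT.1 hSΓ, hu⟩
    have e := eq_of_subset_of_card_le (subset_union_left (s₁ := T) (s₂ := S)) this
    rw [e]; exact subset_union_right
  have htop : ∀ i ∈ Γ, i ∉ T → ω i = Θ := by
    intro i hi hiT
    by_contra hne
    have hlt : ω i < Θ := lt_of_le_of_ne (h1 i) hne
    let F : Finset (Finset α) := {S ∈ Γ.powerset | i ∈ S}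
    have hF : F.Nonempty := ⟨Γ, by simp [F, hi]⟩
    obtain ⟨S0, hS0, hmin⟩ := exists_min_image F (fun S => (rk S : ℝ) - ∑ j ∈ S, ω j) hF
    simp only [F, mem_filter, mem_powerset] at hS0 hmin
    have hpos : 0 < (rk S0 : ℝ) - ∑ j ∈ S0, ω j := by
      refine lt_of_le_of_ne (by linarith [hS S0 hS0.1]) fun e => hiT ?_
      exact hsub S0 hS0.1 (by linarith) hS0.2
    -- The largest increase of `ω i` allowed both by the box and by the smallest slack among the
    -- sets containing `i`. That slack is positive because no tight set contains `i`.
    set δ := min (Θ - ω i) ((rk S0 : ℝ) - ∑ j ∈ S0, ω j) with hδ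
    have hδpos : 0 < δ := lt_min (by linarith) hpos
    let ω' : α → ℝ := ω + Pi.single i δ
    have hsum : ∀ S : Finset α, ∑ j ∈ S, ω' j = ∑ j ∈ S, ω j + if i ∈ S then δ else 0 := by
      intro S
      simp [ω', sum_add_distrib, Pi.single_apply]
    have hmem : ω' ∈ K := by
      refine ⟨⟨fun j => ?_, fun j => ?_⟩, fun S hSΓ => ?_⟩
      · have := h0 j
        by_cases hj : j = i
        · subst hj; simp only [ω', Pi.add_apply, Pi.single_eq_same] at *; linarith
        · simpa [ω', hj] using this
      · have := h1 j
        by_cases hj : j = i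
        · subst hj; simp only [ω', Pi.add_apply, Pi.single_eq_same] at *
          linarith [min_le_left (Θ - ω j) ((rk S0 : ℝ) - ∑ j ∈ S0, ω j)]
        · simpa [ω', hj] using this
      · rw [hsum]
        split_ifs with hiS
        · have := hmin S ⟨hSΓ, hiS⟩
          linarith [min_le_right (Θ - ω i) ((rk S0 : ℝ) - ∑ j ∈ S0, ω j)]
        · simpa using hS S hSΓ
    have := hmax hmem
    simp only [Set.mem_ofPred_eq, hsum, hi, if_true] at this
    linarith
  have e1 : ∑ i ∈ Γ, ω i = rk T + Θ * ((#Γ : ℝ) - #T) := by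
    rw [← sum_sdiff hT.1, hT.2, sum_congr rfl (g := fun _ => Θ)
      (fun i hi => htop i (mem_sdiff.1 hi).1 (mem_sdiff.1 hi).2), sum_const,
      card_sdiff_of_subset hT.1, nsmul_eq_mul, Nat.cast_sub (card_le_card hT.1)]
    ring
  rw [e1]
  linarith [hslope T hT.1]

/-- Greedy choice of a basis: if `ω` is bounded by the rank on all subsets of `R`, then the
`ω`-weighted sum over `R` is at most the sum over a suitable basis of `R`. -/
theorem exists_basis_weighted_sum_le {rk : Finset α → ℕ} (h : IsRankFunction rk)
    (ω : α → ℝ) (R : Finset α) (hω : ∀ S ⊆ R, ∑ i ∈ S, ω i ≤ rk S) :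
    ∀ x : α → ℝ, (∀ i ∈ R, 0 ≤ x i) →
      ∃ B ⊆ R, #B = rk R ∧ rk B = rk R ∧ ∑ i ∈ R, ω i * x i ≤ ∑ i ∈ B, x i := by
  induction hc : #R generalizing R with
  | zero =>
    intro x _
    rw [card_eq_zero] at hc
    subst hc
    exact ⟨∅, subset_rfl, by simp [h.empty], rfl, by simp⟩
  | succ c ih =>
    intro x hx
    have hne : R.Nonempty := card_pos.1 (by omega)
    obtain ⟨i0, hi0, hmin⟩ := exists_min_image R x hne
    have hcard : #(R.erase i0) = c := by rw [card_erase_of_mem hi0]; omega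
    obtain ⟨B, hB, hBc, hBr, hle⟩ := ih (R.erase i0)
      (fun S hS => hω S (hS.trans (erase_subset _ _))) hcard (fun i => x i - x i0)
      (fun i hi => by linarith [hmin i (erase_subset _ _ hi)])
    -- Abel summation: subtract the least value `x i0` everywhere, so that `i0` drops out, and bound
    -- the total weight by the rank for the part that was subtracted.
    have key : ∑ i ∈ R, ω i * x i ≤ ∑ i ∈ B, (x i - x i0) + x i0 * rk R := by
      have e1 : ∑ i ∈ R, ω i * x i
          = ∑ i ∈ R.erase i0, ω i * (x i - x i0) + x i0 * ∑ i ∈ R, ω i := by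
        rw [sum_erase (s := R) (a := i0) (f := fun i => ω i * (x i - x i0)) (by simp), mul_sum,
          ← sum_add_distrib]
        exact sum_congr rfl fun i _ => by ring
      rw [e1]
      exact add_le_add hle (mul_le_mul_of_nonneg_left (hω R subset_rfl) (hx i0 hi0))
    have hins : insert i0 (R.erase i0) = R := insert_erase hi0
    have hi0B : i0 ∉ B := fun hh => by simpa using hB hh
    -- The element `i0` enters the basis exactly when its removal lowers the rank. In both cases the
    -- basis has `rk R` elements, which restores the term `x i0 * rk R`.
    by_cases hr : rk (R.erase i0) = rk R
    · refine ⟨B, hB.trans (erase_subset _ _), by rw [hBc, hr], by rw [hBr, hr], key.trans ?_⟩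
      rw [sum_sub_distrib, sum_const, nsmul_eq_mul, hBc, hr]
      linarith
    · have hr' : rk R = rk (R.erase i0) + 1 := by
        have h1 := h.mono _ _ (erase_subset i0 R)
        have h2 := h.insert_le i0 (R.erase i0)
        rw [hins] at h2
        omega
      refine ⟨insert i0 B, insert_subset hi0 (hB.trans (erase_subset _ _)), ?_, ?_, key.trans ?_⟩
      · rw [card_insert_of_notMem hi0B, hBc, hr']
      · have h1 := h.mono (insert i0 B) R (insert_subset hi0 (hB.trans (erase_subset _ _)))
        have h2 := h.submod (insert i0 B) (R.erase i0)
        have e1 : insert i0 B ∪ R.erase i0 = R := by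
          rw [insert_union, union_eq_right.2 hB, hins]
        have e2 : B ⊆ insert i0 B ∩ R.erase i0 := subset_inter (subset_insert _ _) hB
        have h3 := h.mono _ _ e2
        rw [e1] at h2
        omega
      · rw [sum_insert hi0B, sum_sub_distrib, sum_const, nsmul_eq_mul, hBc, hr']
        push_cast
        linarith

/-- **Nochka weights** for a rank function of total rank `d` in which every set of `D` elements
has full rank. -/
theorem exists_nochka_weights [Fintype α] {rk : Finset α → ℕ} (h : IsRankFunction rk) {d D : ℕ}
    (hd : 0 < d) (hdD : d ≤ D) (hle : ∀ S, rk S ≤ d) (hfull : ∀ S, #S = D → rk S = d)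
    (hq : D ≤ Fintype.card α) :
    ∃ (Θ : ℝ) (ω : α → ℝ), 0 < Θ ∧ (∀ i, 0 ≤ ω i ∧ ω i ≤ Θ) ∧
      ∑ i, ω i = Θ * ((Fintype.card α : ℝ) - (2 * D - d)) + d ∧
      ∀ R : Finset α, #R ≤ D → ∑ i ∈ R, ω i ≤ rk R := by
  -- sets of small rank are small
  have hsmall : ∀ S : Finset α, #S ≤ D → #S + d ≤ D + rk S := by
    intro S hSD
    obtain ⟨T, hST, -, hT⟩ := exists_subsuperset_card_eq (subset_univ S) hSD (by simpa using hq)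
    have hgrow : ∀ U : Finset α, rk (S ∪ U) ≤ rk S + #U := by
      intro U
      induction U using Finset.induction_on with
      | empty => simp
      | insert a U ha ih =>
        rw [union_insert, card_insert_of_notMem ha]
        have := h.insert_le a (S ∪ U)
        omega
    have := hgrow (T \ S)
    rw [union_sdiff_of_subset hST, hfull T hT, card_sdiff_of_subset hST] at this
    omega
  have hcardlt : ∀ S : Finset α, rk S < d → #S < D := by
    intro S hS
    by_contra hge
    obtain ⟨T, hTS, hT⟩ := exists_subset_card_eq (not_lt.1 hge)
    have := h.mono _ _ hTS
    rw [hfull T hT] at this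
    omega
  -- The slope of the segment from `(#S, rk S)` to `(2D - d, d)`. The constant `Θ` is its largest
  -- value over the sets of deficient rank, attained at `Γ`.
  let slope : Finset α → ℝ := fun S => ((d : ℝ) - rk S) / ((2 * D - d : ℝ) - #S)
  have hden : ∀ S : Finset α, rk S < d → (D : ℝ) - rk S ≤ (2 * D - d : ℝ) - #S := by
    intro S hS
    have := hsmall S (hcardlt S hS).le
    have : (#S : ℝ) + d ≤ D + rk S := by exact_mod_cast this
    linarith
  have hden' : ∀ S : Finset α, rk S < d → 0 < (2 * D - d : ℝ) - #S := by
    intro S hS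
    refine lt_of_lt_of_le ?_ (hden S hS)
    have : (rk S : ℝ) < d := by exact_mod_cast hS
    have : (d : ℝ) ≤ D := by exact_mod_cast hdD
    linarith
  let F : Finset (Finset α) := {S | rk S < d}
  have hF : F.Nonempty := ⟨∅, by simp [F, h.empty, hd]⟩
  obtain ⟨Γ, hΓ, hmax⟩ := exists_max_image F slope hF
  simp only [F, mem_filter, mem_univ, true_and] at hΓ hmax
  set Θ := slope Γ with hΘdef
  have hΓ' : (rk Γ : ℝ) < d := by exact_mod_cast hΓ
  have hΘpos : 0 < Θ := div_pos (by linarith) (hden' Γ hΓ)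
  have hΘeq : (d : ℝ) - rk Γ = Θ * ((2 * D - d : ℝ) - #Γ) := by
    rw [hΘdef]; simp only [slope]; rw [div_mul_cancel₀ _ (hden' Γ hΓ).ne']
  have hΘle : ∀ S : Finset α, rk S < d → (d : ℝ) - rk S ≤ Θ * ((2 * D - d : ℝ) - #S) := by
    intro S hS
    have := hmax S hS
    rwa [div_le_iff₀ (hden' S hS)] at this
  have hslope : ∀ S, rk S < d → (rk Γ : ℝ) - rk S ≤ Θ * ((#Γ : ℝ) - #S) := by
    intro S hS
    have := hΘle S hS
    linarith
  obtain ⟨ω, hω, hωS, hωΓ⟩ := exists_weight_sum_eq_rank h Γ Θ hΘpos.le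
    (fun S hS => hslope S (lt_of_le_of_lt (h.mono _ _ hS) hΓ))
  -- Beyond `Γ` all weights equal `Θ`; together with the weight `rk Γ` on `Γ` and the definition of
  -- the slope this gives the prescribed total.
  let w : α → ℝ := fun i => if i ∈ Γ then ω i else Θ
  have hwsum : ∀ R : Finset α, ∑ i ∈ R, w i = ∑ i ∈ R ∩ Γ, ω i + Θ * (#(R \ Γ) : ℝ) := by
    intro R
    rw [← sum_inter_add_sum_sdiff R Γ]
    congr 1
    · exact sum_congr rfl fun i hi => if_pos (mem_inter.1 hi).2
    · rw [sum_congr rfl (g := fun _ => Θ) fun i hi => if_neg (mem_sdiff.1 hi).2, sum_const,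
        nsmul_eq_mul, mul_comm]
  refine ⟨Θ, w, hΘpos, fun i => ?_, ?_, fun R hR => ?_⟩
  · by_cases hi : i ∈ Γ
    · simpa [w, hi] using hω i
    · simpa [w, hi] using hΘpos.le
  · rw [hwsum univ, univ_inter, hωΓ, ← compl_eq_univ_sdiff, card_compl,
      Nat.cast_sub (card_le_univ Γ)]
    linarith
  -- If `R ∪ Γ` has deficient rank, maximality of the slope applies to it and submodularity
  -- finishes. Otherwise `rk R ≥ d - rk Γ`, and the crude bound `Θ * #R` is enough.
  · by_cases hRΓ : rk (R ∪ Γ) < d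
    · have e1 := hΘle _ hRΓ
      have e2 : (#(R ∪ Γ) : ℝ) = #Γ + #(R \ Γ) := by
        rw [← sdiff_union_self_eq_union, card_union_of_disjoint sdiff_disjoint]
        push_cast; ring
      have e3 : (rk (R ∪ Γ) : ℝ) + rk (R ∩ Γ) ≤ rk R + rk Γ := by exact_mod_cast h.submod R Γ
      have e4 := hωS (R ∩ Γ) inter_subset_right
      rw [hwsum]
      rw [e2] at e1
      linarith
    · have hd' : rk (R ∪ Γ) = d := le_antisymm (hle _) (not_lt.1 hRΓ)
      have e1 := h.submod R Γ
      have e2 : ((d : ℝ) - rk Γ) ≤ rk R := by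
        have : d ≤ rk R + rk Γ := by omega
        have : (d : ℝ) ≤ rk R + rk Γ := by exact_mod_cast this
        linarith
      have e3 : ∑ i ∈ R, w i ≤ Θ * #R := by
        rw [mul_comm, ← nsmul_eq_mul]
        refine sum_le_card_nsmul _ _ _ fun i _ => ?_
        by_cases hi : i ∈ Γ
        · simpa [w, hi] using (hω i).2
        · simp [w, hi]
      have e4 : (#R : ℝ) + d ≤ D + rk R := by exact_mod_cast hsmall R hR
      have e5 := hden Γ hΓ
      have hdD' : (d : ℝ) ≤ D := by exact_mod_cast hdD
      -- `Θ (D - rk Γ) ≤ d - rk Γ`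
      have e6 : Θ * ((D : ℝ) - rk Γ) ≤ d - rk Γ := by
        rw [hΘeq]; exact mul_le_mul_of_nonneg_left e5 hΘpos.le
      have hΘ1 : Θ ≤ 1 := by
        by_contra hgt
        nlinarith
      refine e3.trans ?_
      have e7 : Θ * (#R : ℝ) ≤ Θ * (D - d + rk R) :=
        mul_le_mul_of_nonneg_left (by linarith) hΘpos.le
      -- The inequality `Θ (D - d + t) ≤ t` at `t = d - rk Γ`. As `Θ ≤ 1` it persists for all larger
      -- `t`, in particular for `t = rk R`.
      have e8 : Θ * ((D : ℝ) - d + (d - rk Γ)) ≤ d - rk Γ := by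
        rw [show (D : ℝ) - d + (d - rk Γ) = D - rk Γ by ring]; exact e6
      nlinarith

end Nochka

/-! ### Nochka weights for vectors in subgeneral position. -/

section VectorRank
open Finset

variable {V : Type*} [AddCommGroup V] [Module ℂ V] [FiniteDimensional ℂ V]
variable {α : Type*} [DecidableEq α]

theorem isRankFunction_finrank_span (v : α → V) :
    IsRankFunction fun S : Finset α => Module.finrank ℂ (Submodule.span ℂ (v '' (S : Set α))) where
  empty := by simp
  mono S T hST := Submodule.finrank_mono (Submodule.span_mono (Set.image_mono (by simpa using hST)))
  submod S T := by
    have h := Submodule.finrank_sup_add_finrank_inf_eq (Submodule.span ℂ (v '' (S : Set α)))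
      (Submodule.span ℂ (v '' (T : Set α)))
    rw [← h, coe_union, Set.image_union, Submodule.span_union]
    refine Nat.add_le_add_left (Submodule.finrank_mono (le_inf ?_ ?_)) _ <;>
      exact Submodule.span_mono (Set.image_mono (by simp))
  insert_le a S := by
    rw [coe_insert, Set.image_insert_eq, Submodule.span_insert]
    refine (Submodule.finrank_add_le_finrank_add_finrank _ _).trans ?_
    have := finrank_span_le_card (R := ℂ) ({v a} : Set V)
    simp only [Set.toFinset_singleton, card_singleton] at this
    omega

theorem linearIndependent_of_card_eq_finrank_span {ι U : Type*} [AddCommGroup U] [Module ℂ U]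
    (v : ι → U) (B : Finset ι)
    (h : #B = Module.finrank ℂ (Submodule.span ℂ (v '' (B : Set ι)))) :
    LinearIndependent ℂ fun i : B => v i := by
  rw [linearIndependent_iff_card_eq_finrank_span]
  have e : Set.range (fun i : B => v i) = v '' (B : Set ι) := by
    ext x; simp
  rw [Fintype.card_coe, h, Set.finrank, e]

/-- **Nochka weights** for vectors in `D`-subgeneral position. -/
theorem exists_nochka_weights_of_span [Fintype α] (v : α → V) {D : ℕ}
    (hd : 0 < Module.finrank ℂ V) (hdD : Module.finrank ℂ V ≤ D) (hq : D ≤ Fintype.card α)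
    (hspan : ∀ S : Finset α, #S = D → Submodule.span ℂ (v '' (S : Set α)) = ⊤) :
    ∃ (Θ : ℝ) (ω : α → ℝ), 0 < Θ ∧ (∀ i, 0 ≤ ω i ∧ ω i ≤ Θ) ∧
      ∑ i, ω i = Θ * ((Fintype.card α : ℝ) - (2 * D - Module.finrank ℂ V)) + Module.finrank ℂ V ∧
      ∀ R : Finset α, #R = D → ∀ x : α → ℝ, (∀ i ∈ R, 0 ≤ x i) →
        ∃ B ⊆ R, #B = Module.finrank ℂ V ∧ (LinearIndependent ℂ fun i : B => v i) ∧
          ∑ i ∈ R, ω i * x i ≤ ∑ i ∈ B, x i := by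
  have hrk := isRankFunction_finrank_span v
  have hfull : ∀ S : Finset α, #S = D →
      Module.finrank ℂ (Submodule.span ℂ (v '' (S : Set α))) = Module.finrank ℂ V := by
    intro S hS; rw [hspan S hS, finrank_top]
  obtain ⟨Θ, ω, h1, h2, h3, h4⟩ := exists_nochka_weights hrk hd hdD
    (fun S => Submodule.finrank_le _) hfull hq
  refine ⟨Θ, ω, h1, h2, h3, fun R hR x hx => ?_⟩
  obtain ⟨B, hB, hBc, hBr, hle⟩ := exists_basis_weighted_sum_le hrk ω R
    (fun S hS => h4 S (by rw [← hR]; exact card_le_card hS)) x hx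
  exact ⟨B, hB, hBc.trans (hfull R hR),
    linearIndependent_of_card_eq_finrank_span v B (hBc.trans hBr.symm), hle⟩

end VectorRank

/-! ### Logarithmic derivatives of zero-free functions on a disk. -/

section LogDerivZeroFree
open Complex Real Metric Set Filter Topology MeasureTheory

/-- A zero-free holomorphic function is, up to a constant, the exponential of the Schwarz integral
of its logarithmic modulus. -/
theorem logDeriv_eq_circleAverage_of_ne_zero {g : ℂ → ℂ} {R : ℝ} (hR : 0 < R)
    (hg : AnalyticOnNhd ℂ g (closedBall 0 R)) (h0 : ∀ z ∈ closedBall 0 R, g z ≠ 0)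
    {w : ℂ} (hw : w ∈ ball 0 R) :
    logDeriv g w = circleAverage (fun ζ ↦ (2 * ζ / (ζ - w) ^ 2) • ((Real.log ‖g ζ‖ : ℝ) : ℂ)) 0 R := by
  have hint : CircleIntegrable (fun ζ => Real.log ‖g ζ‖) 0 R :=
    MeromorphicOn.circleIntegrable_log_norm
      (fun z hz => (hg z (sphere_subset_closedBall (by rwa [abs_of_pos hR] at hz))).meromorphicAt)
  have hint' : CircleIntegrable (fun ζ => ((Real.log ‖g ζ‖ : ℝ) : ℂ)) 0 R := by
    have := hint
    unfold CircleIntegrable at this ⊢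
    exact ⟨this.1.ofReal, this.2.ofReal⟩
  -- The Schwarz integral of `log ‖g‖`. Its real part is the Poisson integral, which reproduces `log
  -- ‖g‖` because `g` has no zeros.
  set u : ℂ → ℂ := fun w ↦
    circleAverage (fun ζ ↦ herglotzRieszKernel 0 w ζ • ((Real.log ‖g ζ‖ : ℝ) : ℂ)) 0 R with hu
  have hderiv : ∀ w ∈ ball (0 : ℂ) R, HasDerivAt u
      (circleAverage (fun ζ ↦ (2 * ζ / (ζ - w) ^ 2) • ((Real.log ‖g ζ‖ : ℝ) : ℂ)) 0 R) w :=
    fun w hw => hasDerivAt_circleAverage_herglotzRieszKernel_smul hint' hw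
  have hharm : InnerProductSpace.HarmonicOnNhd (fun z => Real.log ‖g z‖) (closedBall 0 R) :=
    fun z hz => (hg z hz).harmonicAt_log_norm (h0 z hz)
  have hre : ∀ w ∈ ball (0 : ℂ) R, (u w).re = Real.log ‖g w‖ := by
    intro w hw
    rw [hu]
    simp only
    rw [re_circleAverage_herglotzRieszKernel_smul hint hw]
    exact hharm.circleAverage_re_herglotzRieszKernel_smul hw
  have hdiff : DifferentiableOn ℂ (fun z => g z * cexp (-u z)) (ball 0 R) := by
    intro z hz
    exact (((hg z (ball_subset_closedBall hz)).differentiableAt).mul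
      ((hderiv z hz).differentiableAt.neg.cexp)).differentiableWithinAt
  have hnorm : ∀ z ∈ ball (0 : ℂ) R, ‖g z * cexp (-u z)‖ = 1 := by
    intro z hz
    have hgz : 0 < ‖g z‖ := norm_pos_iff.2 (h0 z (ball_subset_closedBall hz))
    rw [norm_mul, Complex.norm_exp, neg_re, hre z hz, Real.exp_neg, Real.exp_log hgz,
      mul_inv_cancel₀ hgz.ne']
  -- `g * exp (-u)` has modulus one throughout the disk, hence is constant by the maximum principle.
  have hconst := Complex.eqOn_of_isPreconnected_of_isMaxOn_norm
    (convex_ball (0 : ℂ) R).isPreconnected isOpen_ball hdiff hw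
    (fun z hz => ((hnorm z hz).trans (hnorm w hw).symm).le)
  set c := g w * cexp (-u w) with hc
  have hgeq : g =ᶠ[𝓝 w] fun z => c * cexp (u z) := by
    filter_upwards [isOpen_ball.mem_nhds hw] with z hz
    have := hconst hz
    simp only [Function.const] at this
    rw [← this, mul_assoc, ← Complex.exp_add, neg_add_cancel, Complex.exp_zero, mul_one]
  have hcne : c ≠ 0 := by
    intro h
    have := hnorm w hw
    rw [← hc, h] at this
    simp at this
  rw [(logDeriv_congr_nhds hgeq).eq_of_nhds, logDeriv_apply,
    ((hderiv w hw).cexp.const_mul c).deriv]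
  field_simp [Complex.exp_ne_zero]

/-- On the circle the differentiated kernel `2ζ / (ζ - w)^2` has modulus exactly `2R / (R^2 -
‖w‖^2)` times the Poisson kernel. The resulting bound is a harmonic function of `w`, whose average
over a smaller circle can be evaluated exactly. -/
theorem norm_logDeriv_le_of_ne_zero {g : ℂ → ℂ} {R : ℝ} (hR : 0 < R)
    (hg : AnalyticOnNhd ℂ g (closedBall 0 R)) (h0 : ∀ z ∈ closedBall 0 R, g z ≠ 0)
    {w : ℂ} (hw : w ∈ ball 0 R) :
    ‖logDeriv g w‖ ≤ 2 * R / (R ^ 2 - ‖w‖ ^ 2) *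
      (circleAverage (fun ζ ↦ herglotzRieszKernel 0 w ζ • ((|Real.log ‖g ζ‖| : ℝ) : ℂ)) 0 R).re := by
  have hint : CircleIntegrable (fun ζ => Real.log ‖g ζ‖) 0 R :=
    MeromorphicOn.circleIntegrable_log_norm
      (fun z hz => (hg z (sphere_subset_closedBall (by rwa [abs_of_pos hR] at hz))).meromorphicAt)
  have hintabs : CircleIntegrable (fun ζ => |Real.log ‖g ζ‖|) 0 R := hint.abs
  have hwR : ‖w‖ < R := by simpa using hw
  have hpos : 0 < R ^ 2 - ‖w‖ ^ 2 := by nlinarith [norm_nonneg w]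
  rw [logDeriv_eq_circleAverage_of_ne_zero hR hg h0 hw,
    re_circleAverage_herglotzRieszKernel_smul hintabs hw]
  have hcont : ContinuousOn (fun ζ : ℂ => ((re ∘ herglotzRieszKernel 0 w) ζ : ℝ)) (sphere 0 |R|) := by
    exact Complex.continuous_re.comp_continuousOn (continuousOn_herglotzRieszKernel_sphere hw)
  have hint2 : CircleIntegrable ((re ∘ herglotzRieszKernel 0 w) • fun ζ => |Real.log ‖g ζ‖|) 0 R := by
    exact hintabs.continuousOn_smul hcont
  have hpt : ∀ ζ ∈ sphere (0 : ℂ) |R|, ‖(2 * ζ / (ζ - w) ^ 2) • ((Real.log ‖g ζ‖ : ℝ) : ℂ)‖ ≤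
      (2 * R / (R ^ 2 - ‖w‖ ^ 2)) • ((re ∘ herglotzRieszKernel 0 w) • fun ζ => |Real.log ‖g ζ‖|) ζ := by
    intro ζ hζ
    have hζR : ‖ζ‖ = R := by simpa [abs_of_pos hR] using hζ
    have hp : (re ∘ herglotzRieszKernel 0 w) ζ = (R ^ 2 - ‖w‖ ^ 2) / ‖ζ - w‖ ^ 2 := by
      rw [← poissonKernel_eq_re_herglotzRieszKernel, poissonKernel_def]
      simp [hζR]
    have hne : 0 < ‖ζ - w‖ := by
      rw [norm_pos_iff, sub_ne_zero]
      rintro rfl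
      linarith
    simp only [Pi.smul_apply', smul_eq_mul, norm_mul, norm_div, norm_pow, hζR, hp, norm_real,
      Real.norm_eq_abs, RCLike.norm_ofNat]
    rw [← mul_assoc]
    refine mul_le_mul_of_nonneg_right (le_of_eq ?_) (abs_nonneg _)
    field_simp
  rw [← smul_eq_mul, ← circleAverage_fun_smul]
  have h1 : ‖circleAverage (fun ζ ↦ (2 * ζ / (ζ - w) ^ 2) • ((Real.log ‖g ζ‖ : ℝ) : ℂ)) 0 R‖ ≤
      circleAverage (fun ζ => ‖(2 * ζ / (ζ - w) ^ 2) • ((Real.log ‖g ζ‖ : ℝ) : ℂ)‖) 0 R := by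
    rw [circleAverage_def, circleAverage_def, norm_smul, smul_eq_mul, Real.norm_eq_abs,
      abs_of_pos (by positivity)]
    gcongr
    exact intervalIntegral.norm_integral_le_integral_norm (by positivity)
  refine h1.trans ?_
  have hint' : CircleIntegrable (fun ζ => ((Real.log ‖g ζ‖ : ℝ) : ℂ)) 0 R := by
    have := hint
    unfold CircleIntegrable at this ⊢
    exact ⟨this.1.ofReal, this.2.ofReal⟩
  refine circleAverage_mono ?_ (hint2.const_smul) hpt
  have hcont2 : ContinuousOn (fun ζ => 2 * ζ / (ζ - w) ^ 2) (sphere 0 |R|) := by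
    intro ζ hζ
    have hζR : ‖ζ‖ = R := by simpa [abs_of_pos hR] using hζ
    have hne : ζ - w ≠ 0 := by
      rw [sub_ne_zero]
      rintro rfl
      linarith
    have h : ContinuousAt (fun ζ => 2 * ζ / (ζ - w) ^ 2) ζ :=
      ContinuousAt.div (by fun_prop) (by fun_prop) (pow_ne_zero 2 hne)
    exact h.continuousWithinAt
  exact IntervalIntegrable.norm (hint'.fun_continuousOn_smul hcont2)

/-- Mean value of the logarithmic derivative of a zero-free holomorphic function. -/
theorem circleAverage_norm_logDeriv_le_of_ne_zero {g : ℂ → ℂ} {r R : ℝ} (hr : 0 ≤ r) (hrR : r < R)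
    (hg : AnalyticOnNhd ℂ g (closedBall 0 R)) (h0 : ∀ z ∈ closedBall 0 R, g z ≠ 0) :
    circleAverage (fun z => ‖logDeriv g z‖) 0 r ≤
      2 * R / (R ^ 2 - r ^ 2) * circleAverage (fun z => |Real.log ‖g z‖|) 0 R := by
  have hR : 0 < R := hr.trans_lt hrR
  have hint : CircleIntegrable (fun ζ => |Real.log ‖g ζ‖|) 0 R :=
    (MeromorphicOn.circleIntegrable_log_norm
      (fun z hz => (hg z (sphere_subset_closedBall
        (by rwa [abs_of_pos hR] at hz))).meromorphicAt)).abs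
  have hint' : CircleIntegrable (fun ζ => ((|Real.log ‖g ζ‖| : ℝ) : ℂ)) 0 R := by
    have := hint
    unfold CircleIntegrable at this ⊢
    exact ⟨this.1.ofReal, this.2.ofReal⟩
  set V : ℂ → ℂ := fun w ↦
    circleAverage (fun ζ ↦ herglotzRieszKernel 0 w ζ • ((|Real.log ‖g ζ‖| : ℝ) : ℂ)) 0 R with hV
  have hVan : AnalyticOnNhd ℂ V (ball 0 R) :=
    analyticOnNhd_circleAverage_herglotzRieszKernel_smul hint'
  have hsub : closedBall (0 : ℂ) r ⊆ ball 0 R := closedBall_subset_ball hrR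
  have hVc : CircleIntegrable V 0 r := by
    refine ContinuousOn.circleIntegrable hr (hVan.continuousOn.mono ?_)
    exact sphere_subset_closedBall.trans hsub
  have hlog : ContinuousOn (logDeriv g) (closedBall 0 R) := by
    intro z hz
    exact (((hg z hz).deriv.div (hg z hz) (h0 z hz)).continuousAt).continuousWithinAt
  -- The mean value property of `V` replaces the average over the circle of radius `r` by the value
  -- at the centre, which is the average of `|log ‖g‖|` over the outer circle.
  have hmv : circleAverage V 0 r = V 0 := by
    refine DiffContOnCl.circleAverage ⟨?_, ?_⟩
    · rw [abs_of_nonneg hr]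
      exact (hVan.differentiableOn).mono (ball_subset_closedBall.trans hsub)
    · rw [abs_of_nonneg hr]
      exact hVan.continuousOn.mono (closure_ball_subset_closedBall.trans hsub)
  have hV0 : (V 0).re = circleAverage (fun z => |Real.log ‖g z‖|) 0 R := by
    rw [hV]
    simp only
    rw [re_circleAverage_herglotzRieszKernel_smul hint (mem_ball_self hR)]
    refine circleAverage_congr_sphere fun ζ hζ => ?_
    have hζR : ‖ζ‖ = R := by simpa [abs_of_pos hR] using hζ
    have hne : ζ ≠ 0 := by rintro rfl; simp at hζR; linarith
    simp [herglotzRieszKernel_def, hne]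
  have hre : circleAverage (fun z => (V z).re) 0 r = (V 0).re := by
    rw [← hmv]
    exact Complex.reCLM.circleAverage_comp_comm hVc
  rw [← hV0, ← hre, ← smul_eq_mul, ← circleAverage_fun_smul]
  refine circleAverage_mono ?_ ?_ ?_
  · exact ContinuousOn.circleIntegrable hr
      (hlog.mono (sphere_subset_closedBall.trans (closedBall_subset_closedBall hrR.le))).norm
  · refine ContinuousOn.circleIntegrable hr (ContinuousOn.fun_smul continuousOn_const ?_)
    exact Complex.continuous_re.comp_continuousOn
      (hVan.continuousOn.mono (sphere_subset_closedBall.trans hsub))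
  · intro z hz
    have hzr : ‖z‖ = r := by simpa [abs_of_nonneg hr] using hz
    have := norm_logDeriv_le_of_ne_zero hR hg h0 (w := z) (by simpa [hzr] using hrR)
    rw [hzr] at this
    exact this

end LogDerivZeroFree

/-! ### Circle averages of negative powers of the distance to a point. -/

section NegativePower
open Complex Real Metric Set Filter Topology MeasureTheory

theorem intervalIntegrable_abs_sin_rpow_neg {α : ℝ} (h0 : 0 < α) (h1 : α < 1) (a b : ℝ) :
    IntervalIntegrable (fun θ => |Real.sin θ| ^ (-α)) volume a b := by
  have hper : Function.Periodic (fun θ : ℝ => |Real.sin θ| ^ (-α)) π := by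
    intro θ; simp [Real.sin_add_pi]
  refine hper.intervalIntegrable₀ pi_ne_zero ?_ a b
  have hI : IntervalIntegrable (fun θ : ℝ => (π / 2) ^ α * (θ ^ (-α) + (π - θ) ^ (-α)))
      volume 0 π := by
    refine IntervalIntegrable.const_mul (IntervalIntegrable.add ?_ ?_) _
    · exact intervalIntegral.intervalIntegrable_rpow' (by linarith)
    · have := (intervalIntegral.intervalIntegrable_rpow' (a := 0) (b := π)
        (r := -α) (by linarith)).comp_sub_left π
      simpa using this.symm
  refine hI.mono_fun (Measurable.aestronglyMeasurable (by fun_prop)) ?_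
  rw [Filter.EventuallyLE, ae_restrict_iff' measurableSet_uIoc]
  refine Eventually.of_forall fun θ hθ => ?_
  rw [uIoc_of_le pi_pos.le] at hθ
  have hs := Real.sin_nonneg_of_nonneg_of_le_pi hθ.1.le hθ.2
  have hp : 0 < π / 2 := by positivity
  rw [Real.norm_of_nonneg (by positivity), Real.norm_of_nonneg
    (by have := sub_nonneg.2 hθ.2; have := hθ.1.le; positivity), abs_of_nonneg hs]
  have hn1 : 0 ≤ (π - θ) ^ (-α) := Real.rpow_nonneg (sub_nonneg.2 hθ.2) _
  have hn2 : 0 ≤ θ ^ (-α) := Real.rpow_nonneg hθ.1.le _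
  -- Jordan's inequality `sin t ≥ 2t / π`; the other half of the interval follows by reflection.
  have key : ∀ t : ℝ, 0 < t → t ≤ π / 2 → (Real.sin t) ^ (-α) ≤ (π / 2) ^ α * t ^ (-α) := by
    intro t ht ht2
    have hj := Real.mul_le_sin ht.le ht2
    have : (Real.sin t) ^ (-α) ≤ (2 / π * t) ^ (-α) :=
      Real.rpow_le_rpow_of_nonpos (by positivity) hj (by linarith)
    refine this.trans (le_of_eq ?_)
    rw [Real.mul_rpow (by positivity) ht.le, Real.rpow_neg (by positivity : (0:ℝ) ≤ 2 / π),
      ← Real.inv_rpow (by positivity), inv_div]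
  rcases le_total θ (π / 2) with h | h
  · refine (key θ hθ.1 h).trans ?_
    gcongr
    linarith
  · rcases eq_or_lt_of_le hθ.2 with h' | h'
    · subst h'
      rw [Real.sin_pi, Real.zero_rpow (by linarith)]
      positivity
    · have := key (π - θ) (by linarith) (by linarith)
      rw [Real.sin_pi_sub] at this
      refine this.trans ?_
      gcongr
      linarith

/-- Rotation by `-φ` moves `ρ e^{iφ}` to the real axis, and the left side is the modulus of the
imaginary part that remains. The bound does not see `ρ`. -/
theorem abs_sin_mul_le_norm_circleMap_sub (r θ φ ρ : ℝ) :
    |r| * |Real.sin (θ - φ)| ≤ ‖circleMap 0 r θ - ρ * cexp (φ * I)‖ := by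
  have e : circleMap 0 r θ - ρ * cexp (φ * I)
      = cexp (φ * I) * (r * cexp (((θ - φ : ℝ) : ℂ) * I) - ρ) := by
    rw [circleMap_zero, mul_sub, mul_left_comm, ← Complex.exp_add]
    push_cast
    ring_nf
  rw [e, norm_mul, Complex.norm_exp_ofReal_mul_I, one_mul, ← abs_mul]
  refine le_trans (le_of_eq ?_) (Complex.abs_im_le_norm _)
  congr 1
  rw [Complex.exp_mul_I, ← Complex.ofReal_cos, ← Complex.ofReal_sin]
  simp [-Complex.ofReal_sub, -Complex.ofReal_cos, -Complex.ofReal_sin]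

/-- The constant is uniform in `a`, so zeros and poles may lie arbitrarily close to the circle. An
exponent below one keeps the singularity integrable even when `a` is on the circle. -/
theorem exists_circleAverage_norm_sub_rpow_neg_le {α : ℝ} (h0 : 0 < α) (h1 : α < 1) :
    ∃ C : ℝ, 0 ≤ C ∧ ∀ (a : ℂ) (r : ℝ), 0 < r →
      CircleIntegrable (fun z => ‖z - a‖ ^ (-α)) 0 r ∧
      circleAverage (fun z => ‖z - a‖ ^ (-α)) 0 r ≤ C * r ^ (-α) := by
  refine ⟨(2 * π)⁻¹ * ∫ θ in (0 : ℝ)..2 * π, |Real.sin θ| ^ (-α), ?_, ?_⟩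
  · refine mul_nonneg (by positivity) (intervalIntegral.integral_nonneg (by positivity) ?_)
    intro θ _; positivity
  intro a r hr
  set φ := a.arg
  have ha : a = (‖a‖ : ℝ) * cexp (φ * I) := (Complex.norm_mul_exp_arg_mul_I a).symm
  have hpt : ∀ θ, Real.sin (θ - φ) ≠ 0 →
      ‖circleMap 0 r θ - a‖ ^ (-α) ≤ r ^ (-α) * |Real.sin (θ - φ)| ^ (-α) := by
    intro θ hθ
    rw [← Real.mul_rpow hr.le (abs_nonneg _)]
    refine Real.rpow_le_rpow_of_nonpos (mul_pos hr (abs_pos.2 hθ)) ?_ (by linarith)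
    have := abs_sin_mul_le_norm_circleMap_sub r θ φ ‖a‖
    rwa [← ha, abs_of_pos hr] at this
  -- At a zero of the sine the majorant is `0`, by the convention for `0 ^ (-α)`, so the comparison
  -- can hold only almost everywhere.
  have hae : ∀ᵐ θ : ℝ, Real.sin (θ - φ) ≠ 0 := by
    rw [ae_iff]
    refine Set.Countable.measure_zero ?_ _
    have : {θ : ℝ | ¬ Real.sin (θ - φ) ≠ 0} ⊆ Set.range fun n : ℤ => n * π + φ := by
      intro θ hθ
      simp only [ne_eq, not_not, Set.mem_ofPred_eq] at hθ
      obtain ⟨n, hn⟩ := Real.sin_eq_zero_iff.1 hθ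
      exact ⟨n, by simp only; linarith⟩
    exact (Set.countable_range _).mono this
  have hI : IntervalIntegrable (fun θ => r ^ (-α) * |Real.sin (θ - φ)| ^ (-α)) volume 0 (2 * π) := by
    refine IntervalIntegrable.const_mul ?_ _
    have := (intervalIntegrable_abs_sin_rpow_neg h0 h1 (-φ) (2 * π - φ)).comp_sub_right φ
    simpa using this
  have hint : IntervalIntegrable (fun θ => ‖circleMap 0 r θ - a‖ ^ (-α)) volume 0 (2 * π) := by
    refine hI.mono_fun ?_ ?_
    · exact Measurable.aestronglyMeasurable (by fun_prop)
    · refine ae_restrict_of_ae ?_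
      filter_upwards [hae] with θ hθ
      rw [Real.norm_of_nonneg (by positivity), Real.norm_of_nonneg (by positivity)]
      exact hpt θ hθ
  refine ⟨hint, ?_⟩
  rw [circleAverage_def, smul_eq_mul, mul_assoc]
  refine mul_le_mul_of_nonneg_left ?_ (by positivity)
  have e1 : ∫ θ in (0 : ℝ)..2 * π, |Real.sin (θ - φ)| ^ (-α)
      = ∫ θ in (0 : ℝ)..2 * π, |Real.sin θ| ^ (-α) := by
    rw [intervalIntegral.integral_comp_sub_right (fun θ => |Real.sin θ| ^ (-α)) φ]
    have hper : Function.Periodic (fun θ : ℝ => |Real.sin θ| ^ (-α)) (2 * π) := by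
      intro θ; simp
    have := hper.intervalIntegral_add_eq (0 - φ) 0
    rw [zero_add] at this
    rw [← this]
    congr 1
    ring
  rw [← e1, mul_comm _ (r ^ (-α)), ← intervalIntegral.integral_const_mul]
  refine intervalIntegral.integral_mono_ae (by positivity) hint hI ?_
  filter_upwards [hae] with θ hθ using hpt θ hθ

end NegativePower

/-! ### Counting weights of divisors, and removal of zeros and poles by canonical factors. -/

section LogDerivLemma
open Complex Real Metric Set Filter Topology MeasureTheory Function.locallyFinsuppWithin

/-- The weight of a point `a` in the logarithmic counting function at radius `r`. -/
noncomputable def countingWeight (r : ℝ) (a : ℂ) : ℝ :=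
  if a = 0 then Real.log r else Real.log (r * ‖a‖⁻¹)

/-- The set `S` may be larger than the support. Several divisors can thus be written over one common
set and compared point by point. -/
theorem logCounting_eq_sum (D : Function.locallyFinsupp ℂ ℤ) {r : ℝ} (hr : 0 < r)
    (S : Finset ℂ) (hS : ∀ a ∈ S, ‖a‖ ≤ r) (hD : ∀ a, ‖a‖ ≤ r → D a ≠ 0 → a ∈ S) :
    logCounting D r = ∑ a ∈ S, (D a : ℝ) * countingWeight r a := by
  have hball : ∀ a : ℂ, ‖a‖ ≤ r ↔ a ∈ closedBall (0 : ℂ) |r| := by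
    intro a; simp [abs_of_pos hr]
  simp only [logCounting, AddMonoidHom.coe_mk, ZeroHom.coe_mk]
  rw [finsum_eq_sum_of_support_subset (s := S)]
  · have h1 : ∀ a ∈ S, (toClosedBall r D a : ℝ) * Real.log (r * ‖a‖⁻¹)
        = (D a : ℝ) * Real.log (r * ‖a‖⁻¹) := by
      intro a ha
      rw [toClosedBall_eval_within D ((hball a).1 (hS a ha))]
    rw [Finset.sum_congr rfl h1]
    by_cases h0 : (0 : ℂ) ∈ S
    · rw [← Finset.add_sum_erase S _ h0, ← Finset.add_sum_erase S _ h0]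
      have : ∀ a ∈ S.erase 0, (D a : ℝ) * countingWeight r a
          = (D a : ℝ) * Real.log (r * ‖a‖⁻¹) := by
        intro a ha
        rw [countingWeight, if_neg (Finset.ne_of_mem_erase ha)]
      rw [Finset.sum_congr rfl this]
      simp [countingWeight]
      ring
    · have hD0 : D 0 = 0 := by
        by_contra h
        exact h0 (hD 0 (by simpa using hr.le) h)
      rw [hD0]
      simp only [Int.cast_zero, zero_mul, add_zero]
      refine Finset.sum_congr rfl fun a ha => ?_
      rw [countingWeight, if_neg (by rintro rfl; exact h0 ha)]
  · intro a ha
    have h1 : toClosedBall r D a ≠ 0 := by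
      intro h
      simp [h] at ha
    have h2 := toClosedBall_support_subset_closedBall D (r := r) h1
    rw [toClosedBall_eval_within D h2] at h1
    exact hD a ((hball a).2 h2) h1

theorem countingWeight_nonneg {r : ℝ} (hr : 1 ≤ r) {a : ℂ} (ha : ‖a‖ ≤ r) :
    0 ≤ countingWeight r a := by
  rw [countingWeight]
  split_ifs with h
  · exact Real.log_nonneg hr
  · refine Real.log_nonneg ?_
    rw [← div_eq_mul_inv, one_le_div (norm_pos_iff.2 h)]
    exact ha

theorem log_div_le_countingWeight {r R : ℝ} (hr : 1 ≤ r) (hrR : r ≤ R) {a : ℂ} (ha : ‖a‖ ≤ r) :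
    Real.log (R / r) ≤ countingWeight R a := by
  have hr0 : 0 < r := by linarith
  have hR0 : 0 < R := by linarith
  rw [countingWeight]
  split_ifs with h
  · exact Real.log_le_log (by positivity) (div_le_self (by linarith) hr)
  · have := norm_pos_iff.2 h
    rw [← div_eq_mul_inv]
    exact Real.log_le_log (by positivity) (by gcongr)

theorem finite_support_closedBall (D : Function.locallyFinsupp ℂ ℤ) (r : ℝ) :
    ({a : ℂ | ‖a‖ ≤ r ∧ D a ≠ 0}).Finite := by
  have := D.locallyFiniteSupport.finite_inter_support_of_isCompact (isCompact_closedBall (0:ℂ) r)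
  refine this.subset fun a ha => ⟨by simpa using ha.1, ha.2⟩

/-- Each point of the smaller disk has weight at least `log (R / r)` in the counting function at
`R`. This turns a bound on the characteristic into a bound on the number of zeros and poles. -/
theorem sum_mul_log_le_logCounting {D : Function.locallyFinsupp ℂ ℤ} (hD : 0 ≤ D) {r R : ℝ}
    (hr : 1 ≤ r) (hrR : r ≤ R) (S : Finset ℂ) (hS : ∀ a ∈ S, ‖a‖ ≤ r) :
    (∑ a ∈ S, (D a : ℝ)) * Real.log (R / r) ≤ logCounting D R := by
  have hR : 0 < R := by linarith
  set S' := (finite_support_closedBall D R).toFinset ∪ S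
  have hS' : ∀ a ∈ S', ‖a‖ ≤ R := by
    intro a ha
    rcases Finset.mem_union.1 ha with h | h
    · simp at h; exact h.1
    · exact (hS a h).trans hrR
  rw [logCounting_eq_sum D hR S' hS' (fun a h1 h2 => Finset.mem_union_left _ (by simp [h1, h2])),
    Finset.sum_mul]
  have hD' : ∀ a, (0 : ℝ) ≤ D a := fun a => by exact_mod_cast hD a
  calc _ ≤ ∑ a ∈ S, (D a : ℝ) * countingWeight R a :=
        Finset.sum_le_sum fun a ha => mul_le_mul_of_nonneg_left
          (log_div_le_countingWeight hr hrR (hS a ha)) (hD' a)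
    _ ≤ _ := Finset.sum_le_sum_of_subset_of_nonneg Finset.subset_union_right
        fun a ha _ => mul_nonneg (hD' a) (countingWeight_nonneg (by linarith) (hS' a ha))

/-- The logarithmic derivative is an explicit sum of two simple poles, at `a` and at its reflection
in the circle. For `a = 0` the second term of the formula is absent, and the value `R ^ 2 / 0 = 0`
only weakens the bound. -/
theorem norm_logDeriv_canonicalFactor_le {R : ℝ} (hR : 0 < R) {a z : ℂ} (ha : a ∈ ball 0 R)
    (hz : z ∈ ball 0 R) (hza : z ≠ a) :
    ‖logDeriv (canonicalFactor R a) z‖ ≤ ‖z - a‖⁻¹ + ‖z - R ^ 2 / (starRingEnd ℂ) a‖⁻¹ := by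
  have haR : ‖a‖ < R := by simpa using ha
  have hzR : ‖z‖ < R := by simpa using hz
  have hza' : z - a ≠ 0 := sub_ne_zero.2 hza
  have hRC : (R : ℂ) ≠ 0 := by exact_mod_cast hR.ne'
  have hnum : (R : ℂ) ^ 2 - (starRingEnd ℂ) a * z ≠ 0 := by
    intro h
    have h1 : ‖(R : ℂ) ^ 2‖ = ‖(starRingEnd ℂ) a * z‖ := by rw [sub_eq_zero.1 h]
    rw [norm_pow, norm_mul, norm_real, Real.norm_of_nonneg hR.le, RCLike.norm_conj] at h1
    nlinarith [norm_nonneg a, norm_nonneg z]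
  have hd : HasDerivAt (canonicalFactor R a)
      (((-(starRingEnd ℂ) a) * (R * (z - a)) - (R ^ 2 - (starRingEnd ℂ) a * z) * R)
        / (R * (z - a)) ^ 2) z := by
    rw [canonicalFactor_def]
    have h1 : HasDerivAt (fun z : ℂ => (R : ℂ) ^ 2 - (starRingEnd ℂ) a * z)
        (-(starRingEnd ℂ) a) z := by
      simpa using ((hasDerivAt_id z).const_mul ((starRingEnd ℂ) a)).const_sub ((R : ℂ) ^ 2)
    have h2 : HasDerivAt (fun z : ℂ => (R : ℂ) * (z - a)) R z := by
      simpa using ((hasDerivAt_id z).sub_const a).const_mul (R : ℂ)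
    exact h1.div h2 (mul_ne_zero hRC hza')
  have e : logDeriv (canonicalFactor R a) z
      = -(z - a)⁻¹ - (starRingEnd ℂ) a / (R ^ 2 - (starRingEnd ℂ) a * z) := by
    rw [logDeriv_apply, hd.deriv, canonicalFactor_apply]
    field_simp
    ring
  rw [e]
  refine (norm_sub_le _ _).trans ?_
  rw [norm_neg, norm_inv]
  refine add_le_add_right ?_ _
  by_cases h0 : a = 0
  · subst h0; simp
  · have h0' : (starRingEnd ℂ) a ≠ 0 := by simpa using h0
    have : (starRingEnd ℂ) a / (R ^ 2 - (starRingEnd ℂ) a * z)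
        = -(z - R ^ 2 / (starRingEnd ℂ) a)⁻¹ := by
      rw [neg_inv, neg_sub, div_sub' h0', inv_div]
    rw [this, norm_neg, norm_inv]

/-- Splitting off the zeros and poles from a logarithmic derivative. -/
theorem exists_zeroFree_logDeriv_le {f : ℂ → ℂ} (hf : Meromorphic f)
    (hf' : ∀ z, meromorphicOrderAt f z ≠ ⊤) {R : ℝ} (hR : 0 < R)
    (hsph : ∀ z ∈ sphere (0 : ℂ) R, meromorphicOrderAt f z = 0) :
    ∃ g : ℂ → ℂ, AnalyticOnNhd ℂ g (closedBall 0 R) ∧ (∀ z ∈ closedBall 0 R, g z ≠ 0) ∧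
      circleAverage (fun z => |Real.log ‖g z‖|) 0 R
        = circleAverage (fun z => |Real.log ‖f z‖|) 0 R ∧
      ∃ S : Finset ℂ, (∀ a ∈ S, ‖a‖ < R) ∧
        ∀ᶠ z in codiscreteWithin (ball (0 : ℂ) R), ‖logDeriv f z‖ ≤ ‖logDeriv g z‖ +
          ∑ a ∈ S, |(MeromorphicOn.divisor f univ a : ℝ)| *
            (‖z - a‖⁻¹ + ‖z - R ^ 2 / (starRingEnd ℂ) a‖⁻¹) := by
  obtain ⟨g, hg⟩ := MeromorphicOn.exists_canonicalDecomp (R := R)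
    (fun z _ => hf z) (fun u => hf' u)
  have hfb : MeromorphicOn f (closedBall 0 R) := fun z _ => hf z
  have hord : ∀ z ∈ closedBall (0 : ℂ) R, g z ≠ 0 := by
    intro z hz
    by_cases hzb : z ∈ ball (0 : ℂ) R
    · exact hg.ne_zero z hzb
    · have hzs : z ∈ sphere (0 : ℂ) R := by
        simp at hz hzb ⊢; linarith
      have h1 := hg.divisor_eq_divisor hR (x := z)
      rw [MeromorphicOn.divisor_apply hg.meromorphicNFOn.meromorphicOn hz,
        MeromorphicOn.divisor_apply (fun z _ => hf z) hzs, hsph z hzs] at h1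
      have h2 : meromorphicOrderAt g z = 0 ∨ meromorphicOrderAt g z = ⊤ := by
        simpa using h1
      rcases h2 with h2 | h2
      · exact (hg.meromorphicNFOn hz).meromorphicOrderAt_eq_zero_iff.1 h2
      · exfalso
        have hcl : IsConnected (closedBall (0 : ℂ) R) :=
          ⟨⟨0, by simp [hR.le]⟩, (convex_closedBall _ _).isPreconnected⟩
        have := (hg.meromorphicNFOn.meromorphicOn.meromorphicOrderAt_ne_top_of_isPreconnected
          (x := 0) (y := z) hcl.isPreconnected (by simp [hR.le]) hz) ?_
        · exact this h2
        · rw [(hg.meromorphicNFOn (show (0 : ℂ) ∈ closedBall 0 R by simp [hR.le])).meromorphicOrderAt_eq_zero_iff.2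
            (hg.ne_zero 0 (by simp [hR]))]
          simp
  have han : AnalyticOnNhd ℂ g (closedBall 0 R) := by
    intro z hz
    refine (hg.meromorphicNFOn hz).meromorphicOrderAt_nonneg_iff_analyticAt.1 ?_
    rw [(hg.meromorphicNFOn hz).meromorphicOrderAt_eq_zero_iff.2 (hord z hz)]
  set F := MeromorphicOn.divisor f (ball (0 : ℂ) R) with hF
  have hfin : F.support.Finite := hfb.divisor_ball_support_finite
  have hFball : ∀ a, F a ≠ 0 → a ∈ ball (0 : ℂ) R := fun a ha => F.supportWithinDomain ha
  -- A canonical factor has a simple pole at its parameter, hence the exponent `-F u`. All factors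
  -- have modulus one on the circle of radius `R`, so the average of `|log ‖f‖|` there equals that
  -- of `|log ‖g‖|`.
  set P : ℂ → ℂ := ∏ᶠ u, (canonicalFactor R u) ^ (-F u) with hP
  have hPprod : P = ∏ u ∈ hfin.toFinset, (canonicalFactor R u) ^ (-F u) := by
    rw [hP, finprod_eq_prod_of_mulSupport_subset_of_finite _ _ hfin]
    intro u hu
    simp only [Function.mem_mulSupport] at hu
    simp only [Function.mem_support]
    intro h
    exact hu (by simp [h])
  refine ⟨g, han, hord, ?_, hfin.toFinset, ?_, ?_⟩
  · refine circleAverage_congr_codiscreteWithin ?_ hR.ne'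
    have h1 := hg.eventuallyEq.filter_mono
      (codiscreteWithin_mono (U₁ := sphere (0 : ℂ) |R|) (by
        rw [abs_of_pos hR]; exact sphere_subset_closedBall))
    filter_upwards [h1, self_mem_codiscreteWithin (sphere (0 : ℂ) |R|)] with z hz hzs
    rw [abs_of_pos hR] at hzs
    have hPz : ‖P z‖ = 1 := by
      rw [hPprod, Finset.prod_apply, norm_prod]
      refine Finset.prod_eq_one fun u hu => ?_
      rw [Pi.pow_apply, norm_zpow, norm_canonicalFactor_eval_circle_eq_one
        (hFball u (by simpa using hu)) hzs, one_zpow]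
    rw [hz, Pi.smul_apply', smul_eq_mul, norm_mul]
    change _ = |Real.log (‖P z‖ * _)|
    rw [hPz, one_mul]
  · intro a ha
    simpa using hFball a (by simpa using ha)
  · have h1 := logDeriv_congr_codiscreteWithin isOpen_ball (hg.eventuallyEq.filter_mono
      (codiscreteWithin_mono (U₁ := ball (0 : ℂ) R) ball_subset_closedBall))
    have hout : ∀ᶠ z in codiscreteWithin (ball (0 : ℂ) R), z ∉ hfin.toFinset := by
      have := (hfin.toFinset.finite_toSet.compl_mem_codiscrete)
      exact (codiscreteWithin_mono (subset_univ _)) this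
    filter_upwards [h1, hout, self_mem_codiscreteWithin (ball (0 : ℂ) R)] with z hz hzS hzb
    rw [hz]
    have hcan : ∀ u ∈ hfin.toFinset, canonicalFactor R u z ≠ 0 := by
      intro u hu
      exact canonicalFactor_ne_zero (hFball u (by simpa using hu)) (ball_subset_closedBall hzb)
        (by rintro rfl; exact hzS hu)
    have hcand : ∀ u ∈ hfin.toFinset, DifferentiableAt ℂ (canonicalFactor R u) z := by
      intro u hu
      exact (analyticOnNhd_canonicalFactor R u z (by rintro rfl; exact hzS hu)).differentiableAt
    have hPd : ∀ u ∈ hfin.toFinset, DifferentiableAt ℂ (canonicalFactor R u ^ (-F u)) z :=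
      fun u hu => (hcand u hu).zpow (Or.inl (hcan u hu))
    have hP0 : ∀ u ∈ hfin.toFinset, (canonicalFactor R u ^ (-F u)) z ≠ 0 :=
      fun u hu => zpow_ne_zero _ (hcan u hu)
    have hgd : DifferentiableAt ℂ g z := (han z (ball_subset_closedBall hzb)).differentiableAt
    have e : logDeriv (P • g) z
        = (∑ u ∈ hfin.toFinset, ((-F u : ℤ) : ℂ) * logDeriv (canonicalFactor R u) z)
          + logDeriv g z := by
      rw [hPprod, smul_eq_mul]
      have := logDeriv_mul (f := ∏ u ∈ hfin.toFinset, (canonicalFactor R u) ^ (-F u)) (g := g) z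
        (by rw [Finset.prod_apply]; exact Finset.prod_ne_zero_iff.2 hP0)
        (hord z (ball_subset_closedBall hzb)) (by
          rw [show (∏ u ∈ hfin.toFinset, (canonicalFactor R u) ^ (-F u))
            = fun z => ∏ u ∈ hfin.toFinset, ((canonicalFactor R u) ^ (-F u)) z by
              ext z; simp]
          exact DifferentiableAt.fun_finsetProd hPd) hgd
      have e1 : (fun z => (∏ u ∈ hfin.toFinset, (canonicalFactor R u) ^ (-F u)) z * g z)
        = (∏ u ∈ hfin.toFinset, (canonicalFactor R u) ^ (-F u)) * g := rfl
      rw [← e1, this]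
      congr 1
      have e2 := logDeriv_prod (s := hfin.toFinset)
        (f := fun u => canonicalFactor R u ^ (-F u)) (x := z) hP0 hPd
      rw [show (∏ u ∈ hfin.toFinset, (canonicalFactor R u) ^ (-F u))
        = fun z => ∏ u ∈ hfin.toFinset, ((canonicalFactor R u) ^ (-F u)) z by
              ext z; simp]
      rw [e2]
      refine Finset.sum_congr rfl fun u hu => ?_
      exact logDeriv_fun_zpow (hcand u hu) _
    change ‖logDeriv (P • g) z‖ ≤ _
    rw [e, add_comm]
    refine (norm_add_le _ _).trans (add_le_add_right ((norm_sum_le _ _).trans ?_) _)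
    refine Finset.sum_le_sum fun u hu => ?_
    have hub := hFball u (by simpa using hu)
    have hdiv : F u = MeromorphicOn.divisor f univ u := by
      rw [hF, MeromorphicOn.divisor_apply (fun z _ => hf z) hub,
        MeromorphicOn.divisor_apply (fun z _ => hf z) (mem_univ u)]
    rw [norm_mul, Complex.norm_intCast, ← hdiv]
    push_cast
    rw [abs_neg]
    exact mul_le_mul_of_nonneg_left (norm_logDeriv_canonicalFactor_le hR hub hzb
      (by rintro rfl; exact hzS hu)) (abs_nonneg _)

end LogDerivLemma

/-! ### The lemma on the logarithmic derivative. -/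

section LogDerivEstimate
open Complex Real Metric Set Filter Topology MeasureTheory ValueDistribution

/-- Off a discrete subset of the circle `u` coincides with `min u v`, which lies below `v`
everywhere; averages do not notice the discrete set. -/
theorem circleAverage_mono_codiscreteWithin {u v : ℂ → ℝ} {c : ℂ} {R : ℝ} (hR : R ≠ 0)
    (hu : CircleIntegrable u c R) (hv : CircleIntegrable v c R)
    (h : ∀ᶠ z in codiscreteWithin (sphere c |R|), u z ≤ v z) :
    circleAverage u c R ≤ circleAverage v c R := by
  classical
  have he : u =ᶠ[codiscreteWithin (sphere c |R|)] fun z => min (u z) (v z) := by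
    filter_upwards [h] with z hz using (min_eq_left hz).symm
  rw [circleAverage_congr_codiscreteWithin he hR]
  exact circleAverage_mono (hu.congr_codiscreteWithin he) hv fun z _ => min_le_right _ _

theorem add_rpow_le_rpow_add_rpow {a b p : ℝ} (ha : 0 ≤ a) (hb : 0 ≤ b) (hp : 0 ≤ p)
    (hp1 : p ≤ 1) : (a + b) ^ p ≤ a ^ p + b ^ p := by
  have := NNReal.rpow_add_le_add_rpow ⟨a, ha⟩ ⟨b, hb⟩ hp hp1
  exact_mod_cast this

theorem sum_rpow_le {ι : Type*} (S : Finset ι) (x : ι → ℝ) (hx : ∀ i ∈ S, 0 ≤ x i) {p : ℝ}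
    (hp : 0 < p) (hp1 : p ≤ 1) : (∑ i ∈ S, x i) ^ p ≤ ∑ i ∈ S, x i ^ p := by
  classical
  induction S using Finset.induction_on with
  | empty => simp [Real.zero_rpow hp.ne']
  | insert a s ha ih =>
    rw [Finset.sum_insert ha, Finset.sum_insert ha]
    refine (add_rpow_le_rpow_add_rpow (hx a (Finset.mem_insert_self _ _))
      (Finset.sum_nonneg fun i hi => hx i (Finset.mem_insert_of_mem hi)) hp.le hp1).trans ?_
    exact add_le_add_right (ih fun i hi => hx i (Finset.mem_insert_of_mem hi)) _

theorem posLog_le_inv_mul_log {t α : ℝ} (ht : 0 ≤ t) (hα : 0 < α) :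
    log⁺ t ≤ α⁻¹ * Real.log (1 + t ^ α) := by
  have h0 : 0 ≤ t ^ α := Real.rpow_nonneg ht _
  rcases le_or_gt t 1 with h | h
  · rw [(posLog_eq_zero_iff t).2 (by rwa [abs_of_nonneg ht])]
    exact mul_nonneg (by positivity) (Real.log_nonneg (by linarith))
  · rw [posLog_eq_log (by rw [abs_of_nonneg ht]; exact h.le)]
    have h1 : Real.log t = α⁻¹ * Real.log (t ^ α) := by
      rw [Real.log_rpow (by linarith)]; field_simp
    rw [h1]
    have : 0 < t ^ α := Real.rpow_pos_of_pos (by linarith) _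
    gcongr
    linarith

/-- Multiplicities are integers, so a nonzero one has modulus at least one. Hence passing to the
power `α` costs nothing. -/
theorem rpow_le_self_of_int {n : ℤ} {α : ℝ} (h0 : 0 < α) (h1 : α ≤ 1) :
    |(n : ℝ)| ^ α ≤ |(n : ℝ)| := by
  rcases eq_or_ne n 0 with rfl | h
  · simp [Real.zero_rpow h0.ne']
  · have : (1 : ℝ) ≤ |(n : ℝ)| := by exact_mod_cast Int.one_le_abs h
    calc |(n : ℝ)| ^ α ≤ |(n : ℝ)| ^ (1 : ℝ) := Real.rpow_le_rpow_of_exponent_le this h1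
      _ = _ := Real.rpow_one _

theorem rpow_le_one_add {x α : ℝ} (hx : 0 ≤ x) (h0 : 0 < α) (h1 : α ≤ 1) : x ^ α ≤ 1 + x := by
  rcases le_or_gt x 1 with h | h
  · have := Real.rpow_le_one hx h h0.le
    linarith
  · calc x ^ α ≤ x ^ (1 : ℝ) := Real.rpow_le_rpow_of_exponent_le h.le h1
      _ = x := Real.rpow_one _
      _ ≤ _ := by linarith

/-- Concavity of the logarithm, in the form of a tangent inequality. -/
theorem log_le_log_add_div_sub_one {y M : ℝ} (hy : 0 < y) (hM : 0 < M) :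
    Real.log y ≤ Real.log M + y / M - 1 := by
  have := Real.log_le_sub_one_of_pos (div_pos hy hM)
  rw [Real.log_div hy.ne' hM.ne'] at this
  linarith

theorem circleAverage_abs_log_norm {f : ℂ → ℂ} (hf : Meromorphic f) (R : ℝ) :
    circleAverage (fun z => |Real.log ‖f z‖|) 0 R = proximity f ⊤ R + proximity f⁻¹ ⊤ R := by
  rw [proximity_top, proximity_top]
  have h1 : CircleIntegrable (fun z => log⁺ ‖f z‖) 0 R :=
    MeromorphicOn.circleIntegrable_posLog_norm fun z _ => hf z
  have h2 : CircleIntegrable (fun z => log⁺ ‖f⁻¹ z‖) 0 R :=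
    MeromorphicOn.circleIntegrable_posLog_norm fun z _ => hf.inv z
  have := circleAverage_fun_add h1 h2
  rw [← this]
  congr 1
  ext z
  rw [Pi.inv_apply, norm_inv]
  have a := half_mul_log_add_log_abs (x := ‖f z‖)
  have b := half_mul_log_add_log_abs (x := ‖f z‖⁻¹)
  rw [Real.log_inv, abs_neg] at b
  linarith

/-- The first main theorem at the value zero, in the only form needed: inversion changes the
characteristic by a bounded amount. -/
theorem exists_characteristic_inv_le {f : ℂ → ℂ} (hf : Meromorphic f) :
    ∃ c : ℝ, 0 ≤ c ∧ ∀ r, characteristic f⁻¹ ⊤ r ≤ characteristic f ⊤ r + c := by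
  refine ⟨max |Real.log ‖f 0‖| |Real.log ‖meromorphicTrailingCoeffAt f 0‖|, by positivity,
    fun r => ?_⟩
  have := characteristic_sub_characteristic_inv_le hf (R := r)
  have := (abs_le.1 this).1
  linarith

theorem sum_abs_divisor_mul_log_le {f : ℂ → ℂ} {r R : ℝ}
    (hr : 1 ≤ r) (hrR : r ≤ R) (S : Finset ℂ) (hS : ∀ a ∈ S, ‖a‖ ≤ r) :
    (∑ a ∈ S, |(MeromorphicOn.divisor f univ a : ℝ)|) * Real.log (R / r) ≤
      logCounting f ⊤ R + logCounting f⁻¹ ⊤ R := by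
  rw [logCounting_inv, logCounting_zero, logCounting_top]
  have h1 := sum_mul_log_le_logCounting
    (D := (MeromorphicOn.divisor f univ)⁺) (posPart_nonneg _) hr hrR S hS
  have h2 := sum_mul_log_le_logCounting
    (D := (MeromorphicOn.divisor f univ)⁻) (negPart_nonneg _) hr hrR S hS
  refine le_trans (le_of_eq ?_) (add_le_add h2 h1)
  rw [← add_mul, ← Finset.sum_add_distrib]
  congr 1
  refine Finset.sum_congr rfl fun a _ => ?_
  rw [Function.locallyFinsuppWithin.posPart_apply, Function.locallyFinsuppWithin.negPart_apply]
  rw [← Int.cast_add, add_comm, posPart_add_negPart]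
  simp

/-- The lemma on the logarithmic derivative. -/
theorem exists_proximity_logDeriv_le {f : ℂ → ℂ} (hf : Meromorphic f)
    (hf' : ∀ z, meromorphicOrderAt f z ≠ ⊤) {α : ℝ} (h0 : 0 < α) (h1 : α < 1) :
    ∃ K : ℝ, 0 ≤ K ∧ ∀ r R' : ℝ, 1 ≤ r → r < R' →
      proximity (logDeriv f) ⊤ r ≤ α⁻¹ * Real.log (2 + K * (characteristic f ⊤ R' + 1) *
        (1 + R' * r ^ (-α)) / (R' - r)) := by
  obtain ⟨C, hC0, hC⟩ := exists_circleAverage_norm_sub_rpow_neg_le h0 h1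
  obtain ⟨c, hc0, hc⟩ := exists_characteristic_inv_le hf
  -- The product `(2 + c) * (T + 1)` bounds both the average of `|log ‖f‖|` and the total count of
  -- zeros and poles. The zero-free part contributes the factor `6 / δ`, and the poles contribute `3
  -- R' / δ` times `2 C`.
  refine ⟨(2 + c) * (6 + 6 * C), by positivity, fun r R' hr hrR' => ?_⟩
  have hr0 : 0 < r := by linarith
  set δ := R' - r with hδ
  have hδ0 : 0 < δ := sub_pos.2 hrR'
  have hR'0 : 0 < R' := by linarith
  set T := characteristic f ⊤ R' with hT
  have hT0 : 0 ≤ T := characteristic_nonneg (by linarith)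
  -- a good radius
  obtain ⟨R, hRI, hRgood⟩ : ∃ R ∈ Ioo (r + δ / 3) (r + 2 * δ / 3),
      ∀ z ∈ sphere (0 : ℂ) R, meromorphicOrderAt f z = 0 := by
    have hfin := (finite_support_closedBall (MeromorphicOn.divisor f univ) R').image
      (fun a : ℂ => ‖a‖)
    obtain ⟨R, hR, hRn⟩ := ((Ioo_infinite (show r + δ / 3 < r + 2 * δ / 3 by linarith)).sdiff
      hfin).nonempty
    refine ⟨R, hR, fun z hz => ?_⟩
    by_contra hne
    refine hRn ⟨z, ⟨?_, ?_⟩, by simpa using hz⟩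
    · rw [mem_sphere_zero_iff_norm.1 hz]
      have := hR.2
      linarith
    · rw [MeromorphicOn.divisor_apply (fun z _ => hf z) (mem_univ z)]
      intro h
      rcases (WithTop.untop₀_eq_zero).1 h with h | h
      · exact hne h
      · exact hf' z h
  have hrR : r < R := by have := hRI.1; linarith
  have hRR' : R < R' := by have := hRI.2; linarith
  have hR0 : 0 < R := by linarith
  have hR1 : 1 ≤ R := by linarith
  obtain ⟨g, hg, hg0, hgf, S, hS, hbound⟩ := exists_zeroFree_logDeriv_le hf hf' hR0 hRgood
  set n : ℂ → ℝ := fun a => |(MeromorphicOn.divisor f univ a : ℝ)| with hn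
  have hn0 : ∀ a, 0 ≤ n a := fun a => abs_nonneg _
  have hTR : characteristic f ⊤ R ≤ T :=
    characteristic_monotoneOn hf (mem_Ioi.2 hR0) (mem_Ioi.2 (by linarith)) hRR'.le
  -- the average of `|log |f||`
  have hE : circleAverage (fun z => |Real.log ‖g z‖|) 0 R ≤ (2 + c) * (T + 1) := by
    rw [hgf, circleAverage_abs_log_norm hf]
    have a1 : proximity f ⊤ R ≤ characteristic f ⊤ R := by
      simp only [characteristic, Pi.add_apply]
      have := logCounting_nonneg (f := f) (e := ⊤) hR1
      linarith
    have a2 : proximity f⁻¹ ⊤ R ≤ characteristic f⁻¹ ⊤ R := by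
      simp only [characteristic, Pi.add_apply]
      have := logCounting_nonneg (f := f⁻¹) (e := ⊤) hR1
      linarith
    have := hc R
    nlinarith
  -- the number of zeros and poles
  have hN : ∑ a ∈ S, n a ≤ 3 * R' / δ * ((2 + c) * (T + 1)) := by
    have h2 := sum_abs_divisor_mul_log_le (f := f) hR1 hRR'.le S (fun a ha => (hS a ha).le)
    have a1 : logCounting f ⊤ R' ≤ T := by
      simp only [hT, characteristic, Pi.add_apply]
      have := proximity_nonneg (f := f) (a := ⊤) R'
      simp only [Pi.zero_apply] at this
      linarith
    have a2 : logCounting f⁻¹ ⊤ R' ≤ T + c := by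
      refine le_trans ?_ (hc R')
      simp only [characteristic, Pi.add_apply]
      have := proximity_nonneg (f := f⁻¹) (a := ⊤) R'
      simp only [Pi.zero_apply] at this
      linarith
    -- The radius `R` stays at least `δ / 3` below `R'`, so zeros and poles in the disk of radius
    -- `R` carry a definite weight at `R'`.
    have a3 : δ / (3 * R') ≤ Real.log (R' / R) := by
      have := Real.one_sub_inv_le_log_of_pos (show 0 < R' / R by positivity)
      refine le_trans ?_ this
      rw [inv_div, div_le_iff₀ (by linarith)]
      have h3 := hRI.2
      have : (1 - R / R') * (3 * R') = 3 * R' - 3 * R := by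
        field_simp
      rw [this]
      linarith
    have hsum0 : 0 ≤ ∑ a ∈ S, n a := Finset.sum_nonneg fun a _ => hn0 a
    have a4 : (∑ a ∈ S, n a) * (δ / (3 * R')) ≤ (2 + c) * (T + 1) := by
      refine (mul_le_mul_of_nonneg_left a3 hsum0).trans (h2.trans ?_)
      nlinarith
    have hp : 0 < δ / (3 * R') := by positivity
    calc ∑ a ∈ S, n a = 3 * R' / δ * ((∑ a ∈ S, n a) * (δ / (3 * R'))) := by
          field_simp
      _ ≤ _ := by gcongr
  -- `Y` majorizes `1 + ‖logDeriv f‖ ^ α` off a discrete set. The exponent `α < 1` turns the simple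
  -- poles into integrable singularities whose averages do not depend on their position.
  set Y : ℂ → ℝ := fun z => 2 + ‖logDeriv g z‖ +
    ∑ a ∈ S, n a * (‖z - a‖ ^ (-α) + ‖z - R ^ 2 / (starRingEnd ℂ) a‖ ^ (-α)) with hY
  have hlogc : ContinuousOn (logDeriv g) (sphere 0 r) := by
    intro z hz
    have hzc : z ∈ closedBall (0 : ℂ) R := by
      simp at hz ⊢; linarith
    exact (((hg z hzc).deriv.div (hg z hzc) (hg0 z hzc)).continuousAt).continuousWithinAt
  have hI1 : CircleIntegrable (fun z => ‖logDeriv g z‖) 0 r :=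
    hlogc.norm.circleIntegrable hr0.le
  have hIa : ∀ a : ℂ, CircleIntegrable (fun z => ‖z - a‖ ^ (-α)) 0 r := fun a => (hC a r hr0).1
  have hI2' : ∀ a ∈ S, CircleIntegrable (fun z => n a * (‖z - a‖ ^ (-α) +
      ‖z - R ^ 2 / (starRingEnd ℂ) a‖ ^ (-α))) 0 r := fun a _ =>
    ((hIa a).add (hIa _)).const_mul (n a)
  have hI2 : CircleIntegrable (fun z => ∑ a ∈ S, n a * (‖z - a‖ ^ (-α) +
      ‖z - R ^ 2 / (starRingEnd ℂ) a‖ ^ (-α))) 0 r := CircleIntegrable.fun_sum S hI2'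
  have hIc : CircleIntegrable (fun z => 2 + ‖logDeriv g z‖) 0 r :=
    (circleIntegrable_const 2 0 r).add hI1
  have hIY : CircleIntegrable Y 0 r := hIc.add hI2
  set M : ℝ := 2 + (2 + c) * (6 + 6 * C) * (T + 1) * (1 + R' * r ^ (-α)) / δ with hM
  have hrα : 0 < r ^ (-α) := Real.rpow_pos_of_pos hr0 _
  have hMpos : 0 < M := by positivity
  have hEY : circleAverage Y 0 r ≤ M := by
    have e : circleAverage Y 0 r = 2 + circleAverage (fun z => ‖logDeriv g z‖) 0 r +
        ∑ a ∈ S, n a * (circleAverage (fun z => ‖z - a‖ ^ (-α)) 0 r +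
          circleAverage (fun z => ‖z - R ^ 2 / (starRingEnd ℂ) a‖ ^ (-α)) 0 r) := by
      rw [hY, circleAverage_fun_add hIc hI2, circleAverage_fun_add (circleIntegrable_const 2 0 r) hI1,
        circleAverage_const, circleAverage_fun_sum hI2']
      congr 1
      refine Finset.sum_congr rfl fun a _ => ?_
      have := circleAverage_fun_smul (a := n a) (f := fun z : ℂ => ‖z - a‖ ^ (-α) +
        ‖z - R ^ 2 / (starRingEnd ℂ) a‖ ^ (-α)) (c := 0) (R := r)
      simp only [smul_eq_mul] at this
      rw [this, circleAverage_fun_add (hIa a) (hIa _)]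
    rw [e]
    have b1 := circleAverage_norm_logDeriv_le_of_ne_zero hr0.le hrR hg hg0
    have b2 : 2 * R / (R ^ 2 - r ^ 2) ≤ 6 / δ := by
      have h3 := hRI.1
      rw [div_le_div_iff₀ (by nlinarith) hδ0]
      nlinarith
    have hB : 0 ≤ (2 + c) * (T + 1) := by positivity
    have b3 : circleAverage (fun z => ‖logDeriv g z‖) 0 r ≤ 6 / δ * ((2 + c) * (T + 1)) := by
      refine b1.trans ?_
      refine (mul_le_mul_of_nonneg_left hE (div_nonneg (by linarith) (by nlinarith))).trans ?_
      exact mul_le_mul_of_nonneg_right b2 hB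
    have b4 : ∑ a ∈ S, n a * (circleAverage (fun z => ‖z - a‖ ^ (-α)) 0 r +
          circleAverage (fun z => ‖z - R ^ 2 / (starRingEnd ℂ) a‖ ^ (-α)) 0 r)
        ≤ 3 * R' / δ * ((2 + c) * (T + 1)) * (2 * C * r ^ (-α)) := by
      refine le_trans ?_ (mul_le_mul_of_nonneg_right hN (by positivity))
      rw [Finset.sum_mul]
      refine Finset.sum_le_sum fun a _ => mul_le_mul_of_nonneg_left ?_ (hn0 a)
      have := (hC a r hr0).2
      have := (hC (R ^ 2 / (starRingEnd ℂ) a) r hr0).2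
      linarith
    have b5 : M = 2 + 6 / δ * ((2 + c) * (T + 1)) +
        3 * R' / δ * ((2 + c) * (T + 1)) * (2 * C * r ^ (-α)) +
        ((2 + c) * (T + 1)) * (6 * C + 6 * (R' * r ^ (-α))) / δ := by
      rw [hM]; field_simp; ring
    have b6 : 0 ≤ ((2 + c) * (T + 1)) * (6 * C + 6 * (R' * r ^ (-α))) / δ := by positivity
    linarith
  have hYpos : ∀ z, 0 < Y z := by
    intro z
    have : 0 ≤ ∑ a ∈ S, n a * (‖z - a‖ ^ (-α) + ‖z - R ^ 2 / (starRingEnd ℂ) a‖ ^ (-α)) :=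
      Finset.sum_nonneg fun a _ => mul_nonneg (hn0 a) (add_nonneg
        (Real.rpow_nonneg (norm_nonneg _) _) (Real.rpow_nonneg (norm_nonneg _) _))
    have := norm_nonneg (logDeriv g z)
    simp only [hY]
    linarith
  -- The tangent of the logarithm at `M` takes the place of Jensen's inequality for concave
  -- functions: its average is at most `log M`, since the average of `Y` is at most `M`.
  have hpt : ∀ᶠ z in codiscreteWithin (sphere (0 : ℂ) |r|), log⁺ ‖logDeriv f z‖ ≤
      α⁻¹ * (Real.log M + Y z / M - 1) := by
    have := hbound.filter_mono (codiscreteWithin_mono (U₁ := sphere (0 : ℂ) |r|) (by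
      rw [abs_of_pos hr0]
      exact sphere_subset_closedBall.trans (closedBall_subset_ball hrR)))
    filter_upwards [this] with z hz
    refine (posLog_le_inv_mul_log (norm_nonneg _) h0).trans ?_
    refine mul_le_mul_of_nonneg_left ?_ (by positivity)
    refine le_trans ?_ (log_le_log_add_div_sub_one (hYpos z) hMpos)
    refine Real.log_le_log (by positivity) ?_
    have hterm : ∀ a ∈ S, 0 ≤ n a * (‖z - a‖⁻¹ + ‖z - R ^ 2 / (starRingEnd ℂ) a‖⁻¹) :=
      fun a _ => mul_nonneg (hn0 a) (by positivity)
    have c1 : ‖logDeriv f z‖ ^ α ≤ (‖logDeriv g z‖ +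
        ∑ a ∈ S, n a * (‖z - a‖⁻¹ + ‖z - R ^ 2 / (starRingEnd ℂ) a‖⁻¹)) ^ α :=
      Real.rpow_le_rpow (norm_nonneg _) hz h0.le
    have c2 := add_rpow_le_rpow_add_rpow (norm_nonneg (logDeriv g z))
      (Finset.sum_nonneg hterm) h0.le h1.le
    have c3 := sum_rpow_le S _ hterm h0 h1.le
    have c4 : ∑ a ∈ S, (n a * (‖z - a‖⁻¹ + ‖z - R ^ 2 / (starRingEnd ℂ) a‖⁻¹)) ^ α ≤
        ∑ a ∈ S, n a * (‖z - a‖ ^ (-α) + ‖z - R ^ 2 / (starRingEnd ℂ) a‖ ^ (-α)) := by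
      refine Finset.sum_le_sum fun a _ => ?_
      rw [Real.mul_rpow (hn0 a) (by positivity)]
      refine mul_le_mul (rpow_le_self_of_int h0 h1.le) ?_ (by positivity) (hn0 a)
      refine (add_rpow_le_rpow_add_rpow (by positivity) (by positivity) h0.le h1.le).trans ?_
      rw [Real.inv_rpow (norm_nonneg _), Real.inv_rpow (norm_nonneg _),
        Real.rpow_neg (norm_nonneg _), Real.rpow_neg (norm_nonneg _)]
    have c5 := rpow_le_one_add (norm_nonneg (logDeriv g z)) h0 h1.le
    simp only [hY]
    linarith
  have hIr : CircleIntegrable (fun z => α⁻¹ * (Real.log M + Y z / M - 1)) 0 r := by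
    have : CircleIntegrable (fun z => Real.log M + Y z / M - 1) 0 r := by
      have h2 : CircleIntegrable (fun z => Y z / M) 0 r := by
        have h3 : CircleIntegrable (fun z => M⁻¹ * Y z) 0 r := hIY.const_mul (M⁻¹)
        simpa only [div_eq_inv_mul] using h3
      exact ((circleIntegrable_const _ 0 r).add h2).sub (circleIntegrable_const _ 0 r)
    exact this.const_mul _
  have hfin := circleAverage_mono_codiscreteWithin hr0.ne'
    (MeromorphicOn.circleIntegrable_posLog_norm (fun z _ => hf.logDeriv z)) hIr hpt
  rw [proximity_top]
  refine hfin.trans ?_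
  have e : circleAverage (fun z => α⁻¹ * (Real.log M + Y z / M - 1)) 0 r
      = α⁻¹ * (Real.log M + circleAverage Y 0 r / M - 1) := by
    have h2 : CircleIntegrable (fun z => M⁻¹ * Y z) 0 r := hIY.const_mul (M⁻¹)
    have e1 : (fun z => α⁻¹ * (Real.log M + Y z / M - 1))
        = fun z => α⁻¹ • ((Real.log M - 1) + M⁻¹ • Y z) := by
      ext z; simp only [smul_eq_mul]; ring
    rw [e1, circleAverage_fun_smul, circleAverage_fun_add (circleIntegrable_const _ 0 r)
      (by simpa using h2), circleAverage_const, circleAverage_fun_smul]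
    simp only [smul_eq_mul]
    ring
  rw [e]
  refine mul_le_mul_of_nonneg_left ?_ (by positivity)
  have : circleAverage Y 0 r / M ≤ 1 := (div_le_one hMpos).2 hEY
  linarith

end LogDerivEstimate

/-! ### The differential field of meromorphic functions on the plane. -/

section MeromorphicField
open Filter Topology ValueDistribution

theorem eventually_codiscrete_iff {p : ℂ → Prop} :
    (∀ᶠ z in codiscrete ℂ, p z) ↔ ∀ x, ∀ᶠ z in 𝓝[≠] x, p z := by
  rw [Filter.Eventually, codiscrete, mem_codiscreteWithin_iff_forall_mem_nhdsNE]
  simp only [Set.compl_univ, Set.union_empty, Set.mem_univ, true_imp_iff]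
  rfl

instance : (codiscrete ℂ).NeBot := by
  refine ⟨fun h => ?_⟩
  have h1 : ∀ᶠ z in codiscrete ℂ, False := by rw [h]; trivial
  exact (eventually_codiscrete_iff.1 h1 0).exists.choose_spec

/-- Meromorphic functions on the plane, up to equality outside a closed discrete set. -/
noncomputable def meromorphicGerms : Subring ((codiscrete ℂ).Germ ℂ) where
  carrier := {φ | ∃ f : ℂ → ℂ, Meromorphic f ∧ φ = (f : (codiscrete ℂ).Germ ℂ)}
  mul_mem' := by
    rintro _ _ ⟨f, hf, rfl⟩ ⟨g, hg, rfl⟩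
    exact ⟨f * g, hf.mul hg, rfl⟩
  one_mem' := ⟨fun _ => 1, Meromorphic.const 1, rfl⟩
  add_mem' := by
    rintro _ _ ⟨f, hf, rfl⟩ ⟨g, hg, rfl⟩
    exact ⟨f + g, hf.add hg, rfl⟩
  zero_mem' := ⟨fun _ => 0, Meromorphic.const 0, rfl⟩
  neg_mem' := by
    rintro _ ⟨f, hf, rfl⟩
    exact ⟨-f, hf.neg, rfl⟩

/-- The field of meromorphic functions on the plane. -/
abbrev MerField : Type := meromorphicGerms

/-- The class of a meromorphic function. -/
noncomputable def Meromorphic.germ {f : ℂ → ℂ} (hf : Meromorphic f) : MerField := ⟨f, f, hf, rfl⟩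

namespace MerField

theorem exists_germ (x : MerField) : ∃ (f : ℂ → ℂ) (hf : Meromorphic f), x = hf.germ := by
  obtain ⟨_, f, hf, rfl⟩ := x
  exact ⟨f, hf, rfl⟩

theorem germ_eq_iff {f g : ℂ → ℂ} (hf : Meromorphic f) (hg : Meromorphic g) :
    hf.germ = hg.germ ↔ f =ᶠ[codiscrete ℂ] g := by
  rw [Subtype.ext_iff]
  exact Germ.coe_eq

theorem germ_add {f g : ℂ → ℂ} (hf : Meromorphic f) (hg : Meromorphic g) :
    hf.germ + hg.germ = (hf.add hg).germ := rfl

theorem germ_mul {f g : ℂ → ℂ} (hf : Meromorphic f) (hg : Meromorphic g) :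
    hf.germ * hg.germ = (hf.mul hg).germ := rfl

theorem germ_neg {f : ℂ → ℂ} (hf : Meromorphic f) : -hf.germ = hf.neg.germ := rfl

/-- The plane is connected, so infinite order at a single point spreads to all points. This is what
makes nonzero germs invertible. -/
theorem meromorphicOrderAt_ne_top {f : ℂ → ℂ} (hf : Meromorphic f) (h : ¬ f =ᶠ[codiscrete ℂ] 0)
    (z : ℂ) : meromorphicOrderAt f z ≠ ⊤ := by
  intro hz
  apply h
  have htop : ∀ w, meromorphicOrderAt f w = ⊤ := by
    intro w
    by_contra hw
    exact (MeromorphicOn.meromorphicOrderAt_ne_top_of_isPreconnected (U := Set.univ)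
      (fun z _ => hf z) isPreconnected_univ (Set.mem_univ w) (Set.mem_univ z) hw) hz
  exact eventually_codiscrete_iff.2 fun x => meromorphicOrderAt_eq_top_iff.1 (htop x)

theorem eventually_ne_zero {f : ℂ → ℂ} (hf : Meromorphic f) (h : ¬ f =ᶠ[codiscrete ℂ] 0) :
    ∀ᶠ z in codiscrete ℂ, f z ≠ 0 := by
  exact eventually_codiscrete_iff.2 fun x =>
    (meromorphicOrderAt_ne_top_iff_eventually_ne_zero (hf x)).1 (meromorphicOrderAt_ne_top hf h x)

theorem isField : IsField MerField where
  exists_pair_ne := ⟨0, 1, by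
    intro h
    have : (Meromorphic.const (0 : ℂ) : Meromorphic (fun _ : ℂ => (0 : ℂ))).germ =
      (Meromorphic.const (1 : ℂ) : Meromorphic (fun _ : ℂ => (1 : ℂ))).germ := h
    rw [germ_eq_iff] at this
    obtain ⟨z, hz⟩ := this.exists
    exact zero_ne_one hz⟩
  mul_comm := mul_comm
  mul_inv_cancel := by
    intro x hx
    obtain ⟨f, hf, rfl⟩ := exists_germ x
    refine ⟨hf.inv.germ, ?_⟩
    rw [germ_mul]
    change _ = (Meromorphic.const (1 : ℂ) : Meromorphic (fun _ : ℂ => (1 : ℂ))).germ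
    rw [germ_eq_iff]
    have h : ¬ f =ᶠ[codiscrete ℂ] 0 := fun h => hx ((germ_eq_iff hf (Meromorphic.const 0)).2 h)
    filter_upwards [eventually_ne_zero hf h] with z hz
    simp [hz]

noncomputable instance : Field MerField := isField.toField

theorem germ_ne_zero_iff {f : ℂ → ℂ} (hf : Meromorphic f) :
    hf.germ ≠ 0 ↔ ¬ f =ᶠ[codiscrete ℂ] 0 :=
  (germ_eq_iff hf (Meromorphic.const 0)).not

theorem germ_inv {f : ℂ → ℂ} (hf : Meromorphic f) : hf.germ⁻¹ = hf.inv.germ := by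
  by_cases h : hf.germ = 0
  · have h' : hf.inv.germ = 0 := by
      have := (germ_eq_iff hf (Meromorphic.const 0)).1 h
      refine (germ_eq_iff hf.inv (Meromorphic.const 0)).2 ?_
      filter_upwards [this] with z hz
      simp [hz]
    rw [h, h', inv_zero]
  · refine inv_eq_of_mul_eq_one_right ?_
    rw [germ_mul]
    change _ = (Meromorphic.const (1 : ℂ) : Meromorphic (fun _ : ℂ => (1 : ℂ))).germ
    rw [germ_eq_iff]
    filter_upwards [eventually_ne_zero hf ((germ_ne_zero_iff hf).1 h)] with z hz
    simp [hz]

theorem germ_div {f g : ℂ → ℂ} (hf : Meromorphic f) (hg : Meromorphic g) :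
    hf.germ / hg.germ = (hf.div hg).germ := by
  rw [div_eq_mul_inv, germ_inv, germ_mul, germ_eq_iff]
  exact Eventually.of_forall fun z => by simp [div_eq_mul_inv]

/-- Constant functions. -/
noncomputable def const : ℂ →+* MerField where
  toFun c := (Meromorphic.const c : Meromorphic (fun _ : ℂ => c)).germ
  map_one' := rfl
  map_zero' := rfl
  map_add' _ _ := rfl
  map_mul' _ _ := rfl

theorem eventually_analyticAt {f : ℂ → ℂ} (hf : Meromorphic f) :
    ∀ᶠ z in codiscrete ℂ, AnalyticAt ℂ f z :=
  (MeromorphicOn.analyticAt_mem_codiscreteWithin (U := Set.univ) fun z _ => hf z)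

/-- Germs along the codiscrete filter ignore a closed discrete set. Equality on punctured
neighbourhoods passes to derivatives, so differentiation descends to germs. -/
theorem deriv_congr {f g : ℂ → ℂ} (h : f =ᶠ[codiscrete ℂ] g) :
    deriv f =ᶠ[codiscrete ℂ] deriv g :=
  eventually_codiscrete_iff.2 fun x =>
    Filter.EventuallyEq.nhdsNE_deriv (eventually_codiscrete_iff.1 h x)

/-- A chosen meromorphic function in the given class. -/
noncomputable def rep (x : MerField) : ℂ → ℂ := (exists_germ x).choose

theorem meromorphic_rep (x : MerField) : Meromorphic x.rep := (exists_germ x).choose_spec.choose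

@[simp] theorem germ_rep (x : MerField) : (meromorphic_rep x).germ = x :=
  (exists_germ x).choose_spec.choose_spec.symm

theorem rep_germ {f : ℂ → ℂ} (hf : Meromorphic f) : hf.germ.rep =ᶠ[codiscrete ℂ] f :=
  (germ_eq_iff (meromorphic_rep _) hf).1 (germ_rep _)

/-- The derivative of a meromorphic function. -/
noncomputable def derivFun (x : MerField) : MerField := (meromorphic_rep x).deriv.germ

theorem derivFun_germ {f : ℂ → ℂ} (hf : Meromorphic f) : derivFun hf.germ = hf.deriv.germ :=
  (germ_eq_iff _ _).2 (deriv_congr (rep_germ hf))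

/-- Differentiation of meromorphic functions. -/
noncomputable def derivation : Derivation ℤ MerField MerField :=
  Derivation.mk' (AddMonoidHom.toIntLinearMap (AddMonoidHom.mk' derivFun (by
    intro x y
    obtain ⟨f, hf, rfl⟩ := exists_germ x
    obtain ⟨g, hg, rfl⟩ := exists_germ y
    rw [germ_add, derivFun_germ, derivFun_germ, derivFun_germ, germ_add, germ_eq_iff]
    filter_upwards [eventually_analyticAt hf, eventually_analyticAt hg] with z h1 h2
    simp only [Pi.add_apply]
    exact deriv_add h1.differentiableAt h2.differentiableAt))) (by
    intro x y
    obtain ⟨f, hf, rfl⟩ := exists_germ x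
    obtain ⟨g, hg, rfl⟩ := exists_germ y
    simp only [AddMonoidHom.coe_toIntLinearMap, AddMonoidHom.mk'_apply, smul_eq_mul]
    rw [germ_mul, derivFun_germ, derivFun_germ, derivFun_germ, germ_mul, germ_mul, germ_add,
      germ_eq_iff]
    filter_upwards [eventually_analyticAt hf, eventually_analyticAt hg] with z h1 h2
    simp only [Pi.add_apply, Pi.mul_apply]
    rw [deriv_mul h1.differentiableAt h2.differentiableAt]
    ring)

theorem derivation_germ {f : ℂ → ℂ} (hf : Meromorphic f) : derivation hf.germ = hf.deriv.germ :=
  derivFun_germ hf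

theorem derivation_const (c : ℂ) : derivation (const c) = 0 := by
  change derivation (Meromorphic.const c : Meromorphic (fun _ : ℂ => c)).germ = 0
  rw [derivation_germ]
  refine (germ_eq_iff _ (Meromorphic.const 0)).2 (Eventually.of_forall fun z => ?_)
  simp

theorem iterate_derivation_germ {f : ℂ → ℂ} (hf : Meromorphic f) (n : ℕ) :
    derivation^[n] hf.germ = (Meromorphic.iterated_deriv (n := n) hf).germ := by
  induction n with
  | zero => rfl
  | succ n ih =>
    rw [Function.iterate_succ_apply', ih, derivation_germ]
    refine (germ_eq_iff _ _).2 (Eventually.of_forall fun z => ?_)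
    rw [Function.iterate_succ_apply']

end MerField
end MeromorphicField

/-! ### Growth scales, with the field of controlled functions and the ring of admissible ones. -/

section GrowthScales
open Filter Topology ValueDistribution

/-- A scale of growth on the positive real axis: `size` measures the order functions that are
allowed, and error terms are measured by `small` and `negligible`. -/
structure GrowthScale where
  filter : Filter ℝ
  size : ℝ → ℝ
  small : ℝ → ℝ
  negligible : ℝ → ℝ
  filter_le : filter ≤ atTop
  one_le_size : ∀ᶠ r in filter, 1 ≤ size r
  small_nonneg : ∀ᶠ r in filter, 0 ≤ small r
  negligible_nonneg : ∀ᶠ r in filter, 0 ≤ negligible r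
  exists_le_size : ∃ C : ℝ, ∀ᶠ r in filter, small r + negligible r ≤ C * size r
  exists_const_le : ∀ c : ℝ, ∃ C : ℝ, ∀ ε : ℝ, 0 < ε →
    ∀ᶠ r in filter, c ≤ C * small r + ε * negligible r
  exists_logDeriv_le : ∀ f : ℂ → ℂ, Meromorphic f → (∀ z, meromorphicOrderAt f z ≠ ⊤) →
    (∃ C : ℝ, ∀ᶠ r in filter, characteristic f ⊤ r ≤ C * size r) →
    ∃ C : ℝ, ∀ ε : ℝ, 0 < ε → ∀ᶠ r in filter,
      proximity (logDeriv f) ⊤ r ≤ C * small r + ε * negligible r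

namespace GrowthScale
variable (s : GrowthScale)

/-- Error terms of the scale. -/
def IsSmall (φ : ℝ → ℝ) : Prop :=
  ∃ C : ℝ, ∀ ε : ℝ, 0 < ε → ∀ᶠ r in s.filter, φ r ≤ C * s.small r + ε * s.negligible r

/-- Functions of growth at most that of the scale. -/
def IsBounded (φ : ℝ → ℝ) : Prop := ∃ C : ℝ, ∀ᶠ r in s.filter, φ r ≤ C * s.size r

variable {s}

theorem eventually_ge (c : ℝ) : ∀ᶠ r in s.filter, c ≤ r :=
  s.filter_le (eventually_ge_atTop c)

theorem IsSmall.mono {φ ψ : ℝ → ℝ} (hψ : s.IsSmall ψ) (h : ∀ᶠ r in s.filter, φ r ≤ ψ r) :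
    s.IsSmall φ := by
  obtain ⟨C, hC⟩ := hψ
  refine ⟨C, fun ε hε => ?_⟩
  filter_upwards [hC ε hε, h] with r h1 h2 using h2.trans h1

theorem IsBounded.mono {φ ψ : ℝ → ℝ} (hψ : s.IsBounded ψ) (h : ∀ᶠ r in s.filter, φ r ≤ ψ r) :
    s.IsBounded φ := by
  obtain ⟨C, hC⟩ := hψ
  refine ⟨C, ?_⟩
  filter_upwards [hC, h] with r h1 h2 using h2.trans h1

theorem isSmall_const (c : ℝ) : s.IsSmall fun _ => c := s.exists_const_le c

theorem isBounded_const (c : ℝ) : s.IsBounded fun _ => c := by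
  refine ⟨|c|, ?_⟩
  filter_upwards [s.one_le_size] with r hr
  nlinarith [le_abs_self c, abs_nonneg c]

theorem IsSmall.add {φ ψ : ℝ → ℝ} (hφ : s.IsSmall φ) (hψ : s.IsSmall ψ) :
    s.IsSmall fun r => φ r + ψ r := by
  obtain ⟨C, hC⟩ := hφ
  obtain ⟨C', hC'⟩ := hψ
  refine ⟨C + C', fun ε hε => ?_⟩
  filter_upwards [hC (ε / 2) (by positivity), hC' (ε / 2) (by positivity)] with r h1 h2
  linarith

theorem IsBounded.add {φ ψ : ℝ → ℝ} (hφ : s.IsBounded φ) (hψ : s.IsBounded ψ) :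
    s.IsBounded fun r => φ r + ψ r := by
  obtain ⟨C, hC⟩ := hφ
  obtain ⟨C', hC'⟩ := hψ
  refine ⟨C + C', ?_⟩
  filter_upwards [hC, hC'] with r h1 h2
  linarith

theorem IsSmall.sum {ι : Type*} (S : Finset ι) {φ : ι → ℝ → ℝ} (h : ∀ i ∈ S, s.IsSmall (φ i)) :
    s.IsSmall fun r => ∑ i ∈ S, φ i r := by
  classical
  induction S using Finset.induction_on with
  | empty => simpa using isSmall_const (s := s) 0
  | insert a S ha ih =>
    simp only [Finset.sum_insert ha]
    exact (h a (Finset.mem_insert_self _ _)).add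
      (ih fun i hi => h i (Finset.mem_insert_of_mem hi))

theorem IsSmall.const_mul {φ : ℝ → ℝ} (hφ : s.IsSmall φ) {c : ℝ} (hc : 0 ≤ c) :
    s.IsSmall fun r => c * φ r := by
  obtain ⟨C, hC⟩ := hφ
  refine ⟨c * C, fun ε hε => ?_⟩
  -- The denominator `c + 1` rather than `c` also covers `c = 0`.
  filter_upwards [hC (ε / (c + 1)) (by positivity), s.negligible_nonneg] with r h1 h2
  calc c * φ r ≤ c * (C * s.small r + ε / (c + 1) * s.negligible r) := by gcongr
    _ = c * C * s.small r + (c / (c + 1)) * ε * s.negligible r := by field_simp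
    _ ≤ c * C * s.small r + 1 * ε * s.negligible r := by
        have : c / (c + 1) ≤ 1 := (div_le_one (by linarith)).2 (by linarith)
        gcongr
    _ = _ := by ring

theorem IsSmall.isBounded {φ : ℝ → ℝ} (hφ : s.IsSmall φ) : s.IsBounded φ := by
  obtain ⟨C, hC⟩ := hφ
  obtain ⟨C', hC'⟩ := s.exists_le_size
  refine ⟨(|C| + 1) * C', ?_⟩
  filter_upwards [hC 1 one_pos, hC', s.small_nonneg, s.negligible_nonneg] with r h1 h2 h3 h4
  calc φ r ≤ C * s.small r + 1 * s.negligible r := h1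
    _ ≤ (|C| + 1) * (s.small r + s.negligible r) := by
        nlinarith [le_abs_self C, abs_nonneg C]
    _ ≤ (|C| + 1) * (C' * s.size r) := by gcongr
    _ = _ := by ring

variable (s) in
/-- Meromorphic functions whose characteristic is bounded by the scale. -/
def IsControlled (f : ℂ → ℂ) : Prop := s.IsBounded (characteristic f ⊤)

theorem IsControlled.congr {f g : ℂ → ℂ} (hf : s.IsControlled f) (h : f =ᶠ[codiscrete ℂ] g) :
    s.IsControlled g := by
  refine IsBounded.mono hf ?_
  filter_upwards [eventually_ge (s := s) 1] with r hr
  rw [characteristic_congr_codiscrete h (by linarith)]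

theorem isSmall_proximity_congr {f g : ℂ → ℂ} (hf : s.IsSmall (proximity f ⊤))
    (h : f =ᶠ[codiscrete ℂ] g) : s.IsSmall (proximity g ⊤) := by
  refine hf.mono ?_
  filter_upwards [eventually_ge (s := s) 1] with r hr
  rw [proximity_congr_codiscrete h (by linarith)]

theorem isControlled_const (c : ℂ) : s.IsControlled fun _ => c := by
  refine (isBounded_const (s := s) (Real.posLog ‖c‖)).mono (Eventually.of_forall fun r => ?_)
  simp [characteristic]

theorem IsControlled.add {f g : ℂ → ℂ} (hf : Meromorphic f) (hg : Meromorphic g)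
    (h1 : s.IsControlled f) (h2 : s.IsControlled g) : s.IsControlled (f + g) := by
  refine ((IsBounded.add h1 h2).add (isBounded_const (Real.log 2))).mono ?_
  filter_upwards [eventually_ge (s := s) 1] with r hr
  exact characteristic_add_top_le hf hg hr

theorem IsControlled.mul {f g : ℂ → ℂ} (hf : Meromorphic f) (hg : Meromorphic g)
    (h1 : s.IsControlled f) (h2 : s.IsControlled g) : s.IsControlled (f * g) := by
  -- The product bound for characteristics needs finite orders, so functions that vanish identically
  -- are split off.
  by_cases hf0 : f =ᶠ[codiscrete ℂ] 0
  · refine (isControlled_const (s := s) 0).congr ?_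
    filter_upwards [hf0] with z hz
    simp [hz]
  by_cases hg0 : g =ᶠ[codiscrete ℂ] 0
  · refine (isControlled_const (s := s) 0).congr ?_
    filter_upwards [hg0] with z hz
    simp [hz]
  refine (IsBounded.add h1 h2).mono ?_
  filter_upwards [eventually_ge (s := s) 1] with r hr
  exact characteristic_mul_top_le hr hf (MerField.meromorphicOrderAt_ne_top hf hf0) hg
    (MerField.meromorphicOrderAt_ne_top hg hg0)

theorem IsControlled.inv {f : ℂ → ℂ} (hf : Meromorphic f) (h1 : s.IsControlled f) :
    s.IsControlled f⁻¹ := by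
  obtain ⟨c, -, hc⟩ := exists_characteristic_inv_le hf
  exact (IsBounded.add h1 (isBounded_const c)).mono (Eventually.of_forall hc)

theorem IsControlled.neg {f : ℂ → ℂ} (hf : Meromorphic f) (h1 : s.IsControlled f) :
    s.IsControlled (-f) := by
  have := (isControlled_const (s := s) (-1)).mul (Meromorphic.const _) hf h1
  refine this.congr (Eventually.of_forall fun z => ?_)
  simp

/-- The poles of a logarithmic derivative are simple and sit at zeros and poles of `f`, where the
order of `f` has modulus at least one. -/
theorem logCounting_logDeriv_le {f : ℂ → ℂ} (hf : Meromorphic f)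
    (hf' : ∀ z, meromorphicOrderAt f z ≠ ⊤) {r : ℝ} (hr : 1 ≤ r) :
    logCounting (logDeriv f) ⊤ r ≤ logCounting f ⊤ r + logCounting f⁻¹ ⊤ r := by
  rw [logCounting_inv, logCounting_zero, logCounting_top, logCounting_top, ← Pi.add_apply,
    ← map_add]
  refine Function.locallyFinsuppWithin.logCounting_le (fun z => ?_) hr
  rw [Function.locallyFinsuppWithin.coe_add, Pi.add_apply,
    Function.locallyFinsuppWithin.posPart_apply, Function.locallyFinsuppWithin.negPart_apply,
    Function.locallyFinsuppWithin.negPart_apply, add_comm, posPart_add_negPart,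
    MeromorphicOn.divisor_apply (fun z _ => hf z) (Set.mem_univ z),
    MeromorphicOn.divisor_apply (fun z _ => hf.logDeriv z) (Set.mem_univ z)]
  by_cases h0 : meromorphicOrderAt f z = 0
  · have h1 := meromorphicOrderAt_logDeriv_nonneg (hf z) h0
    have h2 : (0 : ℤ) ≤ (meromorphicOrderAt (logDeriv f) z).untop₀ := WithTop.untop₀_nonneg.2 h1
    rw [negPart_eq_zero.2 h2]
    exact abs_nonneg _
  · rw [meromorphicOrderAt_logDeriv_eq_neg_one (hf z) h0 (hf' z)]
    have h1 : (meromorphicOrderAt f z).untop₀ ≠ 0 := fun h =>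
      (WithTop.untop₀_eq_zero.1 h).elim h0 (hf' z)
    have h2 : ((-1 : WithTop ℤ)).untop₀ = -1 := rfl
    rw [h2]
    exact Int.one_le_abs h1

theorem IsControlled.isSmall_proximity_logDeriv {f : ℂ → ℂ} (hf : Meromorphic f)
    (hf' : ∀ z, meromorphicOrderAt f z ≠ ⊤) (h1 : s.IsControlled f) :
    s.IsSmall (proximity (logDeriv f) ⊤) := s.exists_logDeriv_le f hf hf' h1

theorem IsControlled.logDeriv {f : ℂ → ℂ} (hf : Meromorphic f)
    (hf' : ∀ z, meromorphicOrderAt f z ≠ ⊤) (h1 : s.IsControlled f) :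
    s.IsControlled (logDeriv f) := by
  have h2 := (h1.isSmall_proximity_logDeriv hf hf').isBounded
  refine (h2.add (IsBounded.add h1 (h1.inv hf))).mono ?_
  filter_upwards [eventually_ge (s := s) 1] with r hr
  have := logCounting_logDeriv_le hf hf' hr
  have a := proximity_nonneg (f := f) (a := ⊤) r
  have b := proximity_nonneg (f := f⁻¹) (a := ⊤) r
  simp only [Pi.zero_apply] at a b
  simp only [characteristic, Pi.add_apply]
  linarith

open MerField

variable (s) in
/-- The field of meromorphic functions whose characteristic is bounded by the scale. -/
noncomputable def controlled : Subfield MerField where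
  carrier := {x | s.IsControlled x.rep}
  mul_mem' := by
    intro x y hx hy
    refine (IsControlled.mul (meromorphic_rep x) (meromorphic_rep y) hx hy).congr ?_
    rw [← germ_eq_iff ((meromorphic_rep x).mul (meromorphic_rep y)) (meromorphic_rep _),
      ← germ_mul (meromorphic_rep x) (meromorphic_rep y)]
    simp
  one_mem' := (isControlled_const 1).congr
    ((germ_eq_iff (Meromorphic.const 1) (meromorphic_rep _)).1 (by rw [germ_rep]; rfl))
  add_mem' := by
    intro x y hx hy
    refine (IsControlled.add (meromorphic_rep x) (meromorphic_rep y) hx hy).congr ?_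
    rw [← germ_eq_iff ((meromorphic_rep x).add (meromorphic_rep y)) (meromorphic_rep _),
      ← germ_add (meromorphic_rep x) (meromorphic_rep y)]
    simp
  zero_mem' := (isControlled_const 0).congr
    ((germ_eq_iff (Meromorphic.const 0) (meromorphic_rep _)).1 (by rw [germ_rep]; rfl))
  neg_mem' := by
    intro x hx
    refine (IsControlled.neg (meromorphic_rep x) hx).congr ?_
    rw [← germ_eq_iff (meromorphic_rep x).neg (meromorphic_rep _), ← germ_neg (meromorphic_rep x)]
    simp
  inv_mem' := by
    intro x hx
    refine (IsControlled.inv (meromorphic_rep x) hx).congr ?_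
    rw [← germ_eq_iff (meromorphic_rep x).inv (meromorphic_rep _), ← germ_inv (meromorphic_rep x)]
    simp

theorem germ_mem_controlled_iff {f : ℂ → ℂ} (hf : Meromorphic f) :
    hf.germ ∈ s.controlled ↔ s.IsControlled f :=
  ⟨fun h => IsControlled.congr h (rep_germ hf), fun h => h.congr (rep_germ hf).symm⟩

theorem const_mem_controlled (c : ℂ) : const c ∈ s.controlled :=
  (germ_mem_controlled_iff (Meromorphic.const c)).2 (isControlled_const c)

theorem germ_logDeriv {f : ℂ → ℂ} (hf : Meromorphic f) :
    hf.logDeriv.germ = derivation hf.germ / hf.germ := by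
  rw [derivation_germ, germ_div]
  rfl

/-- Write `x'` as `(x' / x) * x`. A logarithmic derivative is controlled because its proximity
function is small and its poles are counted by the divisor of `x`. -/
theorem derivation_mem_controlled {x : MerField} (hx : x ∈ s.controlled) :
    derivation x ∈ s.controlled := by
  by_cases h0 : x = 0
  · simp [h0]
  obtain ⟨f, hf, rfl⟩ := exists_germ x
  have h := (germ_mem_controlled_iff hf).1 hx
  have h1 := (germ_mem_controlled_iff hf.logDeriv).2
    (h.logDeriv hf (meromorphicOrderAt_ne_top hf ((germ_ne_zero_iff hf).1 h0)))
  rw [germ_logDeriv] at h1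
  have := s.controlled.mul_mem h1 hx
  rwa [div_mul_cancel₀ _ h0] at this

variable (s) in
/-- The ring of functions in the controlled field whose proximity function is small. -/
noncomputable def admissible : Subring MerField where
  carrier := {x | x ∈ s.controlled ∧ s.IsSmall (proximity x.rep ⊤)}
  mul_mem' := by
    rintro x y ⟨hx, hx'⟩ ⟨hy, hy'⟩
    refine ⟨s.controlled.mul_mem hx hy, ?_⟩
    refine isSmall_proximity_congr (f := x.rep * y.rep) ((hx'.add hy').mono
      (Eventually.of_forall fun r =>
        proximity_mul_top_le (meromorphic_rep x) (meromorphic_rep y) r)) ?_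
    rw [← germ_eq_iff ((meromorphic_rep x).mul (meromorphic_rep y)) (meromorphic_rep _),
      ← germ_mul (meromorphic_rep x) (meromorphic_rep y)]
    simp
  one_mem' := ⟨s.controlled.one_mem, isSmall_proximity_congr (f := fun _ => 1)
    ((isSmall_const (s := s) (Real.posLog ‖(1 : ℂ)‖)).mono (Eventually.of_forall fun r => by simp))
    ((germ_eq_iff (Meromorphic.const 1) (meromorphic_rep _)).1 (by rw [germ_rep]; rfl))⟩
  add_mem' := by
    rintro x y ⟨hx, hx'⟩ ⟨hy, hy'⟩
    refine ⟨s.controlled.add_mem hx hy, ?_⟩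
    refine isSmall_proximity_congr (f := x.rep + y.rep)
      (((hx'.add hy').add (isSmall_const (Real.log 2))).mono
      (Eventually.of_forall fun r =>
        proximity_add_top_le (meromorphic_rep x) (meromorphic_rep y) r)) ?_
    rw [← germ_eq_iff ((meromorphic_rep x).add (meromorphic_rep y)) (meromorphic_rep _),
      ← germ_add (meromorphic_rep x) (meromorphic_rep y)]
    simp
  zero_mem' := ⟨s.controlled.zero_mem, isSmall_proximity_congr (f := fun _ => 0)
    ((isSmall_const (s := s) (Real.posLog ‖(0 : ℂ)‖)).mono (Eventually.of_forall fun r => by simp))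
    ((germ_eq_iff (Meromorphic.const 0) (meromorphic_rep _)).1 (by rw [germ_rep]; rfl))⟩
  neg_mem' := by
    rintro x ⟨hx, hx'⟩
    refine ⟨s.controlled.neg_mem hx, ?_⟩
    refine isSmall_proximity_congr (f := -x.rep) (hx'.mono
      (Eventually.of_forall fun r => by simp [proximity_top])) ?_
    rw [← germ_eq_iff (meromorphic_rep x).neg (meromorphic_rep _), ← germ_neg (meromorphic_rep x)]
    simp

theorem germ_mem_admissible_iff {f : ℂ → ℂ} (hf : Meromorphic f) :
    hf.germ ∈ s.admissible ↔ s.IsControlled f ∧ s.IsSmall (proximity f ⊤) :=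
  ⟨fun h => ⟨(germ_mem_controlled_iff hf).1 h.1, isSmall_proximity_congr h.2 (rep_germ hf)⟩,
    fun h => ⟨(germ_mem_controlled_iff hf).2 h.1, isSmall_proximity_congr h.2 (rep_germ hf).symm⟩⟩

theorem const_mem_admissible (c : ℂ) : const c ∈ s.admissible :=
  (germ_mem_admissible_iff (Meromorphic.const c)).2 ⟨isControlled_const c,
    (isSmall_const (s := s) (Real.posLog ‖c‖)).mono (Eventually.of_forall fun r => by simp)⟩

theorem admissible_le_controlled {x : MerField} (hx : x ∈ s.admissible) : x ∈ s.controlled := hx.1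

/-- The form in which the lemma on the logarithmic derivative enters the algebra: `x` may be any
controlled function, yet the quotient has small proximity function. -/
theorem derivation_div_self_mem_admissible {x : MerField} (hx : x ∈ s.controlled) :
    derivation x / x ∈ s.admissible := by
  by_cases h0 : x = 0
  · simp [h0]
  obtain ⟨f, hf, rfl⟩ := exists_germ x
  have h := (germ_mem_controlled_iff hf).1 hx
  have hf' := meromorphicOrderAt_ne_top hf ((germ_ne_zero_iff hf).1 h0)
  rw [← germ_logDeriv, germ_mem_admissible_iff]
  exact ⟨h.logDeriv hf hf', h.isSmall_proximity_logDeriv hf hf'⟩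

theorem derivation_mem_admissible {x : MerField} (hx : x ∈ s.admissible) :
    derivation x ∈ s.admissible := by
  by_cases h0 : x = 0
  · simp [h0]
  have := s.admissible.mul_mem (derivation_div_self_mem_admissible hx.1) hx
  rwa [div_mul_cancel₀ _ h0] at this

end GrowthScale
end GrowthScales

/-! ### Borel's growth lemma and the two growth scales. -/

section Scales
open Filter Topology ValueDistribution MeasureTheory Set

/-- Borel's growth lemma. -/
theorem volume_growth_lt_top {S : ℝ → ℝ} (hS : MonotoneOn S (Ioi 0)) (h1 : ∀ r, 1 < r → 1 ≤ S r) :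
    volume {r : ℝ | 1 < r ∧ 2 * S r < S (r + (S r)⁻¹)} < ⊤ := by
  set E := {r : ℝ | 1 < r ∧ 2 * S r < S (r + (S r)⁻¹)} with hE
  -- Dyadic level sets of `S`. Two points of `F j` further apart than `2 ^ (-j)` would push `S` past
  -- `2 ^ (j + 1)`, so the diameters are summable.
  set F : ℕ → Set ℝ := fun j => {r ∈ E | 2 ^ j ≤ S r ∧ S r < 2 ^ (j + 1)} with hF
  have hsub : E ⊆ ⋃ j, F j := by
    intro r hr
    obtain ⟨j, hj⟩ := exists_nat_pow_near (h1 r hr.1) one_lt_two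
    exact mem_iUnion.2 ⟨j, hr, hj⟩
  have hdiam : ∀ j, volume (F j) ≤ ENNReal.ofReal ((1 / 2) ^ j) := by
    intro j
    refine (Real.volume_le_diam _).trans ?_
    refine Metric.ediam_le fun x hx y hy => ?_
    have key : ∀ x ∈ F j, ∀ y ∈ F j, x ≤ y → y - x ≤ (1 / 2) ^ j := by
      intro x hx y hy hxy
      by_contra! h
      have hp : (0 : ℝ) < 2 ^ j := by positivity
      have hSx : 0 < S x := hp.trans_le hx.2.1
      have e : (S x)⁻¹ ≤ (1 / 2) ^ j := by
        rw [one_div, inv_pow]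
        exact inv_anti₀ hp hx.2.1
      have hx0 : 1 < x := hx.1.1
      have : S (x + (S x)⁻¹) ≤ S y := hS (mem_Ioi.2 (by positivity))
        (mem_Ioi.2 (by linarith)) (by linarith)
      have h3 := hx.1.2
      have h4 := hy.2.2
      have h5 := hx.2.1
      rw [pow_succ] at h4
      linarith
    rw [edist_dist]
    refine ENNReal.ofReal_le_ofReal ?_
    rw [Real.dist_eq]
    rcases le_total x y with h | h
    · rw [abs_sub_comm, abs_of_nonneg (by linarith)]
      exact key x hx y hy h
    · rw [abs_of_nonneg (by linarith)]
      exact key y hy x hx h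
  calc volume E ≤ volume (⋃ j, F j) := measure_mono hsub
    _ ≤ ∑' j, volume (F j) := measure_iUnion_le _
    _ ≤ ∑' j : ℕ, ENNReal.ofReal ((1 / 2) ^ j) := ENNReal.tsum_le_tsum hdiam
    _ = ENNReal.ofReal (∑' j : ℕ, (1 / 2) ^ j) :=
        (ENNReal.ofReal_tsum_of_nonneg (fun j => by positivity) summable_geometric_two).symm
    _ < ⊤ := ENNReal.ofReal_lt_top

/-- The scale for rational functions. -/
noncomputable def GrowthScale.rational : GrowthScale where
  filter := atTop
  size := Real.log
  small := fun _ => 1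
  negligible := fun _ => 0
  filter_le := le_rfl
  one_le_size := Real.tendsto_log_atTop.eventually_ge_atTop 1
  small_nonneg := Eventually.of_forall fun _ => zero_le_one
  negligible_nonneg := Eventually.of_forall fun _ => le_rfl
  exists_le_size := ⟨1, by
    filter_upwards [Real.tendsto_log_atTop.eventually_ge_atTop 1] with r hr
    linarith⟩
  exists_const_le := fun c => ⟨c, fun ε _ => Eventually.of_forall fun _ => by simp⟩
  exists_logDeriv_le := by
    rintro f hf hf' ⟨C, hC⟩
    obtain ⟨K, hK0, hK⟩ := exists_proximity_logDeriv_le hf hf' (α := 1 / 2) (by norm_num)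
      (by norm_num)
    -- Take `α = 1 / 2` and the outer radius `2 r`. The characteristic is `O(log r)`, hence `O(√r)`,
    -- and `r * r ^ (-1/2) = √r`. The product is `O(r)`, which the gap `2 r - r` cancels.
    refine ⟨2 * Real.log (2 + K * (4 * |C| + 1) * 3), fun ε _ => ?_⟩
    have h2 : Tendsto (fun r : ℝ => 2 * r) atTop atTop :=
      tendsto_id.const_mul_atTop two_pos
    filter_upwards [h2.eventually hC, eventually_ge_atTop 1] with r h3 hr
    have hr0 : 0 < r := by linarith
    refine (hK r (2 * r) hr (by linarith)).trans ?_
    have hT0 : 0 ≤ characteristic f ⊤ (2 * r) := characteristic_nonneg (by linarith)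
    set x := Real.sqrt r with hx
    have hx2 : x ^ 2 = r := Real.sq_sqrt hr0.le
    have hx1 : 1 ≤ x := Real.one_le_sqrt.2 hr
    have e1 : r ^ (-(1 / 2) : ℝ) = x⁻¹ := by
      rw [Real.rpow_neg hr0.le, ← Real.sqrt_eq_rpow]
    have e2 : Real.log (2 * r) ≤ 4 * x := by
      have : Real.log (2 * r) = Real.log 2 + 2 * Real.log x := by
        rw [← hx2, Real.log_mul two_ne_zero (by positivity), Real.log_pow]
        push_cast; ring
      rw [this]
      have h4 := Real.log_le_sub_one_of_pos (show (0 : ℝ) < 2 by norm_num)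
      have h5 := Real.log_le_sub_one_of_pos (show 0 < x by linarith)
      linarith
    have e2' : 0 ≤ Real.log (2 * r) := Real.log_nonneg (by linarith)
    have e3 : characteristic f ⊤ (2 * r) + 1 ≤ (4 * |C| + 1) * x := by
      have : C * Real.log (2 * r) ≤ |C| * (4 * x) :=
        mul_le_mul (le_abs_self C) e2 e2' (abs_nonneg C)
      linarith
    have e4 : 1 + 2 * r * r ^ (-(1 / 2) : ℝ) ≤ 3 * x := by
      rw [e1, ← hx2]
      have : 2 * x ^ 2 * x⁻¹ = 2 * x := by field_simp
      linarith
    have e5 : K * (characteristic f ⊤ (2 * r) + 1) * (1 + 2 * r * r ^ (-(1 / 2) : ℝ)) / (2 * r - r)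
        ≤ K * (4 * |C| + 1) * 3 := by
      rw [div_le_iff₀ (by linarith)]
      calc _ ≤ K * ((4 * |C| + 1) * x) * (3 * x) := by gcongr
        _ = K * (4 * |C| + 1) * 3 * x ^ 2 := by ring
        _ = _ := by rw [hx2]; ring
    have e6 : 0 ≤ K * (characteristic f ⊤ (2 * r) + 1) * (1 + 2 * r * r ^ (-(1 / 2) : ℝ)) /
        (2 * r - r) := by
      have : 0 ≤ 2 * r - r := by linarith
      positivity
    have e7 := Real.log_le_log (by linarith) (add_le_add_right e5 2)
    have : ((1 / 2 : ℝ))⁻¹ = 2 := by norm_num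
    rw [this]
    linarith

theorem mem_cofinite_restrict_Ioi {p : ℝ → Prop} :
    (∀ᶠ r in (volume.restrict (Ioi (1 : ℝ))).cofinite, p r) ↔
      volume.restrict (Ioi (1 : ℝ)) {r | ¬ p r} < ⊤ := Iff.rfl

theorem cofinite_restrict_Ioi_le_atTop :
    (volume.restrict (Ioi (1 : ℝ))).cofinite ≤ atTop := by
  intro s hs
  obtain ⟨a, ha⟩ := mem_atTop_sets.1 hs
  have h1 : sᶜ ⊆ Iio a := fun r hr => by
    by_contra h
    exact hr (ha r (not_lt.1 h))
  refine (measure_mono h1).trans_lt ?_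
  rw [Measure.restrict_apply measurableSet_Iio]
  refine (measure_mono (t := Icc 1 a) fun r hr => ⟨le_of_lt hr.2, le_of_lt hr.1⟩).trans_lt ?_
  simp

/-- The outer radius is `r + 1 / S r`. Outside the exceptional set of Borel's lemma `S` at most
doubles there, so the argument of the logarithm is `O(S ^ 2 * r ^ δ)`. With `α = 1 - δ` close to
one, the power of `r` costs only a small multiple of `log r`. -/
theorem exists_proximity_logDeriv_le_log {f : ℂ → ℂ} (hf : Meromorphic f)
    (hf' : ∀ z, meromorphicOrderAt f z ≠ ⊤) {T : ℝ → ℝ}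
    (hT : ∀ᶠ r in (volume.restrict (Ioi (1 : ℝ))).cofinite, 1 ≤ T r)
    {C : ℝ} (hC : ∀ᶠ r in (volume.restrict (Ioi (1 : ℝ))).cofinite,
      characteristic f ⊤ r ≤ C * T r) {ε : ℝ} (hε : 0 < ε) :
    ∀ᶠ r in (volume.restrict (Ioi (1 : ℝ))).cofinite,
      proximity (logDeriv f) ⊤ r ≤ 4 * Real.log (T r) + ε * Real.log r := by
  -- As `(1 - δ)⁻¹ ≤ 2`, the term `δ log r` contributes at most `(ε / 4) log r`. Another `(ε / 2)
  -- log r` absorbs the constants for large `r`.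
  set δ := min (1 / 2) (ε / 8) with hδ
  have hδ0 : 0 < δ := by positivity
  have hδ1 : δ ≤ 1 / 2 := min_le_left _ _
  have hδ2 : δ ≤ ε / 8 := min_le_right _ _
  obtain ⟨K, hK0, hK⟩ := exists_proximity_logDeriv_le hf hf' (α := 1 - δ) (by linarith)
    (by linarith)
  set S : ℝ → ℝ := fun r => characteristic f ⊤ r + 1 with hS
  have hSm : MonotoneOn S (Ioi 0) := fun x hx y hy hxy =>
    add_le_add_left (characteristic_monotoneOn hf hx hy hxy) 1
  have hS1 : ∀ r, 1 < r → 1 ≤ S r := fun r hr => by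
    have := characteristic_nonneg (f := f) (a := ⊤) hr.le
    simp only [hS]; linarith
  have hB : ∀ᶠ r in (volume.restrict (Ioi (1 : ℝ))).cofinite,
      ¬ (1 < r ∧ 2 * S r < S (r + (S r)⁻¹)) := by
    rw [mem_cofinite_restrict_Ioi]
    simp only [not_not]
    exact (Measure.restrict_apply_le _ _).trans_lt (volume_growth_lt_top hSm hS1)
  have hlog := cofinite_restrict_Ioi_le_atTop (Real.tendsto_log_atTop.eventually_ge_atTop
    ((2 * Real.log (2 + 6 * K) + 4 * Real.log (|C| + 1)) / (ε / 2)))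
  filter_upwards [hT, hC, hB, hlog, cofinite_restrict_Ioi_le_atTop (eventually_gt_atTop 1)]
    with r h1 h2 h3 h4 hr
  have hr0 : 0 < r := by linarith
  have hSr := hS1 r hr
  have hSr0 : 0 < S r := by linarith
  set R := r + (S r)⁻¹ with hR
  have hinv : 0 < (S r)⁻¹ := inv_pos.2 hSr0
  have hinv1 : (S r)⁻¹ ≤ 1 := inv_le_one_of_one_le₀ hSr
  have hSR : S R ≤ 2 * S r := by
    by_contra! h
    exact h3 ⟨hr, h⟩
  refine (hK r R hr.le (by linarith)).trans ?_
  have hSR0 : 0 ≤ characteristic f ⊤ R := characteristic_nonneg (by linarith)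
  set y := r ^ δ with hy
  have hy1 : 1 ≤ y := Real.one_le_rpow hr.le hδ0.le
  have e1 : r * r ^ (-(1 - δ)) = y := by
    rw [hy, show δ = 1 + -(1 - δ) by ring, Real.rpow_add hr0, Real.rpow_one]
    congr 2
    ring
  have hrp : 0 < r ^ (-(1 - δ)) := Real.rpow_pos_of_pos hr0 _
  have e2 : 1 + R * r ^ (-(1 - δ)) ≤ 3 * y := by
    have : R * r ^ (-(1 - δ)) ≤ 2 * r * r ^ (-(1 - δ)) := by gcongr; linarith
    rw [mul_assoc, e1] at this
    linarith
  have e3 : K * (characteristic f ⊤ R + 1) * (1 + R * r ^ (-(1 - δ))) / (R - r) ≤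
      6 * K * S r ^ 2 * y := by
    have : R - r = (S r)⁻¹ := by rw [hR]; ring
    rw [this, div_inv_eq_mul]
    have hR0 : 0 < R := by linarith
    calc K * (characteristic f ⊤ R + 1) * (1 + R * r ^ (-(1 - δ))) * S r
        ≤ K * (2 * S r) * (3 * y) * S r := by gcongr
      _ = _ := by ring
  have e4 : 0 ≤ K * (characteristic f ⊤ R + 1) * (1 + R * r ^ (-(1 - δ))) / (R - r) := by
    have : 0 ≤ R - r := by linarith
    have hR0 : 0 < R := by linarith
    positivity
  have hSC : S r ≤ (|C| + 1) * T r := by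
    simp only [hS]
    nlinarith [le_abs_self C]
  have hC1 : 0 < |C| + 1 := by positivity
  have e5 : 2 + 6 * K * S r ^ 2 * y ≤ (2 + 6 * K) * ((|C| + 1) * T r) ^ 2 * y := by
    have : (1 : ℝ) ≤ ((|C| + 1) * T r) ^ 2 * y := by
      have : 1 ≤ (|C| + 1) * T r := hSr.trans hSC
      nlinarith
    calc 2 + 6 * K * S r ^ 2 * y ≤ 2 * (((|C| + 1) * T r) ^ 2 * y) +
          6 * K * ((|C| + 1) * T r) ^ 2 * y := by gcongr; linarith
      _ = _ := by ring
  have hT0 : 0 < T r := by linarith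
  have hlogr : 0 < Real.log r := Real.log_pos hr
  set X := 2 + K * (characteristic f ⊤ R + 1) * (1 + R * r ^ (-(1 - δ))) / (R - r) with hX
  have hlogX : Real.log X ≤ Real.log (2 + 6 * K) +
      2 * (Real.log (|C| + 1) + Real.log (T r)) + δ * Real.log r := by
    have hXle : X ≤ (2 + 6 * K) * ((|C| + 1) * T r) ^ 2 * y := by
      refine le_trans ?_ e5
      rw [hX]; linarith
    refine (Real.log_le_log (by rw [hX]; linarith) hXle).trans_eq ?_
    rw [Real.log_mul (by positivity) (by positivity), Real.log_mul (by positivity) (by positivity),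
      Real.log_pow, Real.log_mul (by positivity) (by positivity), hy, Real.log_rpow hr0]
    push_cast; ring
  have hX0 : 0 ≤ Real.log X := Real.log_nonneg (by rw [hX]; linarith)
  have hα : (1 - δ)⁻¹ ≤ 2 := by
    rw [inv_le_comm₀ (by linarith) two_pos]; linarith
  rw [div_le_iff₀ (by positivity)] at h4
  calc (1 - δ)⁻¹ * Real.log X ≤ 2 * Real.log X := by gcongr
    _ ≤ 2 * (Real.log (2 + 6 * K) +
      2 * (Real.log (|C| + 1) + Real.log (T r)) + δ * Real.log r) := by gcongr
    _ ≤ _ := by nlinarith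

/-- The scale for a curve with order function `T`. -/
noncomputable def GrowthScale.ofOrder (T : ℝ → ℝ)
    (hT : ∃ c : ℝ, 0 < c ∧ ∀ᶠ r in atTop, c * Real.log r ≤ T r) : GrowthScale :=
  have h1 : ∀ᶠ r in (volume.restrict (Ioi (1 : ℝ))).cofinite, 1 ≤ T r := by
    obtain ⟨c, hc, h⟩ := hT
    filter_upwards [cofinite_restrict_Ioi_le_atTop h, cofinite_restrict_Ioi_le_atTop
      (Real.tendsto_log_atTop.eventually_ge_atTop c⁻¹)] with r h1 h2
    refine le_trans ?_ h1
    rw [← mul_inv_cancel₀ hc.ne']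
    gcongr
  { filter := (volume.restrict (Ioi (1 : ℝ))).cofinite
    size := T
    small := fun r => Real.log (T r)
    negligible := Real.log
    filter_le := cofinite_restrict_Ioi_le_atTop
    one_le_size := h1
    small_nonneg := by
      filter_upwards [h1] with r hr using Real.log_nonneg hr
    negligible_nonneg := by
      filter_upwards [cofinite_restrict_Ioi_le_atTop (eventually_ge_atTop 1)] with r hr
        using Real.log_nonneg hr
    exists_le_size := by
      obtain ⟨c, hc, h⟩ := hT
      refine ⟨1 + c⁻¹, ?_⟩
      filter_upwards [h1, cofinite_restrict_Ioi_le_atTop h] with r h2 h3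
      have h4 := Real.log_le_sub_one_of_pos (show 0 < T r by linarith)
      have h5 : Real.log r ≤ c⁻¹ * T r := by
        rw [← div_eq_inv_mul, le_div_iff₀ hc, mul_comm]; exact h3
      linarith
    -- Constants are eventually below `ε log r`, so no multiple of `log T` is spent on them.
    exists_const_le := fun c => ⟨0, fun ε hε => by
      filter_upwards [cofinite_restrict_Ioi_le_atTop
        (Real.tendsto_log_atTop.eventually_ge_atTop (c / ε))] with r hr
      rw [div_le_iff₀ hε] at hr
      linarith⟩
    exists_logDeriv_le := by
      rintro f hf hf' ⟨C, hC⟩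
      exact ⟨4, fun ε hε => exists_proximity_logDeriv_le_log hf hf' h1 hC hε⟩ }

end Scales

/-! ### Wronskians in differential fields. -/

section DifferentialAlgebra
open Finset Matrix

variable {K : Type*} [Field K] (D : Derivation ℤ K K)

/-- The rows of derivatives of orders `J l` of a family `f`. -/
def derivMatrix {m ι : Type*} (J : m → ℕ) (f : ι → K) : Matrix m ι K :=
  Matrix.of fun l i => D^[J l] (f i)

/-- The Wronskian determinant of a family. -/
def wronskianDet {m : ℕ} (f : Fin m → K) : K :=
  (derivMatrix D (fun l : Fin m => (l : ℕ)) f).det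

theorem derivation_iterate_sum {ι : Type*} (S : Finset ι) (f : ι → K) (l : ℕ) :
    D^[l] (∑ i ∈ S, f i) = ∑ i ∈ S, D^[l] (f i) := by
  induction l generalizing f with
  | zero => rfl
  | succ l ih => simp only [Function.iterate_succ_apply, map_sum, ih]

theorem derivation_iterate_const_mul {c : K} (hc : D c = 0) (x : K) (l : ℕ) :
    D^[l] (c * x) = c * D^[l] x := by
  induction l generalizing x with
  | zero => rfl
  | succ l ih =>
    simp only [Function.iterate_succ_apply, Derivation.leibniz, hc, smul_eq_mul, mul_zero,
      add_zero, ih]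

theorem wronskianDet_eq_zero_of_eq_sum {m p : ℕ} (f : Fin m → K) (j : Fin m) (J : Fin p → Fin m)
    (hj : ∀ s, J s ≠ j) (E : Fin p → K) (hE : ∀ s, D (E s) = 0)
    (h : f j = ∑ s, E s * f (J s)) : wronskianDet D f = 0 := by
  refine Matrix.exists_mulVec_eq_zero_iff.1
    ⟨Pi.single j 1 - ∑ s, Pi.single (J s) (E s), fun h0 => ?_, ?_⟩
  · have h1 := congrFun h0 j
    simp only [Pi.sub_apply, Pi.single_eq_same, Finset.sum_apply, Pi.zero_apply] at h1
    rw [Finset.sum_eq_zero (fun s _ => Pi.single_eq_of_ne (hj s).symm _), sub_zero] at h1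
    exact one_ne_zero h1
  · ext l
    have h2 : D^[(l : ℕ)] (f j) = ∑ s, E s * D^[(l : ℕ)] (f (J s)) := by
      rw [h, derivation_iterate_sum]
      exact Finset.sum_congr rfl fun s _ => derivation_iterate_const_mul D (hE s) _ _
    rw [Matrix.mulVec_sub, Matrix.mulVec_sum]
    simp only [Pi.sub_apply, Finset.sum_apply, Matrix.mulVec_single, Pi.smul_apply,
      MulOpposite.smul_eq_mul_unop, MulOpposite.unop_op, derivMatrix, Matrix.col_apply,
      Matrix.of_apply, mul_one, Pi.zero_apply, h2]
    rw [sub_eq_zero]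
    exact Finset.sum_congr rfl fun s _ => mul_comm _ _

variable {D}

/-- Descent on the number of generators. The relations express all derivatives of order at most `m`
through `m + 1` of the functions. Differentiating and comparing with the next order yields a
homogeneous relation among the generators, valid up to order `m - 1`, which eliminates one of them.
When a single generator is left, all functions are multiples of it with factors in `C`. -/
theorem exists_ratio_mem_of_relation {n : ℕ} (C : Subfield K) (hC : ∀ x ∈ C, D x ∈ C)
    (f : Fin (n + 1) → K) (hf : wronskianDet D f ≠ 0) (m : ℕ) (hm : m < n)
    (J : Fin (m + 1) → Fin (n + 1)) (E : Fin (m + 1) → Fin (n + 1) → K)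
    (hE : ∀ s i, E s i ∈ C)
    (h : ∀ l ≤ m, ∀ i, D^[l] (f i) = ∑ s, E s i * D^[l] (f (J s))) :
    ∃ t, f t ≠ 0 ∧ ∀ i, f i / f t ∈ C := by
  induction m with
  | zero =>
    have h0 : ∀ i, f i = E 0 i * f (J 0) := fun i => by simpa using h 0 le_rfl i
    have ht : f (J 0) ≠ 0 := by
      intro ht
      apply hf
      refine Matrix.det_eq_zero_of_row_eq_zero 0 fun i => ?_
      simp [derivMatrix, h0 i, ht]
    refine ⟨J 0, ht, fun i => ?_⟩
    rw [h0 i, mul_div_cancel_right₀ _ ht]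
    exact hE 0 i
  | succ m ih =>
    obtain ⟨j, hj⟩ : ∃ j, ∀ s, J s ≠ j := by
      by_contra! hcon
      have := Fintype.card_le_of_surjective J (fun j => hcon j)
      simp at this
      omega
    -- If all these coefficients were constants, `f j` would be a constant combination of other
    -- members of the family and the Wronskian would vanish.
    obtain ⟨s, hs⟩ : ∃ s, D (E s j) ≠ 0 := by
      by_contra! hcon
      exact hf (wronskianDet_eq_zero_of_eq_sum D f j J hj (fun s => E s j) hcon
        (by simpa using h 0 (Nat.zero_le _) j))
    have hrel : ∀ l ≤ m, ∑ s, D (E s j) * D^[l] (f (J s)) = 0 := by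
      intro l hl
      have h1 := h (l + 1) (by omega) j
      rw [Function.iterate_succ_apply', h l (by omega) j, map_sum] at h1
      simp only [Derivation.leibniz, smul_eq_mul, Finset.sum_add_distrib,
        ← Function.iterate_succ_apply' (f := D)] at h1
      rw [add_eq_left] at h1
      rw [← h1]
      exact Finset.sum_congr rfl fun s _ => mul_comm _ _
    have hs' : ∀ l ≤ m, D^[l] (f (J s)) =
        -∑ a, (D (E (s.succAbove a) j) / D (E s j)) * D^[l] (f (J (s.succAbove a))) := by
      intro l hl
      have h1 := hrel l hl
      rw [Fin.sum_univ_succAbove _ s] at h1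
      have h2 : D^[l] (f (J s)) = -(∑ a, D (E (s.succAbove a) j) *
          D^[l] (f (J (s.succAbove a)))) / D (E s j) := by
        rw [eq_div_iff hs, eq_neg_iff_add_eq_zero, mul_comm]
        exact h1
      rw [h2, neg_div, Finset.sum_div]
      congr 1
      exact Finset.sum_congr rfl fun a _ => by ring
    refine ih (by omega) (J ∘ s.succAbove)
      (fun a i => E (s.succAbove a) i - E s i * (D (E (s.succAbove a) j) / D (E s j)))
      (fun a i => ?_) (fun l hl i => ?_)
    · exact C.sub_mem (hE _ _) (C.mul_mem (hE _ _) (C.div_mem (hC _ (hE _ _)) (hC _ (hE _ _))))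
    · rw [h l (by omega) i, Fin.sum_univ_succAbove _ s, hs' l hl, mul_neg, Finset.mul_sum,
        ← sub_eq_neg_add, ← Finset.sum_sub_distrib]
      refine Finset.sum_congr rfl fun a _ => ?_
      simp only [Function.comp_apply]
      ring

/-- A family is determined up to a common factor by its Wronskians of a given order. -/
theorem exists_ratio_mem {n k : ℕ} (hk : k < n) (C : Subfield K) (hC : ∀ x ∈ C, D x ∈ C)
    (f : Fin (n + 1) → K) (hf : wronskianDet D f ≠ 0) (I : Fin (k + 1) → Fin (n + 1))
    (hI : wronskianDet D (f ∘ I) ≠ 0)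
    (h : ∀ τ : Fin (k + 1) → Fin (n + 1), wronskianDet D (f ∘ τ) / wronskianDet D (f ∘ I) ∈ C) :
    ∃ t, f t ≠ 0 ∧ ∀ i, f i / f t ∈ C := by
  -- The coefficients come from Cramer's rule: they solve for the derivatives of `f i` of orders `0,
  -- ..., k` in terms of those of the `f (I s)`, and are ratios of Wronskians of order `k + 1`.
  refine exists_ratio_mem_of_relation C hC f hf k hk I
    (fun s i => wronskianDet D (f ∘ Function.update I s i) / wronskianDet D (f ∘ I))
    (fun s i => h _) (fun l hl i => ?_)
  set A := derivMatrix D (fun l : Fin (k + 1) => (l : ℕ)) (f ∘ I) with hA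
  have h1 := congrFun (Matrix.mulVec_cramer A (fun l => D^[(l : ℕ)] (f i)))
    (⟨l, by omega⟩ : Fin (k + 1))
  have h2 : ∀ s, A.cramer (fun l => D^[(l : ℕ)] (f i)) s
      = wronskianDet D (f ∘ Function.update I s i) := by
    intro s
    rw [Matrix.cramer_apply, wronskianDet]
    congr 1
    ext a b
    rw [Matrix.updateCol_apply]
    simp only [derivMatrix, Matrix.of_apply, Function.comp_apply, hA, Function.update_apply]
    split_ifs <;> rfl
  simp only [Matrix.mulVec, dotProduct, h2, Pi.smul_apply, smul_eq_mul] at h1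
  change _ = wronskianDet D (f ∘ I) * _ at h1
  have h3 : D^[l] (f i) = (∑ x, A ⟨l, by omega⟩ x *
      wronskianDet D (f ∘ Function.update I x i)) / wronskianDet D (f ∘ I) := by
    rw [h1, mul_div_cancel_left₀ _ hI]
  rw [h3, Finset.sum_div]
  refine Finset.sum_congr rfl fun s _ => ?_
  simp only [hA, derivMatrix, Matrix.of_apply, Function.comp_apply]
  ring

variable (D) in
/-- The field of constants. -/
def constantField : Subfield K where
  carrier := {x | D x = 0}
  mul_mem' := by
    intro a b ha hb
    simp only [Set.mem_ofPred_eq] at *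
    simp [Derivation.leibniz, ha, hb]
  one_mem' := by simp
  add_mem' := by
    intro a b ha hb
    simp only [Set.mem_ofPred_eq] at *
    simp [ha, hb]
  zero_mem' := by simp
  neg_mem' := by
    intro a ha
    simp only [Set.mem_ofPred_eq] at *
    simp [ha]
  inv_mem' := by
    intro a ha
    simp only [Set.mem_ofPred_eq] at *
    simp [Derivation.leibniz_inv, ha]

/-- Apply `exists_ratio_mem` to the field of constants. If all ratios of Wronskians were constant,
all `f i / f t` would be constant, which contradicts the nonvanishing of the full Wronskian. This is
why the derived curve is not constant for `k < n`. -/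
theorem exists_derivation_ratio_ne_zero {n k : ℕ} (hk : k < n)
    (f : Fin (n + 1) → K) (hf : wronskianDet D f ≠ 0) (I : Fin (k + 1) → Fin (n + 1))
    (hI : wronskianDet D (f ∘ I) ≠ 0) :
    ∃ τ : Fin (k + 1) → Fin (n + 1),
      D (wronskianDet D (f ∘ τ) / wronskianDet D (f ∘ I)) ≠ 0 := by
  by_contra! hcon
  obtain ⟨t, ht, h⟩ := exists_ratio_mem hk (constantField D) (fun x (hx : D x = 0) => by
    change D (D x) = 0
    rw [hx, map_zero]) f hf I hI hcon
  obtain ⟨j, hj⟩ : ∃ j, j ≠ t := by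
    have : Nontrivial (Fin (n + 1)) := Fin.nontrivial_iff_two_le.2 (by omega)
    exact exists_ne t
  refine hf (wronskianDet_eq_zero_of_eq_sum D f j (fun _ : Fin 1 => t) (fun _ => hj.symm)
    (fun _ => f j / f t) (fun _ => h j) ?_)
  simp [ht]

variable {R : Subring K} {C : Subfield K}

/-- Functions in a differential field are annihilated by a monic operator whose coefficients lie in
the ring generated by logarithmic derivatives. -/
theorem exists_annihilating_operator (hR : ∀ x ∈ R, D x ∈ R) (hC : ∀ x ∈ C, D x ∈ C)
    (hRC : ∀ x ∈ R, x ∈ C) (hlog : ∀ x ∈ C, D x / x ∈ R) {ι : Type*} (S : Finset ι) (h : ι → K)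
    (hh : ∀ i ∈ S, h i ∈ C) :
    ∃ p ≤ #S, ∃ c : ℕ → K, (∀ l, c l ∈ R) ∧ c p = 1 ∧ (∀ l, p < l → c l = 0) ∧
      ∀ i ∈ S, ∑ l ∈ range (p + 1), c l * D^[l] (h i) = 0 := by
  classical
  induction S using Finset.induction_on with
  | empty =>
    refine ⟨0, le_rfl, fun l => if l = 0 then 1 else 0, fun l => ?_, by simp,
      fun l hl => if_neg hl.ne', by simp⟩
    dsimp only
    split_ifs
    exacts [R.one_mem, R.zero_mem]
  | insert a S ha ih =>
    obtain ⟨p, hp, c, hc, hc1, hc0, hann⟩ := ih fun i hi => hh i (mem_insert_of_mem hi)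
    rw [card_insert_of_notMem ha]
    have hDC : ∀ l, ∀ x ∈ C, D^[l] x ∈ C := by
      intro l
      induction l with
      | zero => exact fun x hx => hx
      | succ l ih =>
        intro x hx
        rw [Function.iterate_succ_apply]
        exact ih _ (hC x hx)
    set P : K → K := fun x => ∑ l ∈ range (p + 1), c l * D^[l] x with hP
    set u := P (h a) with hu
    by_cases hu0 : u = 0
    · refine ⟨p, by omega, c, hc, hc1, hc0, fun i hi => ?_⟩
      rcases mem_insert.1 hi with rfl | hi
      · exact hu0
      · exact hann i hi
    have huC : u ∈ C := by
      refine C.sum_mem fun l _ => C.mul_mem (hRC _ (hc l)) (hDC l _ (hh a (mem_insert_self _ _)))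
    set v := D u / u with hv
    have hvR : v ∈ R := hlog u huC
    -- The coefficients of `(D - v) ∘ P`. The first-order factor kills `u = P (h a)` because `v` is
    -- its logarithmic derivative, and it preserves what `P` already annihilates.
    set c' : ℕ → K := fun l => D (c l) - v * c l + (if l = 0 then 0 else c (l - 1)) with hc'
    have key : ∀ x, ∑ l ∈ range (p + 1 + 1), c' l * D^[l] x = D (P x) - v * P x := by
      intro x
      have e1 : ∑ l ∈ range (p + 1 + 1), c' l * D^[l] x =
          ∑ l ∈ range (p + 1 + 1), D (c l) * D^[l] x - v * ∑ l ∈ range (p + 1 + 1), c l * D^[l] x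
          + ∑ l ∈ range (p + 1 + 1), (if l = 0 then 0 else c (l - 1)) * D^[l] x := by
        rw [Finset.mul_sum, ← Finset.sum_sub_distrib, ← Finset.sum_add_distrib]
        exact Finset.sum_congr rfl fun l _ => by simp only [hc']; ring
      rw [e1, Finset.sum_range_succ (fun l => D (c l) * D^[l] x),
        Finset.sum_range_succ (fun l => c l * D^[l] x), hc0 (p + 1) (by omega),
        Finset.sum_range_succ' (fun l => (if l = 0 then 0 else c (l - 1)) * D^[l] x)]
      simp only [hP, map_sum, Derivation.leibniz, smul_eq_mul, map_zero, zero_mul, add_zero,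
        if_true, Nat.succ_ne_zero, if_false, Nat.add_sub_cancel, Finset.sum_add_distrib,
        Function.iterate_succ_apply']
      have e2 : ∑ l ∈ range (p + 1), D^[l] x * D (c l) = ∑ l ∈ range (p + 1), D (c l) * D^[l] x :=
        Finset.sum_congr rfl fun l _ => mul_comm _ _
      rw [e2]
      ring
    refine ⟨p + 1, by omega, c', fun l => ?_, ?_, fun l hl => ?_, fun i hi => ?_⟩
    · refine R.add_mem (R.sub_mem (hR _ (hc l)) (R.mul_mem hvR (hc l))) ?_
      split_ifs
      exacts [R.zero_mem, hc _]
    · simp [hc', hc0 (p + 1) (by omega), hc1]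
    · simp [hc', hc0 l (by omega), hc0 (l - 1) (by omega)]
    · rw [key]
      rcases mem_insert.1 hi with rfl | hi
      · rw [← hu, hv, div_mul_cancel₀ _ hu0, sub_self]
      · have : P (h i) = 0 := hann i hi
        rw [this]; simp

/-- The annihilating operator is monic, so it writes the row of order `m` through the lower rows
with coefficients in `R`. The span of the first `m` rows is then stable under differentiation, as
`R` is. -/
theorem derivMatrix_row_mem_span (hR : ∀ x ∈ R, D x ∈ R) (hC : ∀ x ∈ C, D x ∈ C)
    (hRC : ∀ x ∈ R, x ∈ C) (hlog : ∀ x ∈ C, D x / x ∈ R) {m : ℕ} (h : Fin m → K)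
    (hh : ∀ i, h i ∈ C) (hW : wronskianDet D h ≠ 0) (j : ℕ) :
    (fun i => D^[j] (h i)) ∈ Submodule.span R
      (Set.range fun l : Fin m => fun i => D^[(l : ℕ)] (h i)) := by
  obtain ⟨p, hp, c, hc, hc1, -, hann⟩ :=
    exists_annihilating_operator hR hC hRC hlog univ h fun i _ => hh i
  rw [card_univ, Fintype.card_fin] at hp
  set M := Submodule.span R (Set.range fun l : Fin m => fun i => D^[(l : ℕ)] (h i)) with hM
  -- An operator of order below `m` would be a nontrivial linear relation between the rows of the
  -- Wronskian matrix.
  have hpm : p = m := by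
    by_contra hne
    have hlt : p < m := lt_of_le_of_ne hp hne
    apply hW
    refine Matrix.exists_vecMul_eq_zero_iff.1 ⟨fun l => if (l : ℕ) ≤ p then c l else 0,
      fun h0 => ?_, ?_⟩
    · have := congrFun h0 ⟨p, hlt⟩
      simp [hc1] at this
    · ext i
      simp only [Matrix.vecMul, dotProduct, derivMatrix, Matrix.of_apply, Pi.zero_apply]
      rw [Fin.sum_univ_eq_sum_range (fun l => (if l ≤ p then c l else 0) * D^[l] (h i)) m]
      refine Eq.trans ?_ (hann i (mem_univ i))
      rw [← Finset.sum_subset (range_subset_range.2 (show p + 1 ≤ m by omega))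
        (f := fun l => (if l ≤ p then c l else 0) * D^[l] (h i))]
      · refine Finset.sum_congr rfl fun l hl => ?_
        rw [if_pos (by simp at hl; omega)]
      · intro l _ hl
        rw [if_neg (by simp at hl; omega), zero_mul]
  subst hpm
  have hlow : ∀ l ≤ p, (fun i => D^[l] (h i)) ∈ M := by
    intro l hl
    rcases hl.lt_or_eq with hl | rfl
    · exact Submodule.subset_span ⟨⟨l, hl⟩, rfl⟩
    · have : (fun i => D^[l] (h i)) = -∑ j ∈ range l, (⟨c j, hc j⟩ : R) • fun i => D^[j] (h i) := by
        ext i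
        have h1 := hann i (mem_univ i)
        rw [Finset.sum_range_succ, hc1, one_mul] at h1
        simp only [Pi.neg_apply, Finset.sum_apply, Pi.smul_apply, Subring.smul_def, smul_eq_mul]
        rw [eq_neg_iff_add_eq_zero, add_comm]
        exact h1
      rw [this]
      refine M.neg_mem (M.sum_mem fun j hj => M.smul_mem _ ?_)
      exact Submodule.subset_span ⟨⟨j, mem_range.1 hj⟩, rfl⟩
  have hD : ∀ φ ∈ M, (fun i => D (φ i)) ∈ M := by
    intro φ hφ
    induction hφ using Submodule.span_induction with
    | mem φ hφ =>
      obtain ⟨l, rfl⟩ := hφ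
      have := hlow (l + 1) l.2
      simpa only [Function.iterate_succ_apply'] using this
    | zero =>
      have : (fun i : Fin p => D ((0 : Fin p → K) i)) = 0 := by ext i; simp
      rw [this]; exact M.zero_mem
    | add φ ψ _ _ h1 h2 =>
      have : (fun i => D ((φ + ψ) i)) = (fun i => D (φ i)) + fun i => D (ψ i) := by ext i; simp
      rw [this]; exact M.add_mem h1 h2
    | smul a φ hφ h1 =>
      have : (fun i => D ((a • φ) i)) = a • (fun i => D (φ i)) + (⟨D a, hR a a.2⟩ : R) • φ := by
        ext i
        simp only [Pi.smul_apply, Subring.smul_def, smul_eq_mul, Derivation.leibniz, Pi.add_apply]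
        ring
      rw [this]; exact M.add_mem (M.smul_mem _ h1) (M.smul_mem _ hφ)
  induction j with
  | zero => exact hlow 0 (Nat.zero_le _)
  | succ j ih => simpa only [Function.iterate_succ_apply'] using hD _ ih

/-- Generalized Wronskians of functions in a differential field, divided by the Wronskian, lie in
the ring generated by logarithmic derivatives. -/
theorem det_derivMatrix_div_wronskianDet_mem (hR : ∀ x ∈ R, D x ∈ R) (hC : ∀ x ∈ C, D x ∈ C)
    (hRC : ∀ x ∈ R, x ∈ C) (hlog : ∀ x ∈ C, D x / x ∈ R) {m : ℕ} (h : Fin m → K)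
    (hh : ∀ i, h i ∈ C) (hW : wronskianDet D h ≠ 0) (J : Fin m → ℕ) :
    (derivMatrix D J h).det / wronskianDet D h ∈ R := by
  have hspan := fun l => (Submodule.mem_span_range_iff_exists_fun R).1
    (derivMatrix_row_mem_span hR hC hRC hlog h hh hW (J l))
  choose c hc using hspan
  -- The generalized matrix is a matrix over `R` times the Wronskian matrix, so the quotient of
  -- determinants is a determinant over `R`.
  have e : derivMatrix D J h = (Matrix.of fun l j => (c l j : K)) *
      derivMatrix D (fun l : Fin m => (l : ℕ)) h := by
    ext l i
    have := congrFun (hc l) i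
    simp only [Finset.sum_apply, Pi.smul_apply, Subring.smul_def, smul_eq_mul] at this
    simp only [derivMatrix, Matrix.of_apply, Matrix.mul_apply]
    exact this.symm
  rw [e, Matrix.det_mul, ← wronskianDet, mul_div_cancel_right₀ _ hW, Matrix.det_apply]
  refine R.sum_mem fun σ _ => R.zsmul_mem (R.prod_mem fun i _ => ?_) _
  exact (c _ _).2

end DifferentialAlgebra

/-! ### Compound matrices, the Leibniz rule, and generalized Wronskians. -/

section CompoundMatrices
open Finset Matrix

variable {R : Type*} [CommRing R]

/-- The increasing enumeration of a subset of `Fin n` with `p` elements. -/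
def subsetEnum {n p : ℕ} (I : Set.powersetCard (Fin n) p) : Fin p ↪o Fin n :=
  Set.powersetCard.ofFinEmbEquiv.symm I

theorem eq_of_range_subsetEnum_subset {n p : ℕ} {I J : Set.powersetCard (Fin n) p}
    (h : ∀ s, ∃ t, (subsetEnum I) s = (subsetEnum J) t) : I = J := by
  have hsub : (I : Finset (Fin n)) ⊆ J := by
    intro i hi
    obtain ⟨s, rfl⟩ := (Set.powersetCard.mem_range_ofFinEmbEquiv_symm_iff_mem I i).2 hi
    obtain ⟨t, ht⟩ := h s
    change (subsetEnum I) s ∈ J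
    rw [ht]
    exact (Set.powersetCard.mem_range_ofFinEmbEquiv_symm_iff_mem J _).1 ⟨t, rfl⟩
  exact Subtype.ext (Finset.eq_of_subset_of_card_le hsub (by rw [I.2, J.2]))

/-- The Cauchy-Binet formula. -/
theorem det_mul_eq_sum_minors {n p : ℕ} (A : Matrix (Fin p) (Fin n) R)
    (B : Matrix (Fin n) (Fin p) R) :
    (A * B).det = ∑ I : Set.powersetCard (Fin n) p,
      (A.submatrix id (subsetEnum I)).det * (B.submatrix (subsetEnum I) id).det := by
  set b := (Pi.basisFun R (Fin n)).exteriorPower p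
  -- The columns of `B` act as functionals on the rows of `A`. Pairing their wedge products gives
  -- `det (A * B)`, and expanding the wedge of the rows in the standard basis gives the sum.
  set φ : Fin p → Module.Dual R (Fin n → R) := fun j => LinearMap.proj j ∘ₗ B.vecMulLinear
  have h1 := congrArg (exteriorPower.pairingDual R (Fin n → R) p (exteriorPower.ιMulti R p φ))
    (b.sum_repr (exteriorPower.ιMulti R p fun i => A i))
  rw [map_sum, exteriorPower.pairingDual_ιMulti_ιMulti] at h1
  have e : A * B = Matrix.of fun i j => φ j (A i) := by
    ext i j
    simp [φ, Matrix.mul_apply, Matrix.vecMul, dotProduct]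
  rw [e, ← h1]
  refine Finset.sum_congr rfl fun I _ => ?_
  rw [map_smul, smul_eq_mul, exteriorPower.basis_repr_apply, exteriorPower.basis_apply,
    exteriorPower.ιMultiDual_apply_ιMulti, exteriorPower.ιMulti_family,
    exteriorPower.pairingDual_ιMulti_ιMulti]
  congr 1
  congr 1
  ext i j
  simp [φ, subsetEnum, Matrix.vecMul, Pi.basisFun_apply]

/-- The compound matrix, whose entries are the minors of order `p`. -/
def compoundMatrix (p : ℕ) {m n : ℕ} (A : Matrix (Fin m) (Fin n) R) :
    Matrix (Set.powersetCard (Fin m) p) (Set.powersetCard (Fin n) p) R :=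
  Matrix.of fun J I => (A.submatrix (subsetEnum J) (subsetEnum I)).det

theorem compoundMatrix_mul (p : ℕ) {l m n : ℕ} (A : Matrix (Fin l) (Fin m) R)
    (B : Matrix (Fin m) (Fin n) R) :
    compoundMatrix p (A * B) = compoundMatrix p A * compoundMatrix p B := by
  ext J I
  rw [Matrix.mul_apply]
  simp only [compoundMatrix, Matrix.of_apply]
  rw [Matrix.submatrix_mul A B (subsetEnum J) id (subsetEnum I) Function.bijective_id, det_mul_eq_sum_minors]
  rfl

/-- Some term of the expansion is nonzero. The permutation so obtained is a bijective matching of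
rows and columns, which replaces exchange arguments for bases. -/
theorem exists_perm_of_det_ne_zero {ι : Type*} [Fintype ι] [DecidableEq ι] {A : Matrix ι ι R}
    (h : A.det ≠ 0) : ∃ σ : Equiv.Perm ι, ∀ i, A (σ i) i ≠ 0 := by
  rw [Matrix.det_apply] at h
  obtain ⟨σ, -, hσ⟩ := Finset.exists_ne_zero_of_sum_ne_zero h
  refine ⟨σ, fun i hi => hσ ?_⟩
  have h0 : ∏ j, A (σ j) j = 0 := Finset.prod_eq_zero (mem_univ i) hi
  rw [h0, smul_zero]

/-- For a lower triangular matrix a nonzero minor forces its column indices to lie below its row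
indices after a permutation. The compound is therefore triangular for the grading of subsets by the
sum of their elements. -/
theorem sum_enum_le_of_minor_ne_zero {n p : ℕ} {A : Matrix (Fin n) (Fin n) R}
    (hA : ∀ i j, i < j → A i j = 0) {J I : Set.powersetCard (Fin n) p}
    (h : compoundMatrix p A J I ≠ 0) :
    ∑ s, ((subsetEnum I) s : ℕ) ≤ ∑ s, ((subsetEnum J) s : ℕ) ∧
      (∑ s, ((subsetEnum I) s : ℕ) = ∑ s, ((subsetEnum J) s : ℕ) → I = J) := by
  obtain ⟨σ, hσ⟩ := exists_perm_of_det_ne_zero h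
  have hle : ∀ s, ((subsetEnum I) s : ℕ) ≤ ((subsetEnum J) (σ s) : ℕ) := by
    intro s
    by_contra! hlt
    exact hσ s (hA _ _ hlt)
  have hsum : ∑ s, ((subsetEnum J) (σ s) : ℕ) = ∑ s, ((subsetEnum J) s : ℕ) :=
    Equiv.sum_comp σ fun s => ((subsetEnum J) s : ℕ)
  rw [← hsum]
  refine ⟨Finset.sum_le_sum fun s _ => hle s, fun heq => ?_⟩
  have := (Finset.sum_eq_sum_iff_of_le fun s _ => hle s).1 heq
  exact eq_of_range_subsetEnum_subset fun s => ⟨σ s, Fin.ext (this s (mem_univ s))⟩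

/-- Only the identity permutation contributes. Any other nonzero term would satisfy an index-sum
inequality for every subset while the two totals agree; equality throughout then forces the
permutation to fix every subset. -/
theorem det_compoundMatrix_of_lowerTriangular {n p : ℕ} {A : Matrix (Fin n) (Fin n) R}
    (hA : ∀ i j, i < j → A i j = 0) {φ : R} (hd : ∀ i, A i i = φ) :
    (compoundMatrix p A).det = φ ^ (p * Fintype.card (Set.powersetCard (Fin n) p)) := by
  rw [Matrix.det_apply, Finset.sum_eq_single 1]
  · simp only [Equiv.Perm.sign_one, one_smul, Equiv.Perm.coe_one, id]
    have : ∀ I : Set.powersetCard (Fin n) p, compoundMatrix p A I I = φ ^ p := by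
      intro I
      simp only [compoundMatrix, Matrix.of_apply]
      rw [Matrix.det_of_isLowerTriangular]
      · simp [hd]
      · intro i j hij
        exact hA _ _ ((subsetEnum I).strictMono hij)
    simp only [this]
    rw [Finset.prod_const, card_univ, pow_mul]
  · intro σ _ hσ
    by_contra hne
    have hne' : ∀ I, compoundMatrix p A (σ I) I ≠ 0 := by
      intro I hI
      apply hne
      have h0 : ∏ j, compoundMatrix p A (σ j) j = 0 := Finset.prod_eq_zero (mem_univ I) hI
      rw [h0, smul_zero]
    have hle : ∀ I : Set.powersetCard (Fin n) p,
        ∑ s, ((subsetEnum I) s : ℕ) ≤ ∑ s, (subsetEnum (σ I) s : ℕ) :=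
      fun I => (sum_enum_le_of_minor_ne_zero hA (hne' I)).1
    have hsum : ∑ I : Set.powersetCard (Fin n) p, ∑ s, ((subsetEnum I) s : ℕ) =
        ∑ I, ∑ s, (subsetEnum (σ I) s : ℕ) :=
      (Equiv.sum_comp σ fun I : Set.powersetCard (Fin n) p => ∑ s, ((subsetEnum I) s : ℕ)).symm
    have := (Finset.sum_eq_sum_iff_of_le fun I _ => hle I).1 hsum
    apply hσ
    ext1 I
    exact ((sum_enum_le_of_minor_ne_zero hA (hne' I)).2 (this I (mem_univ I))).symm
  · simp

theorem det_compoundMatrix_ne_zero {K : Type*} [Field K] {n : ℕ} (p : ℕ)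
    {A : Matrix (Fin n) (Fin n) K} (hA : A.det ≠ 0) : (compoundMatrix p A).det ≠ 0 := by
  intro h
  have h1 := compoundMatrix_mul p A A⁻¹
  rw [Matrix.mul_nonsing_inv A (isUnit_iff_ne_zero.2 hA)] at h1
  have h2 := det_compoundMatrix_of_lowerTriangular (p := p) (A := (1 : Matrix (Fin n) (Fin n) K))
    (φ := 1) (fun i j hij => Matrix.one_apply_ne hij.ne) (fun i => Matrix.one_apply_eq i)
  rw [h1, Matrix.det_mul, h, zero_mul, one_pow] at h2
  exact zero_ne_one h2

section Leibniz
variable {K : Type*} [Field K] (D : Derivation ℤ K K)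

/-- The coefficients of the Leibniz rule for the derivatives of a multiple of `φ`. -/
def leibnizCoeff (φ : K) : ℕ → ℕ → K
  | 0, j => if j = 0 then φ else 0
  | l + 1, j => D (leibnizCoeff φ l j) + if j = 0 then 0 else leibnizCoeff φ l (j - 1)

theorem leibnizCoeff_eq_zero (φ : K) {l j : ℕ} (h : l < j) : leibnizCoeff D φ l j = 0 := by
  induction l generalizing j with
  | zero => rw [leibnizCoeff, if_neg h.ne']
  | succ l ih =>
    rw [leibnizCoeff, ih (by omega), if_neg (by omega), ih (by omega)]
    simp

theorem leibnizCoeff_self (φ : K) (l : ℕ) : leibnizCoeff D φ l l = φ := by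
  induction l with
  | zero => rw [leibnizCoeff, if_pos rfl]
  | succ l ih =>
    rw [leibnizCoeff, leibnizCoeff_eq_zero D φ (Nat.lt_succ_self l)]
    simp [ih]

theorem iterate_derivation_mul (φ x : K) {l m : ℕ} (h : l < m) :
    D^[l] (φ * x) = ∑ j ∈ range m, leibnizCoeff D φ l j * D^[j] x := by
  induction l generalizing m with
  | zero =>
    rw [Finset.sum_eq_single 0]
    · simp [leibnizCoeff]
    · intro j _ hj
      simp [leibnizCoeff, hj]
    · intro h0
      exact absurd (mem_range.2 h) h0
  | succ l ih =>
    obtain ⟨m, rfl⟩ : ∃ m', m = m' + 1 := ⟨m - 1, by omega⟩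
    rw [Function.iterate_succ_apply', ih (m := m + 1) (by omega), map_sum]
    simp only [Derivation.leibniz, smul_eq_mul, leibnizCoeff, add_mul, Finset.sum_add_distrib]
    rw [add_comm, Finset.sum_range_succ (fun j => leibnizCoeff D φ l j * D (D^[j] x)),
      leibnizCoeff_eq_zero D φ (show l < m by omega), zero_mul, add_zero,
      Finset.sum_range_succ' (fun j => (if j = 0 then 0 else leibnizCoeff D φ l (j - 1)) * D^[j] x)]
    simp only [if_true, zero_mul, add_zero, Nat.succ_ne_zero, if_false, Nat.add_sub_cancel,
      Function.iterate_succ_apply']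
    congr 1
    exact Finset.sum_congr rfl fun j _ => mul_comm _ _

/-- The matrix of the Leibniz rule. -/
def leibnizMatrix (φ : K) (m : ℕ) : Matrix (Fin m) (Fin m) K :=
  Matrix.of fun l j => leibnizCoeff D φ l j

theorem leibnizMatrix_mul {ι : Type*} (φ : K) (m : ℕ) (f : ι → K) :
    leibnizMatrix D φ m * derivMatrix D (fun l : Fin m => (l : ℕ)) f =
      derivMatrix D (fun l : Fin m => (l : ℕ)) fun i => φ * f i := by
  ext l i
  rw [Matrix.mul_apply]
  simp only [leibnizMatrix, derivMatrix, Matrix.of_apply]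
  rw [iterate_derivation_mul D φ (f i) l.2,
    ← Fin.sum_univ_eq_sum_range (fun j => leibnizCoeff D φ l j * D^[j] (f i))]

theorem wronskianDet_mul (φ : K) {m : ℕ} (f : Fin m → K) :
    wronskianDet D (fun i => φ * f i) = φ ^ m * wronskianDet D f := by
  rw [wronskianDet, ← leibnizMatrix_mul, Matrix.det_mul, ← wronskianDet,
    Matrix.det_of_isLowerTriangular]
  · simp [leibnizMatrix, leibnizCoeff_self]
  · intro i j hij
    exact leibnizCoeff_eq_zero D φ hij

/-- Linear combinations with constant coefficients. -/
theorem derivMatrix_combination {m ι κ : Type*} [Fintype ι] (J : m → ℕ) (f : ι → K)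
    (a : κ → ι → K) (ha : ∀ s i, D (a s i) = 0) :
    derivMatrix D J (fun s => ∑ i, a s i * f i) = derivMatrix D J f * (Matrix.of a)ᵀ := by
  ext l s
  rw [Matrix.mul_apply]
  simp only [derivMatrix, Matrix.of_apply, Matrix.transpose_apply]
  rw [derivation_iterate_sum]
  exact Finset.sum_congr rfl fun i _ => by
    rw [derivation_iterate_const_mul D (ha s i), mul_comm]

/-- The matrix of generalized Wronskians of families of linear combinations. -/
theorem det_generalized_wronskians {n p : ℕ} (f : Fin n → K)
    (a : Set.powersetCard (Fin n) p → Fin p → Fin n → K) (ha : ∀ b s i, D (a b s i) = 0) :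
    (Matrix.of fun J b : Set.powersetCard (Fin n) p =>
      (derivMatrix D (fun l => ((subsetEnum J) l : ℕ)) fun s => ∑ i, a b s i * f i).det).det =
    (compoundMatrix p (derivMatrix D (fun l : Fin n => (l : ℕ)) f)).det *
      (Matrix.of fun I b : Set.powersetCard (Fin n) p =>
        ((Matrix.of (a b)).submatrix id (subsetEnum I)).det).det := by
  rw [← Matrix.det_mul]
  congr 1
  ext J b
  rw [Matrix.of_apply, derivMatrix_combination D _ f (a b) (ha b), det_mul_eq_sum_minors,
    Matrix.mul_apply]
  refine Finset.sum_congr rfl fun I _ => ?_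
  rw [Matrix.of_apply, ← Matrix.det_transpose ((Matrix.of (a b)).submatrix id (subsetEnum I))]
  rfl

variable {D} {S : Subring K} {C : Subfield K}

/-- The determinant of the compound Wronskian matrix, compared with the product of the Wronskians
of independent families of linear combinations. -/
theorem det_compound_div_prod_wronskianDet_mem (hS : ∀ x ∈ S, D x ∈ S) (hC : ∀ x ∈ C, D x ∈ C)
    (hSC : ∀ x ∈ S, x ∈ C) (hlog : ∀ x ∈ C, D x / x ∈ S) {n p : ℕ} (f : Fin n → K) {φ : K}
    (hφ : φ ≠ 0) (hf : ∀ i, f i / φ ∈ C)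
    (a : Set.powersetCard (Fin n) p → Fin p → Fin n → K) (ha : ∀ b s i, D (a b s i) = 0)
    (haC : ∀ b s i, a b s i ∈ C)
    (hW : ∀ b, wronskianDet D (fun s => ∑ i, a b s i * f i) ≠ 0) :
    (compoundMatrix p (derivMatrix D (fun l : Fin n => (l : ℕ)) f)).det *
      (Matrix.of fun I b : Set.powersetCard (Fin n) p =>
        ((Matrix.of (a b)).submatrix id (subsetEnum I)).det).det /
      ∏ b, wronskianDet D (fun s => ∑ i, a b s i * f i) ∈ S := by
  -- Only the ratios `f i / φ` are known to lie in `C`. The factor `φ` enters the compound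
  -- determinant and the product of Wronskians with the same power, and cancels.
  set g : Fin n → K := fun i => f i / φ with hg
  have hfg : f = fun i => φ * g i := by
    ext i; simp only [hg]; field_simp
  have hη : ∀ b, (fun s => ∑ i, a b s i * f i) = fun s => φ * ∑ i, a b s i * g i := by
    intro b
    ext s
    rw [Finset.mul_sum]
    exact Finset.sum_congr rfl fun i _ => by rw [hfg]; ring
  have hWg : ∀ b, wronskianDet D (fun s => ∑ i, a b s i * f i) =
      φ ^ p * wronskianDet D (fun s => ∑ i, a b s i * g i) := by
    intro b
    rw [hη b, wronskianDet_mul]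
  have hWg0 : ∀ b, wronskianDet D (fun s => ∑ i, a b s i * g i) ≠ 0 := by
    intro b h0
    exact hW b (by rw [hWg, h0, mul_zero])
  have hcomp : (compoundMatrix p (derivMatrix D (fun l : Fin n => (l : ℕ)) f)).det =
      φ ^ (p * Fintype.card (Set.powersetCard (Fin n) p)) *
        (compoundMatrix p (derivMatrix D (fun l : Fin n => (l : ℕ)) g)).det := by
    conv_lhs => rw [hfg]
    rw [← leibnizMatrix_mul, compoundMatrix_mul, Matrix.det_mul,
      det_compoundMatrix_of_lowerTriangular (φ := φ)]
    · exact fun i j hij => leibnizCoeff_eq_zero D φ hij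
    · exact fun i => leibnizCoeff_self D φ i
  rw [hcomp, mul_assoc, ← det_generalized_wronskians D g a ha]
  simp only [hWg]
  rw [Finset.prod_mul_distrib, Finset.prod_const, card_univ, ← pow_mul,
    mul_div_mul_left _ _ (pow_ne_zero _ hφ)]
  have e : (Matrix.of fun J b : Set.powersetCard (Fin n) p =>
      (derivMatrix D (fun l => ((subsetEnum J) l : ℕ)) fun s => ∑ i, a b s i * g i).det) =
      Matrix.of fun J b => wronskianDet D (fun s => ∑ i, a b s i * g i) *
        ((derivMatrix D (fun l => ((subsetEnum J) l : ℕ)) fun s => ∑ i, a b s i * g i).det /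
          wronskianDet D (fun s => ∑ i, a b s i * g i)) := by
    ext J b
    simp only [Matrix.of_apply]
    rw [mul_div_cancel₀ _ (hWg0 b)]
  rw [e]
  -- Each Wronskian is pulled out of its own column; what is left is a determinant of quotients of
  -- generalized Wronskians.
  have e2 := Matrix.det_mul_row (fun b => wronskianDet D (fun s => ∑ i, a b s i * g i))
    (Matrix.of fun J b : Set.powersetCard (Fin n) p =>
      (derivMatrix D (fun l => ((subsetEnum J) l : ℕ)) fun s => ∑ i, a b s i * g i).det /
          wronskianDet D (fun s => ∑ i, a b s i * g i))
  simp only [Matrix.of_apply] at e2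
  rw [e2, mul_div_cancel_left₀ _ (Finset.prod_ne_zero_iff.2 fun b _ => hWg0 b), Matrix.det_apply]
  refine S.sum_mem fun σ _ => S.zsmul_mem (S.prod_mem fun b _ => ?_) _
  exact det_derivMatrix_div_wronskianDet_mem hS hC hSC hlog _
    (fun s => C.sum_mem fun i _ => C.mul_mem (haC b s i) (hf i)) (hWg0 b) _

end Leibniz
end CompoundMatrices

/-! ### Bases adapted to vanishing orders. -/

section AdaptedBases
open Finset

/-- Order functions on a complex vector space whose graded pieces are at most one-dimensional. -/
structure IsOrderFunction {V : Type*} [AddCommGroup V] [Module ℂ V] (v : V → ℕ∞) : Prop where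
  min_le_add : ∀ x y, min (v x) (v y) ≤ v (x + y)
  smul_eq : ∀ (c : ℂ) x, c ≠ 0 → v (c • x) = v x
  exists_lt : ∀ x y, v x = v y → v x ≠ ⊤ → ∃ c : ℂ, v x < v (x - c • y)
  eq_top_iff : ∀ x, v x = ⊤ ↔ x = 0

namespace IsOrderFunction
variable {V : Type*} [AddCommGroup V] [Module ℂ V] {v : V → ℕ∞} (hv : IsOrderFunction v)
include hv

theorem lt_sum {ι : Type*} (S : Finset ι) (x : ι → V) {e : ℕ} (h : ∀ i ∈ S, (e : ℕ∞) < v (x i)) :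
    (e : ℕ∞) < v (∑ i ∈ S, x i) := by
  classical
  induction S using Finset.induction_on with
  | empty =>
    rw [Finset.sum_empty, (hv.eq_top_iff 0).2 rfl]
    exact ENat.natCast_lt_top e
  | insert a S ha ih =>
    rw [Finset.sum_insert ha]
    exact (lt_min (h a (mem_insert_self _ _)) (ih fun i hi => h i (mem_insert_of_mem hi))).trans_le
      (hv.min_le_add _ _)

/-- With pairwise distinct orders nothing cancels: the term of least order among those with nonzero
coefficient would otherwise equal a sum of elements of strictly larger order. -/
theorem le_of_coeff_ne_zero {ι : Type*} [Fintype ι] {ξ : ι → V} {e : ι → ℕ}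
    (he : Function.Injective e) (hξ : ∀ i, v (ξ i) = e i) (c : ι → ℂ) {j : ι} (hj : c j ≠ 0) :
    v (∑ i, c i • ξ i) ≤ e j := by
  classical
  by_contra! hlt
  obtain ⟨j₀, hj₀, hmin⟩ := Finset.exists_min_image (univ.filter fun i => c i ≠ 0) e
    ⟨j, by simp [hj]⟩
  have hc0 : c j₀ ≠ 0 := (mem_filter.1 hj₀).2
  have hle : e j₀ ≤ e j := hmin j (by simp [hj])
  have e1 : c j₀ • ξ j₀ = ∑ i, c i • ξ i + ∑ i ∈ univ.erase j₀, (-c i) • ξ i := by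
    rw [← Finset.add_sum_erase _ _ (mem_univ j₀), add_assoc, ← Finset.sum_add_distrib]
    simp
  have h1 : (e j₀ : ℕ∞) < v (∑ i ∈ univ.erase j₀, (-c i) • ξ i) := by
    refine hv.lt_sum _ _ fun i hi => ?_
    by_cases hci : c i = 0
    · rw [hci, neg_zero, zero_smul, (hv.eq_top_iff 0).2 rfl]
      exact ENat.natCast_lt_top _
    · rw [hv.smul_eq _ _ (neg_ne_zero.2 hci), hξ]
      have h2 := hmin i (by simp [hci])
      have h3 : e j₀ ≠ e i := fun h => (ne_of_mem_erase hi) (he h).symm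
      exact_mod_cast lt_of_le_of_ne h2 h3
  have h2 : (e j₀ : ℕ∞) < v (∑ i, c i • ξ i) := lt_of_le_of_lt (by exact_mod_cast hle) hlt
  have h3 := (lt_min h2 h1).trans_le (hv.min_le_add _ _)
  rw [← e1, hv.smul_eq _ _ hc0, hξ] at h3
  exact lt_irrefl _ h3

/-- As long as the order of `y - u` collides with some `e i`, subtracting a multiple of `ξ i` raises
it. Either the collisions stop or the order exceeds any given bound. -/
theorem exists_sub_ne {ι : Type*} (S : Finset ι) (ξ : ι → V) (e : ι → ℕ)
    (hξ : ∀ i ∈ S, v (ξ i) = e i) (U : Submodule ℂ V) (hU : ∀ i ∈ S, ξ i ∈ U) (y : V) (k : ℕ) :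
    ∃ u ∈ U, (∀ i ∈ S, v (y - u) ≠ e i) ∨ (k : ℕ∞) ≤ v (y - u) := by
  induction k with
  | zero => exact ⟨0, U.zero_mem, Or.inr (by simp)⟩
  | succ k ih =>
    obtain ⟨u, hu, h | h⟩ := ih
    · exact ⟨u, hu, Or.inl h⟩
    · by_cases hall : ∀ i ∈ S, v (y - u) ≠ e i
      · exact ⟨u, hu, Or.inl hall⟩
      · push Not at hall
        obtain ⟨i, hi, hie⟩ := hall
        obtain ⟨c, hc⟩ := hv.exists_lt (y - u) (ξ i) (hie.trans (hξ i hi).symm)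
          (by rw [hie]; exact ENat.natCast_ne_top _)
        refine ⟨u + c • ξ i, U.add_mem hu (U.smul_mem c (hU i hi)), Or.inr ?_⟩
        rw [← sub_sub]
        have := Order.add_one_le_of_lt (h.trans_lt hc)
        exact_mod_cast this

/-- Gaussian elimination by orders: each new vector is corrected by the span already treated until
its order is new, and independence keeps that order finite. -/
theorem exists_adapted_finset {ι : Type*} (S : Finset ι) (η : ι → V)
    (hη : LinearIndependent ℂ η) :
    ∃ (ξ : ι → V) (e : ι → ℕ), Set.InjOn e S ∧ (∀ i ∈ S, v (ξ i) = e i) ∧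
      Submodule.span ℂ (ξ '' S) = Submodule.span ℂ (η '' S) := by
  classical
  induction S using Finset.induction_on with
  | empty => exact ⟨η, fun _ => 0, by simp, by simp, rfl⟩
  | insert a S ha ih =>
    obtain ⟨ξ, e, he, hξ, hspan⟩ := ih
    set U := Submodule.span ℂ (η '' S) with hU
    have hξU : ∀ i ∈ S, ξ i ∈ U := fun i hi => by
      rw [← hspan]; exact Submodule.subset_span ⟨i, hi, rfl⟩
    have hηa : η a ∉ U := by
      have := hη.notMem_span_image (s := (S : Set ι)) (x := a) (by simpa using ha)
      exact this
    -- With the bound one above all orders in use, the second alternative also excludes collisions.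
    obtain ⟨u, hu, h⟩ := hv.exists_sub_ne S ξ e hξ U hξU (η a) (S.sup e + 1)
    have hne : ∀ i ∈ S, v (η a - u) ≠ e i := by
      rcases h with h | h
      · exact h
      · intro i hi heq
        rw [heq] at h
        have h1 : S.sup e + 1 ≤ e i := by exact_mod_cast h
        have h2 : e i ≤ S.sup e := Finset.le_sup (f := e) hi
        omega
    have htop : v (η a - u) ≠ ⊤ := by
      rw [Ne, hv.eq_top_iff, sub_eq_zero]
      rintro rfl
      exact hηa hu
    have hup : ∀ i ∈ S, i ≠ a := fun i hi h => ha (h ▸ hi)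
    refine ⟨Function.update ξ a (η a - u), Function.update e a (v (η a - u)).toNat, ?_, ?_, ?_⟩
    · rw [coe_insert, Set.injOn_insert (by simpa using ha)]
      refine ⟨fun i hi j hj hij => ?_, ?_⟩
      · rw [Function.update_of_ne (hup i hi), Function.update_of_ne (hup j hj)] at hij
        exact he hi hj hij
      · rintro ⟨i, hi, hia⟩
        rw [Function.update_self, Function.update_of_ne (hup i hi)] at hia
        exact hne i hi (by rw [hia, ENat.natCast_toNat htop])
    · intro i hi
      rcases mem_insert.1 hi with rfl | hi
      · rw [Function.update_self, Function.update_self, ENat.natCast_toNat htop]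
      · rw [Function.update_of_ne (hup i hi), Function.update_of_ne (hup i hi), hξ i hi]
    · have himg : Function.update ξ a (η a - u) '' (S : Set ι) = ξ '' (S : Set ι) :=
        Set.image_congr fun i hi => Function.update_of_ne (hup i hi) _ _
      rw [coe_insert, Set.image_insert_eq, Set.image_insert_eq, himg, Function.update_self,
        Submodule.span_insert, Submodule.span_insert, hspan]
      refine le_antisymm (sup_le ?_ le_sup_right) (sup_le ?_ le_sup_right)
      · rw [Submodule.span_singleton_le_iff_mem]
        exact Submodule.sub_mem _ (Submodule.mem_sup_left (Submodule.mem_span_singleton_self _))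
          (Submodule.mem_sup_right hu)
      · rw [Submodule.span_singleton_le_iff_mem]
        have h3 := Submodule.add_mem (Submodule.span ℂ {η a - u} ⊔ U)
          (Submodule.mem_sup_left (Submodule.mem_span_singleton_self (η a - u)))
          (Submodule.mem_sup_right hu)
        simpa using h3

/-- A basis with strictly increasing orders. -/
theorem exists_adapted {m : ℕ} (η : Fin m → V) (hη : LinearIndependent ℂ η) :
    ∃ (ξ : Fin m → V) (e : Fin m → ℕ), StrictMono e ∧ (∀ i, v (ξ i) = e i) ∧
      (∃ Q : Fin m → Fin m → ℂ, ∀ i, η i = ∑ j, Q i j • ξ j) ∧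
      ∃ P : Fin m → Fin m → ℂ, ∀ i, ξ i = ∑ j, P i j • η j := by
  obtain ⟨ξ, e, he, hξ, hspan⟩ := hv.exists_adapted_finset univ η hη
  rw [coe_univ, Set.injOn_univ] at he
  rw [coe_univ, Set.image_univ, Set.image_univ] at hspan
  set σ := Tuple.sort e
  have hmono : StrictMono (e ∘ σ) :=
    (Tuple.monotone_sort e).strictMono_of_injective (he.comp σ.injective)
  have hrange : Set.range (ξ ∘ σ) = Set.range ξ := σ.surjective.range_comp ξ
  refine ⟨ξ ∘ σ, e ∘ σ, hmono, fun i => hξ _ (mem_univ _), ?_, ?_⟩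
  · have : ∀ i, ∃ c : Fin m → ℂ, ∑ j, c j • (ξ ∘ σ) j = η i := fun i => by
      rw [← Submodule.mem_span_range_iff_exists_fun ℂ, hrange, hspan]
      exact Submodule.subset_span ⟨i, rfl⟩
    choose Q hQ using this
    exact ⟨Q, fun i => (hQ i).symm⟩
  · have : ∀ i, ∃ c : Fin m → ℂ, ∑ j, c j • η j = (ξ ∘ σ) i := fun i => by
      rw [← Submodule.mem_span_range_iff_exists_fun ℂ, ← hspan, ← hrange]
      exact Submodule.subset_span ⟨i, rfl⟩
    choose P hP using this
    exact ⟨P, fun i => (hP i).symm⟩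

end IsOrderFunction

/-- The space of entire functions. -/
def entireFunctions : Submodule ℂ (ℂ → ℂ) where
  carrier := {f | Differentiable ℂ f}
  add_mem' := fun hf hg => Differentiable.add hf hg
  zero_mem' := differentiable_const 0
  smul_mem' := fun c _ hf => Differentiable.const_smul hf c

theorem analyticOrderAt_ne_top_of_entire {f : ℂ → ℂ} (hf : Differentiable ℂ f) (h : f ≠ 0)
    (a : ℂ) : analyticOrderAt f a ≠ ⊤ := by
  intro h0
  apply h
  rw [analyticOrderAt_eq_top] at h0
  exact AnalyticOnNhd.eq_of_eventuallyEq (fun z _ => hf.analyticAt z)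
    (fun z _ => analyticAt_const) h0

theorem isOrderFunction_analyticOrderAt (a : ℂ) :
    IsOrderFunction fun f : entireFunctions => analyticOrderAt (f : ℂ → ℂ) a where
  min_le_add x y := le_analyticOrderAt_add
  smul_eq c x hc := by
    have h1 := analyticOrderAt_smul (f := fun _ : ℂ => c) (z₀ := a) analyticAt_const
      (x.2.analyticAt a)
    have h2 : analyticOrderAt (fun _ : ℂ => c) a = 0 := by
      rw [analyticOrderAt_eq_zero]; exact Or.inr hc
    rw [h2, zero_add] at h1
    exact h1
  eq_top_iff x := by
    refine ⟨fun h => ?_, fun h => ?_⟩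
    · by_contra hne
      exact analyticOrderAt_ne_top_of_entire x.2 (fun h0 => hne (Subtype.ext h0)) a h
    · subst h
      exact analyticOrderAt_eq_top.2 (Filter.Eventually.of_forall fun _ => rfl)
  exists_lt x y hxy hx := by
    have hxa := x.2.analyticAt a
    have hya := y.2.analyticAt a
    obtain ⟨n, hn⟩ := ENat.ne_top_iff_exists.1 hx
    obtain ⟨g, hg, hg0, hgx⟩ := hxa.analyticOrderAt_eq_natCast.1 hn.symm
    obtain ⟨g', hg', hg0', hgy⟩ := hya.analyticOrderAt_eq_natCast.1 (hxy.symm.trans hn.symm)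
    -- The ratio of the leading coefficients at `a`, which cancels the lowest term.
    refine ⟨g a / g' a, ?_⟩
    have hlt : ((n + 1 : ℕ) : ℕ∞) ≤ analyticOrderAt ((x - (g a / g' a) • y : entireFunctions) :
        ℂ → ℂ) a := by
      set w : ℂ → ℂ := fun z => g z - g a / g' a * g' z with hw
      have hwa : AnalyticAt ℂ w a := hg.sub (analyticAt_const.mul hg')
      have hw0 : analyticOrderAt w a ≠ 0 := by
        rw [hwa.analyticOrderAt_ne_zero]
        simp only [hw]
        field_simp
        ring
      have hw1 : ((1 : ℕ) : ℕ∞) ≤ analyticOrderAt w a := by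
        rw [Nat.cast_one]
        exact Order.one_le_iff_pos.2 (pos_iff_ne_zero.2 hw0)
      obtain ⟨w', hw'a, hw'⟩ := (natCast_le_analyticOrderAt hwa).1 hw1
      refine (natCast_le_analyticOrderAt ((x - (g a / g' a) • y).2.analyticAt a)).2 ⟨w', hw'a, ?_⟩
      filter_upwards [hgx, hgy, hw'] with z h1 h2 h3
      simp only [hw, smul_eq_mul, pow_one] at h1 h2 h3
      simp only [Submodule.coe_sub, Submodule.coe_smul, Pi.sub_apply, Pi.smul_apply, smul_eq_mul,
        h1, h2]
      rw [pow_succ, mul_assoc, ← h3]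
      ring
    refine lt_of_lt_of_le ?_ hlt
    change analyticOrderAt (x : ℂ → ℂ) a < _
    rw [← hn]
    exact_mod_cast Nat.lt_succ_self n

end AdaptedBases

/-! ### Vanishing orders of Wronskians and of compound Wronskians. -/

section WronskianOrders
open Finset Filter Topology
open scoped Matrix

theorem Differentiable.iteratedDeriv_complex {f : ℂ → ℂ} (hf : Differentiable ℂ f) (l : ℕ) :
    Differentiable ℂ (iteratedDeriv l f) :=
  ContDiff.differentiable_iteratedDeriv' l hf.contDiff

/-- The matrix of derivatives `f_i^{(J_l)}(z)`. -/
noncomputable def wronskianMatrix {m ι : Type*} (J : m → ℕ) (f : ι → ℂ → ℂ) (z : ℂ) : Matrix m ι ℂ :=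
  Matrix.of fun l i => iteratedDeriv (J l) (f i) z

theorem wronskianMatrix_combination {m ι κ : Type*} [Fintype ι] (J : m → ℕ) {f : ι → ℂ → ℂ}
    (hf : ∀ i, Differentiable ℂ (f i)) (a : Matrix κ ι ℂ) (z : ℂ) :
    wronskianMatrix J (fun s z => ∑ i, a s i * f i z) z = wronskianMatrix J f z * aᵀ := by
  ext l s
  rw [Matrix.mul_apply]
  simp only [wronskianMatrix, Matrix.of_apply, Matrix.transpose_apply]
  rw [iteratedDeriv_fun_sum (f := fun i z => a s i * f i z)
    fun i _ => (contDiff_const.mul (hf i).contDiff).contDiffAt]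
  exact Finset.sum_congr rfl fun i _ => by rw [iteratedDeriv_const_mul_field, mul_comm]

theorem differentiable_det {m : Type*} [Fintype m] [DecidableEq m] {A : ℂ → Matrix m m ℂ}
    (hA : ∀ i j, Differentiable ℂ fun z => A z i j) : Differentiable ℂ fun z => (A z).det := by
  simp only [Matrix.det_apply]
  exact Differentiable.fun_sum fun σ _ => Differentiable.const_smul
    (Differentiable.fun_finsetProd fun i _ => hA _ _) _

theorem analyticAt_det {m : Type*} [Fintype m] [DecidableEq m] {A : ℂ → Matrix m m ℂ} {a : ℂ}
    (hA : ∀ i j, AnalyticAt ℂ (fun z => A z i j) a) : AnalyticAt ℂ (fun z => (A z).det) a := by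
  simp only [Matrix.det_apply']
  exact Finset.analyticAt_fun_sum _ fun σ _ => analyticAt_const.mul
    (Finset.analyticAt_fun_prod _ fun i _ => hA _ _)

theorem differentiable_wronskianMatrix {m ι : Type*} (J : m → ℕ) {f : ι → ℂ → ℂ}
    (hf : ∀ i, Differentiable ℂ (f i)) (l : m) (i : ι) :
    Differentiable ℂ fun z => wronskianMatrix J f z l i :=
  (hf i).iteratedDeriv_complex (J l)

theorem Matrix.det_of_pow_scaling {m R : Type*} [CommRing R] [Fintype m] [DecidableEq m] {x : R} {r c : m → ℕ}
    {A B : Matrix m m R} (h : ∀ l i, x ^ r l * A l i = x ^ c i * B l i) :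
    x ^ (∑ l, r l) * A.det = x ^ (∑ i, c i) * B.det := by
  rw [← Finset.prod_pow_eq_pow_sum, ← Finset.prod_pow_eq_pow_sum, ← Matrix.det_mul_column,
    ← Matrix.det_mul_row]
  congr 1
  ext l i
  exact h l i

theorem analyticOrderAt_pow_mul {φ : ℂ → ℂ} {a : ℂ} (hφ : AnalyticAt ℂ φ a) (n : ℕ) :
    analyticOrderAt (fun z => (z - a) ^ n * φ z) a = n + analyticOrderAt φ a := by
  have h := analyticOrderAt_mul (f := fun z => (z - a) ^ n) (g := φ) (z₀ := a)
    ((analyticAt_id.sub analyticAt_const).pow n) hφ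
  have h2 : analyticOrderAt (fun z => (z - a) ^ n) a = n := by
    have := analyticOrderAt_centeredMonomial (𝕜 := ℂ) (z₀ := a) (n := n)
    exact this
  rw [h2] at h
  exact h

/-- Multiplying by `(z - a) ^ l` avoids the exponent `E - l`, which may be negative. The leading
coefficient acquires the falling factorial `E (E - 1) ... (E - l + 1)`. -/
theorem exists_pow_mul_iteratedDeriv {ξ : ℂ → ℂ} {a : ℂ} (hξ : Differentiable ℂ ξ) {E : ℕ}
    (hE : analyticOrderAt ξ a = E) : ∃ φ : ℂ, φ ≠ 0 ∧ ∀ l : ℕ, ∃ ψ : ℂ → ℂ, AnalyticAt ℂ ψ a ∧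
      ψ a = (descPochhammer ℂ l).eval (E : ℂ) * φ ∧
      ∀ᶠ z in 𝓝 a, (z - a) ^ l * iteratedDeriv l ξ z = (z - a) ^ E * ψ z := by
  obtain ⟨g, hg, hg0, hgξ⟩ := (hξ.analyticAt a).analyticOrderAt_eq_natCast.1 hE
  refine ⟨g a, hg0, fun l => ?_⟩
  induction l with
  | zero => exact ⟨g, hg, by simp, by simpa using hgξ⟩
  | succ l ih =>
    obtain ⟨ψ, hψ, hψa, h⟩ := ih
    refine ⟨fun z => ((E : ℂ) - l) * ψ z + (z - a) * deriv ψ z,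
      (analyticAt_const.mul hψ).add ((analyticAt_id.sub analyticAt_const).mul hψ.deriv), ?_, ?_⟩
    · simp only [sub_self, zero_mul, add_zero, hψa, descPochhammer_succ_eval]
      ring
    · filter_upwards [h.eventually_nhds, hψ.eventually_analyticAt] with z hz hψz
      have hd := Filter.EventuallyEq.deriv_eq hz
      have hlin : ∀ j : ℕ, HasDerivAt (fun z : ℂ => (z - a) ^ j) (j * (z - a) ^ (j - 1)) z :=
        fun j => by simpa using ((hasDerivAt_id z).sub_const a).fun_pow j
      have h1 := (hlin l).fun_mul ((hξ.iteratedDeriv_complex l) z).hasDerivAt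
      have h2 := (hlin E).fun_mul hψz.differentiableAt.hasDerivAt
      rw [h1.deriv, h2.deriv, ← iteratedDeriv_succ] at hd
      have hp : ∀ j : ℕ, (z - a) * (j * (z - a) ^ (j - 1)) = j * (z - a) ^ j := by
        intro j
        cases j with
        | zero => simp
        | succ j => rw [Nat.add_sub_cancel, pow_succ]; ring
      have h3 := congrArg (fun w => (z - a) * w) hd
      have h0 := hz.self_of_nhds
      rw [pow_succ]
      linear_combination h3 + (l : ℂ) * (-1) * h0 - iteratedDeriv l ξ z * hp l + ψ z * hp E

/-- Scaled derivative matrices of functions of prescribed orders at a point. -/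
theorem exists_scaled_wronskianMatrix {ι : Type*} {ξ : ι → ℂ → ℂ} {a : ℂ}
    (hξ : ∀ i, Differentiable ℂ (ξ i)) {E : ι → ℕ} (hE : ∀ i, analyticOrderAt (ξ i) a = E i) :
    ∃ (φ : ι → ℂ) (Ψ : ℕ → ι → ℂ → ℂ), (∀ i, φ i ≠ 0) ∧ ∀ l i, AnalyticAt ℂ (Ψ l i) a ∧
      Ψ l i a = (descPochhammer ℂ l).eval (E i : ℂ) * φ i ∧
      ∀ᶠ z in 𝓝 a, (z - a) ^ l * iteratedDeriv l (ξ i) z = (z - a) ^ E i * Ψ l i z := by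
  choose φ hφ Ψ hΨ using fun i => exists_pow_mul_iteratedDeriv (hξ i) (hE i)
  exact ⟨φ, fun l i => Ψ i l, hφ, fun l i => hΨ i l⟩

/-- After scaling, the determinant at `a` is a product of nonzero leading coefficients and a
determinant of falling factorials. The latter is a Vandermonde determinant, nonzero because the
orders are distinct. -/
theorem analyticOrderAt_det_wronskianMatrix {m : ℕ} {ξ : Fin m → ℂ → ℂ} {a : ℂ}
    (hξ : ∀ i, Differentiable ℂ (ξ i)) {E : Fin m → ℕ} (hE : ∀ i, analyticOrderAt (ξ i) a = E i)
    (hinj : Function.Injective E) :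
    ((∑ l : Fin m, (l : ℕ) : ℕ) : ℕ∞) +
      analyticOrderAt (fun z => (wronskianMatrix (fun l : Fin m => (l : ℕ)) ξ z).det) a =
      ((∑ i, E i : ℕ) : ℕ∞) := by
  obtain ⟨φ, Ψ, hφ, hΨ⟩ := exists_scaled_wronskianMatrix hξ hE
  set B : ℂ → Matrix (Fin m) (Fin m) ℂ := fun z => Matrix.of fun l i => Ψ l i z with hB
  have hBan : AnalyticAt ℂ (fun z => (B z).det) a := analyticAt_det fun l i => (hΨ l i).1
  have hBa : (B a).det ≠ 0 := by
    have h1 : B a = Matrix.of fun l i => φ i *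
        (Matrix.of fun l i : Fin m => (descPochhammer ℂ l).eval (E i : ℂ)) l i := by
      ext l i
      simp only [hB, Matrix.of_apply, (hΨ l i).2.1, mul_comm]
    rw [h1, Matrix.det_mul_row]
    refine mul_ne_zero (Finset.prod_ne_zero_iff.2 fun i _ => hφ i) ?_
    have h2 := Matrix.det_eval_matrixOfPolynomials_eq_det_vandermonde (fun i => (E i : ℂ))
      (fun l : Fin m => descPochhammer ℂ l) (fun l => descPochhammer_natDegree ℂ l)
      (fun l => monic_descPochhammer ℂ l)
    rw [← Matrix.det_transpose]
    have h3 : (Matrix.vandermonde fun i => (E i : ℂ)).det ≠ 0 :=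
      Matrix.det_vandermonde_ne_zero_iff.2 fun i j hij => hinj (by exact_mod_cast hij)
    rw [h2] at h3
    exact h3
  have hW : AnalyticAt ℂ (fun z => (wronskianMatrix (fun l : Fin m => (l : ℕ)) ξ z).det) a :=
    (differentiable_det fun l i => differentiable_wronskianMatrix _ hξ l i).analyticAt a
  have hev : (fun z => (z - a) ^ (∑ l : Fin m, (l : ℕ)) *
      (wronskianMatrix (fun l : Fin m => (l : ℕ)) ξ z).det) =ᶠ[𝓝 a]
      fun z => (z - a) ^ (∑ i, E i) * (B z).det := by
    have : ∀ᶠ z in 𝓝 a, ∀ l i : Fin m,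
        (z - a) ^ (l : ℕ) * iteratedDeriv l (ξ i) z = (z - a) ^ E i * Ψ l i z :=
      eventually_all.2 fun l => eventually_all.2 fun i => (hΨ l i).2.2
    filter_upwards [this] with z hz
    exact Matrix.det_of_pow_scaling hz
  have h4 := analyticOrderAt_congr hev
  rw [analyticOrderAt_pow_mul hW, analyticOrderAt_pow_mul hBan, hBan.analyticOrderAt_eq_zero.2 hBa,
    add_zero] at h4
  exact h4

/-- The scaling of rows and columns is applied first to each minor and then to the matrix of minors.
The remaining factor is holomorphic, and a lower bound is all that is needed. -/
theorem le_analyticOrderAt_det_compoundMatrix {n : ℕ} (p : ℕ) {ξ : Fin n → ℂ → ℂ} {a : ℂ}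
    (hξ : ∀ i, Differentiable ℂ (ξ i)) {E : Fin n → ℕ} (hE : ∀ i, analyticOrderAt (ξ i) a = E i) :
    ((∑ I : Set.powersetCard (Fin n) p, ∑ s, E (subsetEnum I s) : ℕ) : ℕ∞) ≤
      ((∑ J : Set.powersetCard (Fin n) p, ∑ s, (subsetEnum J s : ℕ) : ℕ) : ℕ∞) +
      analyticOrderAt (fun z =>
        (compoundMatrix p (wronskianMatrix (fun l : Fin n => (l : ℕ)) ξ z)).det) a := by
  obtain ⟨φ, Ψ, hφ, hΨ⟩ := exists_scaled_wronskianMatrix hξ hE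
  set B : ℂ → Matrix (Fin n) (Fin n) ℂ := fun z => Matrix.of fun l i => Ψ l i z with hB
  have hBan : AnalyticAt ℂ (fun z => (compoundMatrix p (B z)).det) a :=
    analyticAt_det fun J I => analyticAt_det fun s t => (hΨ (subsetEnum J s) (subsetEnum I t)).1
  have hW : AnalyticAt ℂ (fun z =>
      (compoundMatrix p (wronskianMatrix (fun l : Fin n => (l : ℕ)) ξ z)).det) a :=
    (differentiable_det fun J I => differentiable_det fun s t =>
      differentiable_wronskianMatrix _ hξ (subsetEnum J s) (subsetEnum I t)).analyticAt a
  have hev : (fun z => (z - a) ^ (∑ J : Set.powersetCard (Fin n) p, ∑ s, (subsetEnum J s : ℕ)) *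
      (compoundMatrix p (wronskianMatrix (fun l : Fin n => (l : ℕ)) ξ z)).det) =ᶠ[𝓝 a]
      fun z => (z - a) ^ (∑ I : Set.powersetCard (Fin n) p, ∑ s, E (subsetEnum I s)) *
        (compoundMatrix p (B z)).det := by
    have : ∀ᶠ z in 𝓝 a, ∀ l i : Fin n,
        (z - a) ^ (l : ℕ) * iteratedDeriv l (ξ i) z = (z - a) ^ E i * Ψ l i z :=
      eventually_all.2 fun l => eventually_all.2 fun i => (hΨ l i).2.2
    filter_upwards [this] with z hz
    exact Matrix.det_of_pow_scaling fun J I => Matrix.det_of_pow_scaling fun s t => hz _ _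
  have h4 := analyticOrderAt_congr hev
  rw [analyticOrderAt_pow_mul hW, analyticOrderAt_pow_mul hBan] at h4
  rw [h4]
  exact le_self_add

theorem analyticOrderAt_const_mul {φ : ℂ → ℂ} {a c : ℂ} (hφ : AnalyticAt ℂ φ a) (hc : c ≠ 0) :
    analyticOrderAt (fun z => c * φ z) a = analyticOrderAt φ a := by
  have h := analyticOrderAt_mul (f := fun _ : ℂ => c) (g := φ) (z₀ := a) analyticAt_const hφ
  rw [analyticAt_const.analyticOrderAt_eq_zero.2 hc, zero_add] at h
  exact h

/-- Linearly independent entire functions have an adapted basis at every point. -/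
theorem exists_adapted_entire {m : ℕ} {η : Fin m → ℂ → ℂ} (hη : ∀ i, Differentiable ℂ (η i))
    (hLI : LinearIndependent ℂ η) (a : ℂ) :
    ∃ (ξ : Fin m → ℂ → ℂ) (E : Fin m → ℕ) (P Q : Matrix (Fin m) (Fin m) ℂ), StrictMono E ∧
      (∀ i, Differentiable ℂ (ξ i)) ∧ (∀ i, analyticOrderAt (ξ i) a = E i) ∧
      (∀ i, ξ i = fun z => ∑ j, P i j * η j z) ∧ (∀ i, η i = fun z => ∑ j, Q i j * ξ j z) ∧
      Q * P = 1 := by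
  set η' : Fin m → entireFunctions := fun i => ⟨η i, hη i⟩ with hη'
  have hLI' : LinearIndependent ℂ η' := LinearIndependent.of_comp entireFunctions.subtype hLI
  obtain ⟨ξ, E, hE, hord, ⟨Q, hQ⟩, P, hP⟩ :=
    (isOrderFunction_analyticOrderAt a).exists_adapted η' hLI'
  have hP' : ∀ i, (ξ i : ℂ → ℂ) = fun z => ∑ j, P i j * η j z := fun i => by
    rw [hP i]; ext z; simp [hη']
  have hQ' : ∀ i, η i = fun z => ∑ j, Q i j * (ξ j : ℂ → ℂ) z := fun i => by
    have := congrArg (Subtype.val) (hQ i)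
    simp only [hη'] at this
    rw [this]; ext z; simp
  refine ⟨fun i => ξ i, E, Matrix.of P, Matrix.of Q, hE, fun i => (ξ i).2, hord, hP', hQ', ?_⟩
  ext i j
  have h1 : ∑ j, (Matrix.of Q * Matrix.of P) i j • η' j =
      ∑ j, (1 : Matrix (Fin m) (Fin m) ℂ) i j • η' j := by
    have : ∑ j, (1 : Matrix (Fin m) (Fin m) ℂ) i j • η' j = η' i := by
      simp [Matrix.one_apply]
    rw [this, hQ i]
    simp only [hP, Matrix.mul_apply, Matrix.of_apply, Finset.sum_smul, Finset.smul_sum, smul_smul]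
    exact Finset.sum_comm
  have h2 := Fintype.linearIndependent_iff.1 hLI'
    (fun j => (Matrix.of Q * Matrix.of P) i j - (1 : Matrix (Fin m) (Fin m) ℂ) i j)
    (by simp only [sub_smul, Finset.sum_sub_distrib, h1, sub_self]) j
  exact sub_eq_zero.1 h2

/-- An adapted basis at the origin has a Wronskian of finite order, and that Wronskian is a constant
multiple of the given one. -/
theorem det_wronskianMatrix_ne_zero {m : ℕ} {f : Fin m → ℂ → ℂ} (hf : ∀ i, Differentiable ℂ (f i))
    (hLI : LinearIndependent ℂ f) :
    (fun z => (wronskianMatrix (fun l : Fin m => (l : ℕ)) f z).det) ≠ 0 := by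
  obtain ⟨ξ, E, P, Q, hE, hξ, hord, hP, -, -⟩ := exists_adapted_entire hf hLI 0
  have h1 := analyticOrderAt_det_wronskianMatrix hξ hord hE.injective
  intro h0
  have h2 : (fun z => (wronskianMatrix (fun l : Fin m => (l : ℕ)) ξ z).det) = 0 := by
    funext z
    have h3 : ξ = fun s z => ∑ i, P s i * f i z := funext hP
    rw [h3, wronskianMatrix_combination _ hf, Matrix.det_mul]
    rw [congrFun h0 z]
    simp
  rw [h2, (analyticOrderAt_eq_top (f := (0 : ℂ → ℂ))).2 (Eventually.of_forall fun _ => rfl),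
    add_top] at h1
  exact ENat.natCast_ne_top _ h1.symm

end WronskianOrders

/-! ### The local inequality between orders, and the source of the truncation level. -/

section LocalInequality
open Finset Filter Topology
open scoped Matrix

/-- For strictly increasing integers `φ t - t` is nondecreasing, stated without subtraction. -/
theorem add_sub_le_of_strictMono {p : ℕ} {φ : Fin p → ℕ} (h : StrictMono φ) {s t : Fin p}
    (hst : s ≤ t) : φ s + (t : ℕ) ≤ φ t + s := by
  obtain ⟨d, hd⟩ := Nat.exists_eq_add_of_le (Fin.le_def.1 hst)
  induction d generalizing t with
  | zero => rw [show t = s from Fin.ext hd]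
  | succ d ih =>
    have hlt : (s : ℕ) + d < p := by have := t.2; omega
    have h1 := ih (t := ⟨s + d, hlt⟩) (Fin.le_def.2 (by simp)) rfl
    have h2 : φ ⟨s + d, hlt⟩ < φ t := h (Fin.lt_def.2 (by simp only; omega))
    simp only at h1
    omega

theorem linearIndependent_of_analyticOrderAt {ι : Type*} [Fintype ι] {h : ι → ℂ → ℂ}
    (hh : ∀ i, Differentiable ℂ (h i)) {a : ℂ} {e : ι → ℕ} (he : Function.Injective e)
    (hord : ∀ i, analyticOrderAt (h i) a = e i) : LinearIndependent ℂ h := by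
  have hLI : LinearIndependent ℂ fun i => (⟨h i, hh i⟩ : entireFunctions) := by
    rw [Fintype.linearIndependent_iff]
    intro c hc i
    by_contra hne
    have h1 := (isOrderFunction_analyticOrderAt a).le_of_coeff_ne_zero he
      (ξ := fun i => (⟨h i, hh i⟩ : entireFunctions)) hord c hne
    rw [hc, ((isOrderFunction_analyticOrderAt a).eq_top_iff 0).2 rfl] at h1
    exact ENat.natCast_ne_top _ (top_le_iff.1 h1)
  exact hLI.map' entireFunctions.subtype (Submodule.ker_subtype _)

theorem analyticOrderAt_combination_le {ι : Type*} [Fintype ι] {h : ι → ℂ → ℂ}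
    (hh : ∀ i, Differentiable ℂ (h i)) {a : ℂ} {e : ι → ℕ} (he : Function.Injective e)
    (hord : ∀ i, analyticOrderAt (h i) a = e i) (c : ι → ℂ) {j : ι} (hj : c j ≠ 0) :
    analyticOrderAt (fun z => ∑ i, c i * h i z) a ≤ e j := by
  have h1 := (isOrderFunction_analyticOrderAt a).le_of_coeff_ne_zero he
    (ξ := fun i => (⟨h i, hh i⟩ : entireFunctions)) hord c hj
  convert! h1 using 2
  ext z
  simp

/-- Pass to an adapted basis `ξ` of the span of the combinations. The nonzero minor matches its
members with the indices `I i` so that each has a nonzero coefficient at its partner, hence order at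
most `e (I i)`. Their Wronskian has order equal to the sum of these orders minus `0 + ... + (p -
1)`. -/
theorem order_wronskian_combination_le {n p : ℕ} {h : Fin n → ℂ → ℂ}
    (hh : ∀ i, Differentiable ℂ (h i)) {a : ℂ} {e : Fin n → ℕ} (he : Function.Injective e)
    (hord : ∀ i, analyticOrderAt (h i) a = e i) (c : Matrix (Fin p) (Fin n) ℂ) (I : Fin p → Fin n)
    (hI : (c.submatrix id I).det ≠ 0) :
    ((∑ l : Fin p, (l : ℕ) : ℕ) : ℕ∞) + analyticOrderAt (fun z =>
      (wronskianMatrix (fun l : Fin p => (l : ℕ)) (fun s z => ∑ i, c s i * h i z) z).det) a ≤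
      ((∑ s, e (I s) : ℕ) : ℕ∞) := by
  set η : Fin p → ℂ → ℂ := fun s z => ∑ i, c s i * h i z with hη
  have hηd : ∀ s, Differentiable ℂ (η s) := fun s =>
    Differentiable.fun_sum fun i _ => (differentiable_const _).mul (hh i)
  have hLI : LinearIndependent ℂ η := by
    rw [Fintype.linearIndependent_iff]
    intro x hx
    have h1 : ∑ i, (x ᵥ* c) i • h i = 0 := by
      rw [← hx]
      ext z
      simp only [Matrix.vecMul, dotProduct, Finset.sum_apply, Pi.smul_apply, smul_eq_mul, hη,
        Finset.sum_mul, Finset.mul_sum, mul_assoc]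
      exact Finset.sum_comm
    have h2 := Fintype.linearIndependent_iff.1 (linearIndependent_of_analyticOrderAt hh he hord) _ h1
    have h3 : x ᵥ* c.submatrix id I = 0 := by
      ext s
      exact h2 (I s)
    exact fun i => congrFun (Matrix.eq_zero_of_vecMul_eq_zero hI h3) i
  obtain ⟨ξ, E, P, Q, hE, hξ, hξord, hP, hQ, hQP⟩ := exists_adapted_entire hηd hLI a
  have hdet : Q.det * P.det = 1 := by rw [← Matrix.det_mul, hQP, Matrix.det_one]
  have hW : (fun z => (wronskianMatrix (fun l : Fin p => (l : ℕ)) η z).det) = fun z =>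
      Q.det * (wronskianMatrix (fun l : Fin p => (l : ℕ)) ξ z).det := by
    funext z
    have h3 : η = fun s z => ∑ i, Q s i * ξ i z := funext hQ
    rw [h3, wronskianMatrix_combination _ hξ, Matrix.det_mul, Matrix.det_transpose, mul_comm]
  have hWan : AnalyticAt ℂ (fun z => (wronskianMatrix (fun l : Fin p => (l : ℕ)) ξ z).det) a :=
    (differentiable_det fun l i => differentiable_wronskianMatrix _ hξ l i).analyticAt a
  rw [hW, analyticOrderAt_const_mul hWan (left_ne_zero_of_mul_eq_one hdet),
    analyticOrderAt_det_wronskianMatrix hξ hξord hE.injective]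
  have hmin : ((P * c).submatrix id I).det ≠ 0 := by
    have : (P * c).submatrix id I = P * c.submatrix id I := by
      rw [Matrix.submatrix_mul P c id id I Function.bijective_id, Matrix.submatrix_id_id]
    rw [this, Matrix.det_mul]
    exact mul_ne_zero (right_ne_zero_of_mul_eq_one hdet) hI
  obtain ⟨σ, hσ⟩ := exists_perm_of_det_ne_zero hmin
  have hle : ∀ i, E (σ i) ≤ e (I i) := fun i => by
    have h1 := analyticOrderAt_combination_le hh he hord (fun j => (P * c) (σ i) j) (hσ i)
    have h2 : (fun z => ∑ j, (P * c) (σ i) j * h j z) = ξ (σ i) := by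
      rw [hP]
      ext z
      simp only [hη, Matrix.mul_apply, Finset.sum_mul, Finset.mul_sum, mul_assoc]
      exact Finset.sum_comm
    rw [h2, hξord] at h1
    exact_mod_cast h1
  rw [← Equiv.sum_comp σ E]
  exact_mod_cast Finset.sum_le_sum fun i _ => hle i

/-- The determinant of the `p`-th compound of the Wronskian matrix. -/
noncomputable def compoundWronskian (p : ℕ) {n : ℕ} (f : Fin n → ℂ → ℂ) (z : ℂ) : ℂ :=
  (compoundMatrix p (wronskianMatrix (fun l : Fin n => (l : ℕ)) f z)).det

/-- The Wronskian. -/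
noncomputable def entireWronskian {p : ℕ} (f : Fin p → ℂ → ℂ) (z : ℂ) : ℂ :=
  (wronskianMatrix (fun l : Fin p => (l : ℕ)) f z).det

theorem differentiable_entireWronskian {p : ℕ} {f : Fin p → ℂ → ℂ}
    (hf : ∀ i, Differentiable ℂ (f i)) : Differentiable ℂ (entireWronskian f) :=
  differentiable_det fun l i => differentiable_wronskianMatrix _ hf l i

theorem differentiable_compoundWronskian (p : ℕ) {n : ℕ} {f : Fin n → ℂ → ℂ}
    (hf : ∀ i, Differentiable ℂ (f i)) : Differentiable ℂ (compoundWronskian p f) :=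
  differentiable_det fun J I => differentiable_det fun s t =>
    differentiable_wronskianMatrix _ hf (subsetEnum J s) (subsetEnum I t)

theorem compoundWronskian_ne_zero (p : ℕ) {n : ℕ} {f : Fin n → ℂ → ℂ}
    (hf : ∀ i, Differentiable ℂ (f i)) (hLI : LinearIndependent ℂ f) :
    compoundWronskian p f ≠ 0 := by
  obtain ⟨z, hz⟩ := Function.ne_iff.1 (det_wronskianMatrix_ne_zero hf hLI)
  exact Function.ne_iff.2 ⟨z, det_compoundMatrix_ne_zero p hz⟩

theorem entireWronskian_combination {n p : ℕ} {f : Fin n → ℂ → ℂ}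
    (hf : ∀ i, Differentiable ℂ (f i)) (a : Matrix (Fin p) (Fin n) ℂ) (z : ℂ) :
    entireWronskian (fun s z => ∑ i, a s i * f i z) z = ∑ I : Set.powersetCard (Fin n) p,
      entireWronskian (fun s => f (subsetEnum I s)) z * (a.submatrix id (subsetEnum I)).det := by
  rw [entireWronskian, wronskianMatrix_combination _ hf, det_mul_eq_sum_minors]
  refine Finset.sum_congr rfl fun I _ => ?_
  congr 1
  rw [← Matrix.det_transpose]
  rfl

theorem compoundWronskian_combination (p : ℕ) {n : ℕ} {f : Fin n → ℂ → ℂ}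
    (hf : ∀ i, Differentiable ℂ (f i)) (a : Matrix (Fin n) (Fin n) ℂ) (z : ℂ) :
    compoundWronskian p (fun s z => ∑ i, a s i * f i z) z =
      (compoundMatrix p aᵀ).det * compoundWronskian p f z := by
  rw [compoundWronskian, wronskianMatrix_combination _ hf, compoundMatrix_mul, Matrix.det_mul,
    mul_comm]
  rfl

theorem natCast_analyticOrderNatAt_of_entire {f : ℂ → ℂ} (hf : Differentiable ℂ f) (h : f ≠ 0)
    (a : ℂ) : ((analyticOrderNatAt f a : ℕ) : ℕ∞) = analyticOrderAt f a :=
  ENat.natCast_toNat (analyticOrderAt_ne_top_of_entire hf h a)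

/-- The two arguments of the maximum use different facts. For `W` it is the bound of the sum of `I`
by `p * (n - p)` plus the least possible sum. For `γ` it is that `e t - t` is nondecreasing, so
moving from the first `p` indices up to `I` raises the sum of the `e`-values at least as much as the
sum of the indices. -/
theorem sum_le_of_orders {n p W γ : ℕ} {e : Fin n → ℕ} (he : StrictMono e)
    (I : Fin p ↪o Fin n) (hpn : p ≤ n) (hW : ∑ l : Fin p, (l : ℕ) + W ≤ ∑ s, e (I s))
    (hγ : ∑ l : Fin p, (l : ℕ) + γ ≤ ∑ s : Fin p, e (Fin.castLE hpn s)) :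
    max W (p * (n - p) + γ) + ∑ s, (I s : ℕ) ≤ p * (n - p) + ∑ s, e (I s) := by
  have hImono : StrictMono fun s => (I s : ℕ) := fun s t hst => Fin.lt_def.1 (I.strictMono hst)
  have hIs : ∀ s : Fin p, (s : ℕ) ≤ I s := fun s => by
    have := add_sub_le_of_strictMono hImono (s := ⟨0, s.pos⟩) (t := s) (Fin.le_def.2 (Nat.zero_le _))
    simp only at this
    omega
  have hIle : ∀ s : Fin p, (I s : ℕ) ≤ (n - p) + s := fun s => by
    have := add_sub_le_of_strictMono hImono (s := s) (t := ⟨p - 1, by have := s.2; omega⟩)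
      (Fin.le_def.2 (by have := s.2; simp only; omega))
    have h2 := (I ⟨p - 1, by have := s.2; omega⟩).2
    have h3 := s.2
    simp only at this
    omega
  have h1 : ∑ s, (I s : ℕ) ≤ p * (n - p) + ∑ s : Fin p, (s : ℕ) := by
    calc ∑ s, (I s : ℕ) ≤ ∑ s : Fin p, ((n - p) + s) := Finset.sum_le_sum fun s _ => hIle s
      _ = _ := by rw [Finset.sum_add_distrib]; simp
  have h2 : ∑ s : Fin p, e (Fin.castLE hpn s) + ∑ s, (I s : ℕ) ≤
      ∑ s, e (I s) + ∑ s : Fin p, (s : ℕ) := by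
    rw [← Finset.sum_add_distrib, ← Finset.sum_add_distrib]
    refine Finset.sum_le_sum fun s _ => ?_
    have := add_sub_le_of_strictMono he (s := Fin.castLE hpn s) (t := I s)
      (Fin.le_def.2 (hIs s))
    simpa using this
  rcases max_cases W (p * (n - p) + γ) with ⟨h, -⟩ | ⟨h, -⟩ <;> rw [h] <;> omega

/-- The local inequality between the multiplicities of decomposable forms of a derived curve, the
content of the Plücker coordinates and the compound Wronskian. -/
theorem sum_max_order_wronskian_le {n p : ℕ} (hpn : p ≤ n) {f : Fin n → ℂ → ℂ}
    (hf : ∀ i, Differentiable ℂ (f i)) (hLI : LinearIndependent ℂ f)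
    (c : Set.powersetCard (Fin n) p → Matrix (Fin p) (Fin n) ℂ)
    (hV : (Matrix.of fun I b : Set.powersetCard (Fin n) p =>
      ((c b).submatrix id (subsetEnum I)).det).det ≠ 0)
    {g : ℂ → ℂ} {G : Set.powersetCard (Fin n) p → ℂ → ℂ} (hg : Differentiable ℂ g)
    (hg0 : g ≠ 0) (hG : ∀ I, Differentiable ℂ (G I))
    (hgG : ∀ I z, entireWronskian (fun s => f (subsetEnum I s)) z = g z * G I z) (x : ℂ) :
    ∑ b, max (analyticOrderNatAt (entireWronskian fun s z => ∑ i, c b s i * f i z) x)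
      (p * (n - p) + analyticOrderNatAt g x) ≤
      analyticOrderNatAt (compoundWronskian p f) x +
        Fintype.card (Set.powersetCard (Fin n) p) * (p * (n - p)) := by
  obtain ⟨h, e, P, Q, he, hh, hord, hP, hQ, hQP⟩ := exists_adapted_entire hf hLI x
  have hdet : Q.det * P.det = 1 := by rw [← Matrix.det_mul, hQP, Matrix.det_one]
  have hQ0 : Q.det ≠ 0 := left_ne_zero_of_mul_eq_one hdet
  have hP0 : P.det ≠ 0 := right_ne_zero_of_mul_eq_one hdet
  have hhP : h = fun s z => ∑ i, P s i * f i z := funext hP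
  -- the order of the compound Wronskian
  have hΔ : ∑ I : Set.powersetCard (Fin n) p, ∑ s, e (subsetEnum I s) ≤
      ∑ J : Set.powersetCard (Fin n) p, ∑ s, (subsetEnum J s : ℕ) +
        analyticOrderNatAt (compoundWronskian p f) x := by
    have h1 := le_analyticOrderAt_det_compoundMatrix p hh hord
    have h2 : (fun z => (compoundMatrix p (wronskianMatrix (fun l : Fin n => (l : ℕ)) h z)).det) =
        fun z => (compoundMatrix p Pᵀ).det * compoundWronskian p f z := by
      funext z
      rw [← compoundWronskian_combination p hf, hhP]
      rfl
    rw [h2, analyticOrderAt_const_mul ((differentiable_compoundWronskian p hf).analyticAt x)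
      (det_compoundMatrix_ne_zero p (by rwa [Matrix.det_transpose])),
      ← natCast_analyticOrderNatAt_of_entire (differentiable_compoundWronskian p hf)
        (compoundWronskian_ne_zero p hf hLI)] at h1
    exact_mod_cast h1
  -- the order of the content
  have hγ : ∑ l : Fin p, (l : ℕ) + analyticOrderNatAt g x ≤
      ∑ s : Fin p, e (Fin.castLE hpn s) := by
    have h1 := analyticOrderAt_det_wronskianMatrix (ξ := fun s : Fin p => h (Fin.castLE hpn s))
      (a := x) (fun s => hh _) (fun s => hord _)
      (he.injective.comp (Fin.castLE_injective hpn))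
    -- The Wronskian of the `p` adapted functions of lowest order is a combination of the Plücker
    -- Wronskians, so it is divisible by `g`.
    have h2 : (fun z => (wronskianMatrix (fun l : Fin p => (l : ℕ))
        (fun s : Fin p => h (Fin.castLE hpn s)) z).det) = g * fun z =>
        ∑ I : Set.powersetCard (Fin n) p, G I z *
          ((P.submatrix (Fin.castLE hpn) id).submatrix id (subsetEnum I)).det := by
      funext z
      have h3 := entireWronskian_combination hf (P.submatrix (Fin.castLE hpn) id) z
      rw [Pi.mul_apply, Finset.mul_sum]
      simp only [← mul_assoc, ← hgG]
      rw [← h3, hhP]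
      rfl
    rw [h2, analyticOrderAt_mul (hg.analyticAt x) (Differentiable.analyticAt
      (Differentiable.fun_sum fun I _ => (hG I).mul_const _) x), ← add_assoc,
      ← natCast_analyticOrderNatAt_of_entire hg hg0] at h1
    have h4 := le_self_add.trans_eq h1
    exact_mod_cast h4
  -- the orders of the forms
  have hV' : (Matrix.of fun I b : Set.powersetCard (Fin n) p =>
      ((c b * Q).submatrix id (subsetEnum I)).det).det ≠ 0 := by
    have : (Matrix.of fun I b : Set.powersetCard (Fin n) p =>
      ((c b * Q).submatrix id (subsetEnum I)).det) = (compoundMatrix p Q)ᵀ *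
        Matrix.of fun I b : Set.powersetCard (Fin n) p =>
          ((c b).submatrix id (subsetEnum I)).det := by
      ext I b
      rw [Matrix.of_apply, Matrix.submatrix_mul (c b) Q id id (subsetEnum I) Function.bijective_id,
        det_mul_eq_sum_minors, Matrix.mul_apply]
      exact Finset.sum_congr rfl fun J _ => mul_comm _ _
    rw [this, Matrix.det_mul, Matrix.det_transpose]
    exact mul_ne_zero (det_compoundMatrix_ne_zero p hQ0) hV
  -- Every form receives its own index set with a nonzero minor. Since `σ` is a bijection, summing
  -- over the forms runs through each index set once, as the bound for the compound Wronskian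
  -- requires.
  obtain ⟨σ, hσ⟩ := exists_perm_of_det_ne_zero hV'
  have hb : ∀ b, ∑ l : Fin p, (l : ℕ) +
      analyticOrderNatAt (entireWronskian fun s z => ∑ i, c b s i * f i z) x ≤
      ∑ s, e (subsetEnum (σ b) s) := fun b => by
    have h1 := order_wronskian_combination_le hh he.injective hord (c b * Q) (subsetEnum (σ b))
      (hσ b)
    have h2 : (fun s z => ∑ i, (c b * Q) s i * h i z) = fun s z => ∑ i, c b s i * f i z := by
      funext s z
      simp only [Matrix.mul_apply, Finset.sum_mul, fun i => congrFun (hQ i) z, Finset.mul_sum,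
        mul_assoc]
      exact Finset.sum_comm
    rw [h2] at h1
    have h3 : analyticOrderAt (entireWronskian fun s z => ∑ i, c b s i * f i z) x ≠ ⊤ := by
      intro h4
      change _ + analyticOrderAt (entireWronskian fun s z => ∑ i, c b s i * f i z) x ≤ _ at h1
      rw [h4, add_top] at h1
      exact ENat.natCast_ne_top _ (top_le_iff.1 h1)
    change _ + analyticOrderAt (entireWronskian fun s z => ∑ i, c b s i * f i z) x ≤ _ at h1
    rw [← ENat.natCast_toNat h3] at h1
    exact_mod_cast h1
  have hfinal := Finset.sum_le_sum fun b (_ : b ∈ univ) =>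
    sum_le_of_orders he (subsetEnum (σ b)) hpn (hb b) hγ
  rw [Finset.sum_add_distrib, Finset.sum_add_distrib,
    Equiv.sum_comp σ fun J => ∑ s, (subsetEnum J s : ℕ),
    Equiv.sum_comp σ fun J => ∑ s, e (subsetEnum J s)] at hfinal
  simp only [Finset.sum_const, Finset.card_univ, smul_eq_mul] at hfinal
  omega

end LocalInequality

/-! ### Jensen's formula and truncated counting functions. -/

section Jensen
open MeasureTheory Set Filter Topology Metric
open Real hiding log
open Function.locallyFinsuppWithin

theorem divisor_entire_apply {h : ℂ → ℂ} (hd : Differentiable ℂ h) (a : ℂ) :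
    MeromorphicOn.divisor h univ a = (analyticOrderNatAt h a : ℤ) := by
  rw [MeromorphicOn.AnalyticOnNhd.divisor_apply (fun z _ => hd.analyticAt z) (mem_univ a), analyticOrderNatAt]
  cases analyticOrderAt h a using ENat.recTopCoe with
  | top => simp
  | coe n => rfl

theorem analyticOrderNatAt_ne_zero_iff {h : ℂ → ℂ} (hd : Differentiable ℂ h) (h0 : h ≠ 0) (a : ℂ) :
    analyticOrderNatAt h a ≠ 0 ↔ h a = 0 := by
  have h1 := (hd.analyticAt a).analyticOrderAt_ne_zero
  rw [← h1, ← natCast_analyticOrderNatAt_of_entire hd h0]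
  simp

theorem finite_zeros_closedBall {h : ℂ → ℂ} (hd : Differentiable ℂ h) (h0 : h ≠ 0) (r : ℝ) :
    {a : ℂ | ‖a‖ ≤ r ∧ h a = 0}.Finite := by
  refine (finite_support_closedBall (MeromorphicOn.divisor h univ) r).subset fun a ha => ⟨ha.1, ?_⟩
  rw [divisor_entire_apply hd]
  exact_mod_cast (analyticOrderNatAt_ne_zero_iff hd h0 a).2 ha.2

/-- Jensen's formula with a constant independent of the radius, over any finite set of points of the
disk that contains its zeros. -/
theorem exists_circleAverage_log_norm_eq {h : ℂ → ℂ} (hd : Differentiable ℂ h) (h0 : h ≠ 0) :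
    ∃ c : ℝ, ∀ r : ℝ, 0 < r → ∀ S : Finset ℂ, (∀ a ∈ S, ‖a‖ ≤ r) →
      (∀ a, ‖a‖ ≤ r → h a = 0 → a ∈ S) →
      circleAverage (fun z => Real.log ‖h z‖) 0 r =
        ∑ a ∈ S, (analyticOrderNatAt h a : ℝ) * countingWeight r a + c := by
  refine ⟨Real.log ‖meromorphicTrailingCoeffAt h 0‖, fun r hr S hS hS' => ?_⟩
  have h1 := logCounting_divisor_eq_circleAverage_sub_const (f := h)
    (fun z => (hd.analyticAt z).meromorphicAt) hr.ne'
  rw [logCounting_eq_sum _ hr S hS] at h1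
  · rw [← sub_eq_iff_eq_add, ← h1]
    refine Finset.sum_congr rfl fun a _ => ?_
    rw [divisor_entire_apply hd]
    norm_cast
  · intro a ha hne
    refine hS' a ha ((analyticOrderNatAt_ne_zero_iff hd h0 a).1 ?_)
    rw [divisor_entire_apply hd] at hne
    exact_mod_cast hne

theorem intervalIntegrable_indicator_div {ρ u v : ℝ} (hu : 0 < u) (hv : 0 < v) :
    IntervalIntegrable (fun t => (if ρ < t then (1 : ℝ) else 0) / t) volume u v := by
  have h1 : IntervalIntegrable (fun t : ℝ => 1 / t) volume u v := by
    apply ContinuousOn.intervalIntegrable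
    intro t ht
    have : 0 < t := lt_of_lt_of_le (lt_min hu hv) ht.1
    exact (continuousAt_const.div continuousAt_id this.ne').continuousWithinAt
  refine h1.mono_fun' ?_ ?_
  · exact ((Measurable.ite measurableSet_Ioi measurable_const measurable_const).div
      measurable_id).aestronglyMeasurable
  · refine (ae_restrict_mem measurableSet_uIoc).mono fun t ht => ?_
    have h0 : 0 < t := (lt_min hu hv).trans ht.1
    dsimp only
    rw [Real.norm_eq_abs, abs_div, abs_of_pos h0]
    refine div_le_div_of_nonneg_right ?_ h0.le
    split_ifs <;> simp

/-- The excess of `countingWeight` over the weight in a counting function that starts at `1`. -/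
noncomputable def innerWeight (a : ℂ) : ℝ := max 0 (-Real.log ‖a‖)

/-- Jensen's weight counts from the centre, the integral only from radius one. The two differ by
`-log ‖a‖` for points of the punctured unit disk and agree elsewhere. -/
theorem countingWeight_le_integral {r : ℝ} (hr : 1 ≤ r) {a : ℂ} (ha : ‖a‖ ≤ r) :
    countingWeight r a ≤ (∫ t in (1 : ℝ)..r, (if ‖a‖ < t then (1 : ℝ) else 0) / t) +
      innerWeight a := by
  have hr0 : 0 < r := by linarith
  have hcw : countingWeight r a = Real.log r - Real.log ‖a‖ := by
    rw [countingWeight]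
    split_ifs with h
    -- Since `Real.log 0 = 0`, the formula also covers the origin.
    · simp [h]
    · rw [Real.log_mul hr0.ne' (inv_ne_zero (norm_ne_zero_iff.2 h)), Real.log_inv]
      ring
  rw [hcw]
  have key : ∀ u : ℝ, 1 ≤ u → u ≤ r → ‖a‖ ≤ u →
      ∫ t in u..r, (if ‖a‖ < t then (1 : ℝ) else 0) / t = Real.log r - Real.log u := by
    intro u hu1 hur hau
    have h1 : ∫ t in u..r, (if ‖a‖ < t then (1 : ℝ) else 0) / t = ∫ t in u..r, 1 / t := by
      refine intervalIntegral.integral_congr_ae (Eventually.of_forall fun t ht => ?_)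
      rw [uIoc_of_le hur] at ht
      rw [if_pos (hau.trans_lt ht.1)]
    rw [h1, integral_one_div_of_pos (by linarith) hr0, Real.log_div hr0.ne' (by linarith)]
  rcases le_total ‖a‖ 1 with h | h
  · rw [key 1 le_rfl hr h, Real.log_one]
    have := le_max_right 0 (-Real.log ‖a‖)
    rw [innerWeight]
    linarith
  · have h2 : ∫ t in (1 : ℝ)..‖a‖, (if ‖a‖ < t then (1 : ℝ) else 0) / t = 0 := by
      have h1 : ∫ t in (1 : ℝ)..‖a‖, (if ‖a‖ < t then (1 : ℝ) else 0) / t =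
          ∫ t in (1 : ℝ)..‖a‖, (0 : ℝ) := by
        refine intervalIntegral.integral_congr_ae (Eventually.of_forall fun t ht => ?_)
        rw [uIoc_of_le h] at ht
        rw [if_neg (not_lt.2 ht.2), zero_div]
      rw [h1, intervalIntegral.integral_zero]
    have h3 := intervalIntegral.integral_add_adjacent_intervals
      (intervalIntegrable_indicator_div (ρ := ‖a‖) (u := 1) (v := ‖a‖) one_pos (by linarith))
      (intervalIntegrable_indicator_div (ρ := ‖a‖) (u := ‖a‖) (v := r) (by linarith) hr0)
    rw [← h3, h2, zero_add, key ‖a‖ h ha le_rfl]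
    have := le_max_left 0 (-Real.log ‖a‖)
    rw [innerWeight]
    linarith

theorem truncatedDegree_eq_sum {m : ℕ} {h : ℂ → ℂ} (hd : Differentiable ℂ h) (h0 : h ≠ 0)
    {r t : ℝ} (htr : t ≤ r) (S : Finset ℂ) (hS' : ∀ a, ‖a‖ ≤ r → h a = 0 → a ∈ S) :
    (DerivedCurve.truncatedDegree m h t : ℝ) =
      ∑ a ∈ S, (min m (analyticOrderNatAt h a) : ℕ) * (if ‖a‖ < t then (1 : ℝ) else 0) := by
  classical
  rw [DerivedCurve.truncatedDegree, finsum_mem_eq_sum_of_inter_support_eq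
    (t := S.filter fun a => ‖a‖ < t)]
  · rw [Finset.sum_filter]
    push_cast
    exact Finset.sum_congr rfl fun a _ => by split_ifs <;> simp
  · ext a
    simp only [mem_inter_iff, mem_ball, dist_zero_right, Function.mem_support, Finset.coe_filter,
      Set.mem_ofPred_eq]
    constructor
    · rintro ⟨h1, h2⟩
      refine ⟨⟨hS' a (h1.le.trans htr) ((analyticOrderNatAt_ne_zero_iff hd h0 a).1 ?_), h1⟩, h2⟩
      intro h3
      rw [h3] at h2
      simp at h2
    · rintro ⟨⟨-, h1⟩, h2⟩
      exact ⟨h1, h2⟩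

theorem countingFunction_eq_sum {m : ℕ} {h : ℂ → ℂ} (hd : Differentiable ℂ h) (h0 : h ≠ 0)
    {r : ℝ} (hr : 1 ≤ r) (S : Finset ℂ) (hS' : ∀ a, ‖a‖ ≤ r → h a = 0 → a ∈ S) :
    DerivedCurve.countingFunction m h r = ∑ a ∈ S, ((min m (analyticOrderNatAt h a) : ℕ) : ℝ) *
      ∫ t in (1 : ℝ)..r, (if ‖a‖ < t then (1 : ℝ) else 0) / t := by
  have h1 : DerivedCurve.countingFunction m h r = ∫ t in (1 : ℝ)..r,
      ∑ a ∈ S, ((min m (analyticOrderNatAt h a) : ℕ) : ℝ) *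
        ((if ‖a‖ < t then (1 : ℝ) else 0) / t) := by
    refine intervalIntegral.integral_congr fun t ht => ?_
    rw [uIcc_of_le hr] at ht
    rw [truncatedDegree_eq_sum hd h0 ht.2 S hS', Finset.sum_div]
    exact Finset.sum_congr rfl fun a _ => mul_div_assoc _ _ _
  rw [h1, intervalIntegral.integral_finsetSum]
  · exact Finset.sum_congr rfl fun a _ => intervalIntegral.integral_const_mul _ _
  · exact fun a _ => (intervalIntegrable_indicator_div one_pos (by linarith)).const_mul _

theorem countingFunction_nonneg {m : ℕ} {h : ℂ → ℂ} {r : ℝ} (hr : 1 ≤ r) :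
    0 ≤ DerivedCurve.countingFunction m h r :=
  intervalIntegral.integral_nonneg hr fun _ ht =>
    div_nonneg (Nat.cast_nonneg _) (zero_le_one.trans ht.1)

/-- The loss comes only from zeros in the closed unit disk, so the constant does not depend on the
radius. -/
theorem exists_sum_countingWeight_le (m : ℕ) {h : ℂ → ℂ} (hd : Differentiable ℂ h) (h0 : h ≠ 0) :
    ∃ c : ℝ, ∀ r : ℝ, 1 ≤ r → ∀ S : Finset ℂ, (∀ a ∈ S, ‖a‖ ≤ r) →
      (∀ a, ‖a‖ ≤ r → h a = 0 → a ∈ S) →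
      ∑ a ∈ S, ((min m (analyticOrderNatAt h a) : ℕ) : ℝ) * countingWeight r a ≤
        DerivedCurve.countingFunction m h r + c := by
  classical
  set Z := (finite_zeros_closedBall hd h0 1).toFinset
  refine ⟨∑ a ∈ Z, ((min m (analyticOrderNatAt h a) : ℕ) : ℝ) * innerWeight a,
    fun r hr S hS hS' => ?_⟩
  rw [countingFunction_eq_sum hd h0 hr S hS']
  have h1 : ∑ a ∈ S, ((min m (analyticOrderNatAt h a) : ℕ) : ℝ) * countingWeight r a ≤
      ∑ a ∈ S, (((min m (analyticOrderNatAt h a) : ℕ) : ℝ) *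
        (∫ t in (1 : ℝ)..r, (if ‖a‖ < t then (1 : ℝ) else 0) / t) +
        ((min m (analyticOrderNatAt h a) : ℕ) : ℝ) * innerWeight a) := by
    refine Finset.sum_le_sum fun a ha => ?_
    rw [← mul_add]
    exact mul_le_mul_of_nonneg_left (countingWeight_le_integral hr (hS a ha)) (Nat.cast_nonneg _)
  refine h1.trans ?_
  rw [Finset.sum_add_distrib]
  refine add_le_add le_rfl ?_
  have hnn : ∀ a, 0 ≤ ((min m (analyticOrderNatAt h a) : ℕ) : ℝ) * innerWeight a := fun a =>
    mul_nonneg (Nat.cast_nonneg _) (le_max_left _ _)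
  calc ∑ a ∈ S, ((min m (analyticOrderNatAt h a) : ℕ) : ℝ) * innerWeight a
      ≤ ∑ a ∈ S ∪ Z, ((min m (analyticOrderNatAt h a) : ℕ) : ℝ) * innerWeight a :=
        Finset.sum_le_sum_of_subset_of_nonneg Finset.subset_union_left fun a _ _ => hnn a
    _ = ∑ a ∈ Z, ((min m (analyticOrderNatAt h a) : ℕ) : ℝ) * innerWeight a := by
      refine (Finset.sum_subset Finset.subset_union_right fun a _ ha => ?_).symm
      by_cases hz : h a = 0
      · have h2 : 1 < ‖a‖ := by
          by_contra! hle
          exact ha ((Set.Finite.mem_toFinset _).2 ⟨hle, hz⟩)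
        have h3 := Real.log_pos h2
        rw [innerWeight, max_eq_left (by linarith), mul_zero]
      · have h2 : analyticOrderNatAt h a = 0 := by
          by_contra h3
          exact hz ((analyticOrderNatAt_ne_zero_iff hd h0 a).1 h3)
        simp [h2]

end Jensen

/-! ### Transfer from entire functions to the field of meromorphic germs. -/

section EntireGerms
open Filter Topology Finset ValueDistribution
open scoped Matrix
open MerField GrowthScale

/-- The ring of entire functions. -/
def entireRing : Subring (ℂ → ℂ) where
  carrier := {f | Differentiable ℂ f}
  mul_mem' := fun hf hg => Differentiable.mul hf hg
  one_mem' := differentiable_const 1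
  add_mem' := fun hf hg => Differentiable.add hf hg
  zero_mem' := differentiable_const 0
  neg_mem' := fun hf => Differentiable.neg hf

theorem meromorphic_of_entire {f : ℂ → ℂ} (hf : Differentiable ℂ f) : Meromorphic f :=
  fun z => (hf.analyticAt z).meromorphicAt

/-- Entire functions as elements of the field of meromorphic functions. -/
noncomputable def entireGerm : entireRing →+* MerField where
  toFun f := (meromorphic_of_entire f.2).germ
  map_one' := rfl
  map_zero' := rfl
  map_add' _ _ := rfl
  map_mul' _ _ := rfl

theorem entireGerm_mk {f : ℂ → ℂ} (hf : Differentiable ℂ f) :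
    entireGerm ⟨f, hf⟩ = (meromorphic_of_entire hf).germ := rfl

theorem eq_zero_of_eventually_codiscrete {f : ℂ → ℂ} (hf : Continuous f)
    (h : f =ᶠ[codiscrete ℂ] 0) : f = 0 := by
  funext z
  have h1 : Tendsto f (𝓝[≠] z) (𝓝 (f z)) := hf.continuousAt.tendsto.mono_left nhdsWithin_le_nhds
  have h2 : Tendsto f (𝓝[≠] z) (𝓝 0) :=
    tendsto_const_nhds.congr' ((eventually_codiscrete_iff.1 h z).mono fun w hw => hw.symm)
  exact tendsto_nhds_unique h1 h2

theorem entireGerm_ne_zero {f : ℂ → ℂ} (hf : Differentiable ℂ f) (h0 : f ≠ 0) :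
    entireGerm ⟨f, hf⟩ ≠ 0 :=
  (germ_ne_zero_iff (meromorphic_of_entire hf)).2 fun h =>
    h0 (eq_zero_of_eventually_codiscrete hf.continuous h)

theorem eventually_codiscrete_ne_zero {f : ℂ → ℂ} (hf : Differentiable ℂ f) (h0 : f ≠ 0) :
    ∀ᶠ z in codiscrete ℂ, f z ≠ 0 :=
  eventually_ne_zero (meromorphic_of_entire hf) fun h =>
    h0 (eq_zero_of_eventually_codiscrete hf.continuous h)

theorem iterate_derivation_entireGerm (f : entireRing) (l : ℕ) :
    derivation^[l] (entireGerm f) =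
      entireGerm ⟨iteratedDeriv l f, Differentiable.iteratedDeriv_complex f.2 l⟩ := by
  refine (iterate_derivation_germ (meromorphic_of_entire f.2) l).trans ((germ_eq_iff _
    (meromorphic_of_entire (Differentiable.iteratedDeriv_complex f.2 l))).2 ?_)
  exact Eventually.of_forall fun z => by rw [iteratedDeriv_eq_iterate]

theorem coe_det_entireRing {m : Type*} [Fintype m] [DecidableEq m] (A : Matrix m m entireRing)
    (z : ℂ) : (A.det : ℂ → ℂ) z = (Matrix.of fun i j => (A i j : ℂ → ℂ) z).det :=
  RingHom.map_det ((Pi.evalRingHom (fun _ : ℂ => ℂ) z).comp entireRing.subtype) A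

theorem entireGerm_det {m : Type*} [Fintype m] [DecidableEq m] (A : Matrix m m entireRing) :
    entireGerm A.det = (A.map entireGerm).det :=
  RingHom.map_det entireGerm A

theorem wronskianDet_entireGerm {p : ℕ} (f : Fin p → ℂ → ℂ) (hf : ∀ i, Differentiable ℂ (f i)) :
    wronskianDet derivation (fun s => entireGerm ⟨f s, hf s⟩) =
      entireGerm ⟨entireWronskian f, differentiable_entireWronskian hf⟩ := by
  set A : Matrix (Fin p) (Fin p) entireRing := Matrix.of fun l s =>
    ⟨iteratedDeriv l (f s), (hf s).iteratedDeriv_complex l⟩ with hA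
  have h1 : (⟨entireWronskian f, differentiable_entireWronskian hf⟩ : entireRing) = A.det :=
    Subtype.ext (funext fun z => (coe_det_entireRing A z).symm)
  rw [h1, entireGerm_det, wronskianDet]
  congr 1
  ext1 l s
  exact iterate_derivation_entireGerm ⟨f s, hf s⟩ l

theorem det_compoundMatrix_entireGerm (p : ℕ) {n : ℕ} (f : Fin n → ℂ → ℂ)
    (hf : ∀ i, Differentiable ℂ (f i)) :
    (compoundMatrix p (derivMatrix derivation (fun l : Fin n => (l : ℕ))
      fun i => entireGerm ⟨f i, hf i⟩)).det =
      entireGerm ⟨compoundWronskian p f, differentiable_compoundWronskian p hf⟩ := by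
  set A : Matrix (Fin n) (Fin n) entireRing := Matrix.of fun l s =>
    ⟨iteratedDeriv l (f s), (hf s).iteratedDeriv_complex l⟩ with hA
  have h1 : (⟨compoundWronskian p f, differentiable_compoundWronskian p hf⟩ : entireRing) =
      (compoundMatrix p A).det := by
    refine Subtype.ext (funext fun z => ?_)
    rw [coe_det_entireRing]
    change (compoundMatrix p (wronskianMatrix (fun l : Fin n => (l : ℕ)) f z)).det = _
    congr 1
    ext1 J I
    exact (coe_det_entireRing (A.submatrix (subsetEnum J) (subsetEnum I)) z).symm
  rw [h1, entireGerm_det]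
  congr 1
  ext1 J I
  simp only [compoundMatrix, Matrix.of_apply, Matrix.map_apply]
  rw [entireGerm_det]
  congr 1
  ext1 l s
  exact iterate_derivation_entireGerm ⟨f _, hf _⟩ _

theorem linearIndependent_combination {n p : ℕ} {h : Fin n → ℂ → ℂ} (hh : LinearIndependent ℂ h)
    (c : Matrix (Fin p) (Fin n) ℂ) (I : Fin p → Fin n) (hI : (c.submatrix id I).det ≠ 0) :
    LinearIndependent ℂ fun s z => ∑ i, c s i * h i z := by
  rw [Fintype.linearIndependent_iff]
  intro x hx
  have h1 : ∑ i, (x ᵥ* c) i • h i = 0 := by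
    rw [← hx]
    ext z
    simp only [Matrix.vecMul, dotProduct, Finset.sum_apply, Pi.smul_apply, smul_eq_mul,
      Finset.sum_mul, Finset.mul_sum, mul_assoc]
    exact Finset.sum_comm
  have h2 := Fintype.linearIndependent_iff.1 hh _ h1
  have h3 : x ᵥ* c.submatrix id I = 0 := by
    ext s
    exact h2 (I s)
  exact fun i => congrFun (Matrix.eq_zero_of_vecMul_eq_zero hI h3) i

theorem differentiable_combination {ι κ : Type*} [Fintype ι] {f : ι → ℂ → ℂ}
    (hf : ∀ i, Differentiable ℂ (f i)) (c : Matrix κ ι ℂ) (s : κ) :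
    Differentiable ℂ fun z => ∑ i, c s i * f i z :=
  Differentiable.fun_sum fun i _ => (differentiable_const _).mul (hf i)

theorem entireWronskian_ne_zero {m : ℕ} {f : Fin m → ℂ → ℂ} (hf : ∀ i, Differentiable ℂ (f i))
    (hLI : LinearIndependent ℂ f) : entireWronskian f ≠ 0 :=
  det_wronskianMatrix_ne_zero hf hLI

theorem entireWronskian_combination_ne_zero {n p : ℕ} {h : Fin n → ℂ → ℂ}
    (hd : ∀ i, Differentiable ℂ (h i)) (hh : LinearIndependent ℂ h)
    (c : Matrix (Fin p) (Fin n) ℂ) (I : Fin p → Fin n) (hI : (c.submatrix id I).det ≠ 0) :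
    entireWronskian (fun s z => ∑ i, c s i * h i z) ≠ 0 :=
  entireWronskian_ne_zero (differentiable_combination hd c) (linearIndependent_combination hh c I hI)

theorem exists_minor_ne_zero {n p : ℕ} {c : Set.powersetCard (Fin n) p → Matrix (Fin p) (Fin n) ℂ}
    (hV : (Matrix.of fun I b : Set.powersetCard (Fin n) p =>
      ((c b).submatrix id (subsetEnum I)).det).det ≠ 0) (b : Set.powersetCard (Fin n) p) :
    ∃ I : Set.powersetCard (Fin n) p, ((c b).submatrix id (subsetEnum I)).det ≠ 0 := by
  obtain ⟨σ, hσ⟩ := exists_perm_of_det_ne_zero hV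
  exact ⟨σ b, hσ b⟩

/-- The lemma on the logarithmic derivative for the quotient of the compound Wronskian of a curve
by a product of decomposable Wronskians. -/
theorem isSmall_proximity_compoundWronskian_div {s : GrowthScale} {n k : ℕ} (hk : k < n)
    {f : Fin (n + 1) → ℂ → ℂ} (hf : ∀ i, Differentiable ℂ (f i)) (hLI : LinearIndependent ℂ f)
    (I : Fin (k + 1) → Fin (n + 1)) (hI : entireWronskian (fun s => f (I s)) ≠ 0)
    (hctrl : ∀ τ : Fin (k + 1) → Fin (n + 1),
      entireGerm ⟨entireWronskian fun s => f (τ s), differentiable_entireWronskian fun _ => hf _⟩ /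
        entireGerm ⟨entireWronskian fun s => f (I s),
          differentiable_entireWronskian fun _ => hf _⟩ ∈ s.controlled)
    (c : Set.powersetCard (Fin (n + 1)) (k + 1) → Matrix (Fin (k + 1)) (Fin (n + 1)) ℂ)
    (hV : (Matrix.of fun I b : Set.powersetCard (Fin (n + 1)) (k + 1) =>
      ((c b).submatrix id (subsetEnum I)).det).det ≠ 0) :
    s.IsSmall (proximity (fun z => compoundWronskian (k + 1) f z /
      ∏ b, entireWronskian (fun s z => ∑ i, c b s i * f i z) z) ⊤) := by
  set φ : Fin (n + 1) → MerField := fun i => entireGerm ⟨f i, hf i⟩ with hφ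
  have hW0 : wronskianDet derivation φ ≠ 0 := by
    rw [wronskianDet_entireGerm f hf]
    exact entireGerm_ne_zero _ (entireWronskian_ne_zero hf hLI)
  have hWτ : ∀ τ : Fin (k + 1) → Fin (n + 1), wronskianDet derivation (φ ∘ τ) =
      entireGerm ⟨entireWronskian fun s => f (τ s), differentiable_entireWronskian fun _ => hf _⟩ :=
    fun τ => wronskianDet_entireGerm (fun s => f (τ s)) fun s => hf _
  -- Here the growth of the original functions is bounded through the derived curve: their ratios
  -- lie in the controlled field as soon as the ratios of Wronskians do.
  obtain ⟨t, ht, hft⟩ := exists_ratio_mem (D := derivation) hk s.controlled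
    (fun x hx => derivation_mem_controlled hx) φ hW0 I
    (by rw [hWτ]; exact entireGerm_ne_zero _ hI) (fun τ => by rw [hWτ, hWτ]; exact hctrl τ)
  have hcomb : ∀ b, (fun s => ∑ i, const (c b s i) * φ i) = fun s =>
      entireGerm ⟨fun z => ∑ i, c b s i * f i z, differentiable_combination hf (c b) s⟩ := by
    intro b
    funext s
    have h1 : (⟨fun z => ∑ i, c b s i * f i z, differentiable_combination hf (c b) s⟩ :
        entireRing) = ∑ i, ⟨fun _ => c b s i, differentiable_const _⟩ * ⟨f i, hf i⟩ := by
      refine Subtype.ext (funext fun z => ?_)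
      simp
    rw [h1, map_sum]
    refine Finset.sum_congr rfl fun i _ => ?_
    rw [map_mul]
    rfl
  have hWb : ∀ b, wronskianDet derivation (fun s => ∑ i, const (c b s i) * φ i) =
      entireGerm ⟨entireWronskian fun s z => ∑ i, c b s i * f i z,
        differentiable_entireWronskian (differentiable_combination hf (c b))⟩ := by
    intro b
    rw [hcomb, wronskianDet_entireGerm]
  have hWb0 : ∀ b, entireWronskian (fun s z => ∑ i, c b s i * f i z) ≠ 0 := fun b => by
    obtain ⟨J, hJ⟩ := exists_minor_ne_zero hV b
    exact entireWronskian_combination_ne_zero hf hLI (c b) _ hJ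
  have hmem := det_compound_div_prod_wronskianDet_mem (D := derivation) (S := s.admissible)
    (C := s.controlled) (fun x hx => derivation_mem_admissible hx)
    (fun x hx => derivation_mem_controlled hx) (fun x hx => admissible_le_controlled hx)
    (fun x hx => derivation_div_self_mem_admissible hx) φ ht hft
    (fun b s i => const (c b s i)) (fun b s i => derivation_const _)
    (fun b s i => const_mem_controlled _)
    (fun b => by rw [hWb]; exact entireGerm_ne_zero _ (hWb0 b))
  have hdetV : (Matrix.of fun I b : Set.powersetCard (Fin (n + 1)) (k + 1) =>
      ((Matrix.of fun s i => const (c b s i)).submatrix id (subsetEnum I)).det).det =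
      const (Matrix.of fun I b : Set.powersetCard (Fin (n + 1)) (k + 1) =>
      ((c b).submatrix id (subsetEnum I)).det).det := by
    rw [RingHom.map_det]
    congr 1
    ext1 I b
    simp only [Matrix.of_apply, RingHom.mapMatrix_apply, Matrix.map_apply]
    rw [RingHom.map_det]
    rfl
  have hcV : const (Matrix.of fun I b : Set.powersetCard (Fin (n + 1)) (k + 1) =>
      ((c b).submatrix id (subsetEnum I)).det).det ≠ 0 :=
    (map_ne_zero const).2 hV
  -- The determinant of the minors is a nonzero constant and is divided out inside the admissible
  -- ring.
  have hmem2 := s.admissible.mul_mem hmem (const_mem_admissible (s := s)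
    (Matrix.of fun I b : Set.powersetCard (Fin (n + 1)) (k + 1) =>
      ((c b).submatrix id (subsetEnum I)).det).det⁻¹)
  rw [hdetV, map_inv₀, mul_div_right_comm, mul_inv_cancel_right₀ hcV,
    det_compoundMatrix_entireGerm _ f hf] at hmem2
  simp only [hWb] at hmem2
  have hprod : ∏ b : Set.powersetCard (Fin (n + 1)) (k + 1),
      entireGerm ⟨entireWronskian fun s z => ∑ i, c b s i * f i z,
        differentiable_entireWronskian (differentiable_combination hf (c b))⟩ =
      entireGerm ⟨fun z => ∏ b, entireWronskian (fun s z => ∑ i, c b s i * f i z) z,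
        Differentiable.fun_finsetProd fun b _ =>
          differentiable_entireWronskian (differentiable_combination hf (c b))⟩ := by
    rw [← map_prod]
    congr 1
    refine Subtype.ext (funext fun z => ?_)
    simp
  rw [hprod] at hmem2
  rw [entireGerm_mk, entireGerm_mk, germ_div, germ_mem_admissible_iff] at hmem2
  exact hmem2.2

end EntireGerms

/-! ### Plücker systems: comparison of norms and orders for independent forms. -/

section SecondMainEstimate
open Filter Topology Finset ValueDistribution Real
open scoped Matrix

/-- Linearly independent entire functions `f_0, …, f_n`, a factorization `W(f_I) = g H_I` of their
Wronskians of order `k + 1` such that the `H_I` have no common zero, and decomposable linear forms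
given by matrices `a_i` of which any `D` span. -/
structure PluckerSystem (n k q D : ℕ) where
  f : Fin (n + 1) → ℂ → ℂ
  differentiable_f : ∀ i, Differentiable ℂ (f i)
  linearIndependent_f : LinearIndependent ℂ f
  g : ℂ → ℂ
  differentiable_g : Differentiable ℂ g
  g_ne_zero : g ≠ 0
  H : Set.powersetCard (Fin (n + 1)) (k + 1) → ℂ → ℂ
  differentiable_H : ∀ I, Differentiable ℂ (H I)
  wronskian_eq : ∀ I z, entireWronskian (fun s => f (subsetEnum I s)) z = g z * H I z
  H_ne_zero : ∀ z, (fun I => H I z) ≠ 0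
  a : Fin q → Matrix (Fin (k + 1)) (Fin (n + 1)) ℂ
  minors_ne_zero : ∀ i, (fun I => ((a i).submatrix id (subsetEnum I)).det) ≠ 0
  card_le : Fintype.card (Set.powersetCard (Fin (n + 1)) (k + 1)) ≤ D
  le_q : D ≤ q
  span_eq_top : ∀ S : Finset (Fin q), #S = D → Submodule.span ℂ ((fun i =>
    (fun I : Set.powersetCard (Fin (n + 1)) (k + 1) =>
      ((a i).submatrix id (subsetEnum I)).det)) '' (S : Set (Fin q))) = ⊤

/-- Every coordinate is a fixed linear combination of the forms in `R`, so small values of these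
forms make the vector small. -/
theorem exists_norm_le_of_span_eq_top {α ι : Type*} [Fintype ι] [DecidableEq ι] (v : α → ι → ℂ)
    (R : Finset α) (h : Submodule.span ℂ (v '' (R : Set α)) = ⊤) :
    ∃ C : ℝ, 0 ≤ C ∧ ∀ (x : ι → ℂ) (ε : ℝ), 0 ≤ ε → (∀ i ∈ R, ‖∑ I, x I * v i I‖ ≤ ε) →
      ‖x‖ ≤ C * ε := by
  have h1 : ∀ I : ι, ∃ c : α → ℂ, ∑ i ∈ R, c i • v i = Pi.single I 1 := fun I => by
    have h2 : (Pi.single I 1 : ι → ℂ) ∈ Submodule.span ℂ (v '' (R : Set α)) := by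
      rw [h]; trivial
    obtain ⟨c, hc⟩ := (Submodule.mem_span_image_finset_iff_exists_fun ℂ).1 h2
    refine ⟨Function.extend Subtype.val c 0, ?_⟩
    rw [← Finset.sum_coe_sort R fun i => Function.extend Subtype.val c 0 i • v i, ← hc]
    exact Finset.sum_congr rfl fun i _ => by rw [Subtype.val_injective.extend_apply]
  choose c hc using h1
  refine ⟨∑ I, ∑ i ∈ R, ‖c I i‖, by positivity, fun x ε hε hx => ?_⟩
  refine (pi_norm_le_iff_of_nonneg (by positivity)).2 fun I => ?_
  have h3 : x I = ∑ i ∈ R, c I i * ∑ J, x J * v i J := by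
    have h4 : ∀ J, ∑ i ∈ R, c I i * v i J = (Pi.single I 1 : ι → ℂ) J := fun J => by
      have := congrFun (hc I) J
      simpa using this
    calc x I = ∑ J, x J * (Pi.single I 1 : ι → ℂ) J := by simp [Pi.single_apply]
      _ = ∑ J, x J * ∑ i ∈ R, c I i * v i J := by simp only [h4]
      _ = _ := by
        simp only [Finset.mul_sum]
        rw [Finset.sum_comm]
        exact Finset.sum_congr rfl fun i _ => Finset.sum_congr rfl fun J _ => by ring
  calc ‖x I‖ ≤ ∑ i ∈ R, ‖c I i‖ * ‖∑ J, x J * v i J‖ := by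
        rw [h3]
        exact (norm_sum_le _ _).trans (Finset.sum_le_sum fun i _ => (norm_mul_le _ _))
    _ ≤ ∑ i ∈ R, ‖c I i‖ * ε := Finset.sum_le_sum fun i hi =>
        mul_le_mul_of_nonneg_left (hx i hi) (norm_nonneg _)
    _ = (∑ i ∈ R, ‖c I i‖) * ε := by rw [Finset.sum_mul]
    _ ≤ _ := mul_le_mul_of_nonneg_right
        (Finset.single_le_sum (f := fun I => ∑ i ∈ R, ‖c I i‖) (fun J _ => by positivity)
          (mem_univ I)) hε

/-- Fewer than `D` forms can be small at a given vector, since any `D` of them bound its norm. The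
set of small forms is padded to exactly `D` elements, the size required by the weights. -/
theorem exists_norm_le_off_subset {α ι : Type*} [Fintype α] [Fintype ι] [DecidableEq ι]
    [DecidableEq α] (v : α → ι → ℂ) {D : ℕ} (hD : D ≤ Fintype.card α)
    (h : ∀ R : Finset α, #R = D → Submodule.span ℂ (v '' (R : Set α)) = ⊤) :
    ∃ C : ℝ, 0 < C ∧ (∀ (x : ι → ℂ) i, ‖∑ I, x I * v i I‖ ≤ C * ‖x‖) ∧
      ∀ x : ι → ℂ, x ≠ 0 → ∃ R : Finset α, #R = D ∧ ∀ i ∉ R, ‖x‖ ≤ C * ‖∑ I, x I * v i I‖ := by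
  have h1 : ∀ R : Finset α, ∃ C : ℝ, 0 ≤ C ∧ (#R = D → ∀ (x : ι → ℂ) (ε : ℝ), 0 ≤ ε →
      (∀ i ∈ R, ‖∑ I, x I * v i I‖ ≤ ε) → ‖x‖ ≤ C * ε) := fun R => by
    by_cases hR : #R = D
    · obtain ⟨C, h0, hC⟩ := exists_norm_le_of_span_eq_top v R (h R hR)
      exact ⟨C, h0, fun _ => hC⟩
    · exact ⟨0, le_rfl, fun h => absurd h hR⟩
  choose c hc0 hc using h1
  set C : ℝ := 1 + ∑ R, c R + ∑ i, ∑ I, ‖v i I‖ with hCdef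
  have hcC : ∀ R, c R < C := fun R => by
    have h2 := Finset.single_le_sum (f := c) (fun R _ => hc0 R) (mem_univ R)
    have h3 : 0 ≤ ∑ i, ∑ I, ‖v i I‖ := by positivity
    linarith
  have hC0 : 0 < C := (hc0 ∅).trans_lt (hcC ∅)
  refine ⟨C, hC0, fun x i => ?_, fun x hx => ?_⟩
  · calc ‖∑ I, x I * v i I‖ ≤ ∑ I, ‖x‖ * ‖v i I‖ := by
          refine (norm_sum_le _ _).trans (Finset.sum_le_sum fun I _ => ?_)
          rw [norm_mul]
          exact mul_le_mul_of_nonneg_right (norm_le_pi_norm x I) (norm_nonneg _)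
      _ = (∑ I, ‖v i I‖) * ‖x‖ := by rw [← Finset.mul_sum, mul_comm]
      _ ≤ _ := by
        refine mul_le_mul_of_nonneg_right ?_ (norm_nonneg _)
        have h2 := Finset.single_le_sum (f := fun i => ∑ I, ‖v i I‖) (fun i _ => by positivity)
          (mem_univ i)
        have h3 : 0 ≤ ∑ R, c R := Finset.sum_nonneg fun R _ => hc0 R
        linarith
  · have hx0 : 0 < ‖x‖ := norm_pos_iff.2 hx
    set Z := univ.filter fun i => C * ‖∑ I, x I * v i I‖ < ‖x‖ with hZ
    have hZD : #Z < D := by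
      by_contra! hle
      obtain ⟨R, hRZ, hR⟩ := Finset.exists_subset_card_eq hle
      have h2 := hc R hR x (‖x‖ / C) (by positivity) fun i hi => by
        have := (mem_filter.1 (hRZ hi)).2
        rw [le_div_iff₀ hC0]
        linarith
      have h3 : c R * (‖x‖ / C) < C * (‖x‖ / C) := by
        have := hcC R
        gcongr
      rw [mul_div_cancel₀ _ hC0.ne'] at h3
      linarith
    obtain ⟨R, hZR, hR⟩ := Finset.exists_superset_card_eq hZD.le hD
    refine ⟨R, hR, fun i hi => ?_⟩
    have : i ∉ Z := fun h => hi (hZR h)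
    simpa [hZ] using this

theorem exists_equiv_det_ne_zero {α ι : Type*} [Fintype ι] [DecidableEq ι]
    (v : α → ι → ℂ) {B : Finset α} (hB : #B = Fintype.card ι)
    (hLI : LinearIndependent ℂ fun i : B => v i) :
    ∃ e : ι ≃ B, (Matrix.of fun I b => v (e b) I).det ≠ 0 := by
  have hcard : Fintype.card ι = Fintype.card B := by simp [hB]
  refine ⟨Fintype.equivOfCardEq hcard, ?_⟩
  have h1 := hLI.comp _ (Fintype.equivOfCardEq hcard).injective
  rw [← Matrix.det_transpose]
  refine ((Matrix.isUnit_iff_isUnit_det _).1 (Matrix.linearIndependent_rows_iff_isUnit.1 ?_)).ne_zero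
  exact h1

namespace PluckerSystem
variable {n k q D : ℕ} (P : PluckerSystem n k q D)

/-- The Plücker coordinates of the forms. -/
noncomputable def minors (i : Fin q) (I : Set.powersetCard (Fin (n + 1)) (k + 1)) : ℂ :=
  ((P.a i).submatrix id (subsetEnum I)).det

/-- The value of the `i`-th form along the curve. -/
noncomputable def form (i : Fin q) (z : ℂ) : ℂ := ∑ I, P.H I z * P.minors i I

/-- The Wronskian of the `i`-th form. -/
noncomputable def formWronskian (i : Fin q) : ℂ → ℂ :=
  entireWronskian fun s z => ∑ j, P.a i s j * P.f j z

/-- Cauchy-Binet together with the common factor `g` of the Plücker Wronskians. -/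
theorem formWronskian_eq (i : Fin q) : P.formWronskian i = P.g * P.form i := by
  funext z
  rw [formWronskian, entireWronskian_combination P.differentiable_f, Pi.mul_apply, form,
    Finset.mul_sum]
  exact Finset.sum_congr rfl fun I _ => by rw [P.wronskian_eq, mul_assoc]; rfl

theorem differentiable_form (i : Fin q) : Differentiable ℂ (P.form i) :=
  Differentiable.fun_sum fun I _ => (P.differentiable_H I).mul_const _

theorem differentiable_formWronskian (i : Fin q) : Differentiable ℂ (P.formWronskian i) :=
  differentiable_entireWronskian (differentiable_combination P.differentiable_f (P.a i))

theorem formWronskian_ne_zero (i : Fin q) : P.formWronskian i ≠ 0 := by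
  obtain ⟨I, hI⟩ := Function.ne_iff.1 (P.minors_ne_zero i)
  exact entireWronskian_combination_ne_zero P.differentiable_f P.linearIndependent_f (P.a i) _ hI

theorem form_ne_zero (i : Fin q) : P.form i ≠ 0 := by
  intro h
  have := P.formWronskian_eq i
  rw [h, mul_zero] at this
  exact P.formWronskian_ne_zero i this

theorem analyticOrderNatAt_formWronskian (i : Fin q) (x : ℂ) :
    analyticOrderNatAt (P.formWronskian i) x =
      analyticOrderNatAt P.g x + analyticOrderNatAt (P.form i) x := by
  rw [formWronskian_eq]
  exact analyticOrderNatAt_mul (P.differentiable_g.analyticAt x)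
    ((P.differentiable_form i).analyticAt x)
    (analyticOrderAt_ne_top_of_entire P.differentiable_g P.g_ne_zero x)
    (analyticOrderAt_ne_top_of_entire (P.differentiable_form i) (P.form_ne_zero i) x)

/-- The compound Wronskian of the system. -/
noncomputable def wronskian : ℂ → ℂ := compoundWronskian (k + 1) P.f

theorem differentiable_wronskian : Differentiable ℂ P.wronskian :=
  differentiable_compoundWronskian _ P.differentiable_f

theorem wronskian_ne_zero : P.wronskian ≠ 0 :=
  compoundWronskian_ne_zero _ P.differentiable_f P.linearIndependent_f

/-- The local inequality with the truncation level and the order of `g` taken out of each maximum;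
the truncated subtraction counts the multiplicity in excess of the level. -/
theorem sum_sub_order_le (hk : k ≤ n) {B : Finset (Fin q)}
    (hB : #B = Fintype.card (Set.powersetCard (Fin (n + 1)) (k + 1)))
    (hLI : LinearIndependent ℂ fun i : B => P.minors i) (x : ℂ) :
    ∑ i ∈ B, (analyticOrderNatAt (P.form i) x - (k + 1) * (n - k)) +
      #B * analyticOrderNatAt P.g x ≤ analyticOrderNatAt P.wronskian x := by
  obtain ⟨e, he⟩ := exists_equiv_det_ne_zero P.minors hB hLI
  have h1 := sum_max_order_wronskian_le (Nat.succ_le_succ hk) P.differentiable_f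
    P.linearIndependent_f (fun b => P.a (e b)) he P.differentiable_g P.g_ne_zero
    P.differentiable_H P.wronskian_eq x
  have h0 : n + 1 - (k + 1) = n - k := by omega
  simp only [Nat.succ_eq_add_one, h0] at h1
  have h2 : ∀ b, max (analyticOrderNatAt (entireWronskian fun s z => ∑ i, P.a (e b) s i * P.f i z) x)
      ((k + 1) * (n - k) + analyticOrderNatAt P.g x) =
      (analyticOrderNatAt (P.form (e b)) x - (k + 1) * (n - k)) +
        ((k + 1) * (n - k) + analyticOrderNatAt P.g x) := fun b => by
    have := P.analyticOrderNatAt_formWronskian (e b) x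
    rw [formWronskian] at this
    rw [this]
    omega
  simp only [h2] at h1
  rw [Finset.sum_add_distrib, Finset.sum_const, Finset.card_univ, ← hB,
    Equiv.sum_comp e fun i : B => analyticOrderNatAt (P.form i) x - (k + 1) * (n - k),
    Finset.sum_coe_sort B fun i => analyticOrderNatAt (P.form i) x - (k + 1) * (n - k),
    smul_eq_mul, mul_add] at h1
  change _ ≤ analyticOrderNatAt P.wronskian x + _ at h1
  omega

theorem isSmall_proximity {s : GrowthScale} (hk : k < n)
    (I : Fin (k + 1) → Fin (n + 1)) (hI : entireWronskian (fun s => P.f (I s)) ≠ 0)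
    (hctrl : ∀ τ : Fin (k + 1) → Fin (n + 1),
      entireGerm ⟨entireWronskian fun s => P.f (τ s),
          differentiable_entireWronskian fun _ => P.differentiable_f _⟩ /
        entireGerm ⟨entireWronskian fun s => P.f (I s),
          differentiable_entireWronskian fun _ => P.differentiable_f _⟩ ∈ s.controlled)
    {B : Finset (Fin q)} (hB : #B = Fintype.card (Set.powersetCard (Fin (n + 1)) (k + 1)))
    (hLI : LinearIndependent ℂ fun i : B => P.minors i) :
    s.IsSmall (proximity (fun z => P.wronskian z / ∏ i ∈ B, P.formWronskian i z) ⊤) := by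
  obtain ⟨e, he⟩ := exists_equiv_det_ne_zero P.minors hB hLI
  have h1 := isSmall_proximity_compoundWronskian_div (s := s) hk P.differentiable_f
    P.linearIndependent_f I hI hctrl (fun b => P.a (e b)) he
  have h2 : (fun z => P.wronskian z / ∏ i ∈ B, P.formWronskian i z) = fun z =>
      compoundWronskian (k + 1) P.f z /
        ∏ b, entireWronskian (fun s z => ∑ i, P.a (e b) s i * P.f i z) z := by
    funext z
    rw [← Finset.prod_coe_sort B fun i => P.formWronskian i z,
      ← Equiv.prod_comp e fun i : B => P.formWronskian i z]
    rfl
  rw [h2]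
  exact h1

end PluckerSystem
end SecondMainEstimate

/-! ### The second main estimate with Nochka weights. -/

section SecondMainEstimate
open Filter Topology Finset ValueDistribution Real
open scoped Matrix

theorem circleIntegrable_log_norm_entire {h : ℂ → ℂ} (hd : Differentiable ℂ h) (r : ℝ) :
    CircleIntegrable (fun z => Real.log ‖h z‖) 0 r :=
  MeromorphicOn.circleIntegrable_log_norm fun z _ => (hd.analyticAt z).meromorphicAt

namespace PluckerSystem
variable {n k q D : ℕ} (P : PluckerSystem n k q D)

/-- The sup norm of the reduced representation. -/
noncomputable def logNorm (z : ℂ) : ℝ := Real.log ‖fun I => P.H I z‖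

theorem continuous_logNorm : Continuous P.logNorm := by
  refine Continuous.log ?_ fun z => norm_ne_zero_iff.2 (P.H_ne_zero z)
  exact (continuous_pi fun I => (P.differentiable_H I).continuous).norm

/-- The sets of `dim` linearly independent forms. -/
noncomputable def bases : Finset (Finset (Fin q)) := by
  classical
  exact univ.filter fun B => #B = Fintype.card (Set.powersetCard (Fin (n + 1)) (k + 1)) ∧
    LinearIndependent ℂ fun i : B => P.minors i

theorem mem_bases {B : Finset (Fin q)} : B ∈ P.bases ↔
    #B = Fintype.card (Set.powersetCard (Fin (n + 1)) (k + 1)) ∧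
    LinearIndependent ℂ fun i : B => P.minors i := by
  simp [bases]

/-- Nochka weights for the system. -/
structure IsNochkaWeight (Θ : ℝ) (ω : Fin q → ℝ) : Prop where
  pos : 0 < Θ
  nonneg : ∀ i, 0 ≤ ω i
  le : ∀ i, ω i ≤ Θ
  sum_eq : ∑ i, ω i = Θ * ((q : ℝ) -
    (2 * D - Fintype.card (Set.powersetCard (Fin (n + 1)) (k + 1)))) +
      Fintype.card (Set.powersetCard (Fin (n + 1)) (k + 1))
  exists_basis : ∀ R : Finset (Fin q), #R = D → ∀ x : Fin q → ℝ, (∀ i ∈ R, 0 ≤ x i) →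
    ∃ B ∈ P.bases, B ⊆ R ∧ ∑ i ∈ R, ω i * x i ≤ ∑ i ∈ B, x i

theorem exists_isNochkaWeight (hk : k ≤ n) : ∃ Θ ω, P.IsNochkaWeight Θ ω := by
  have hcard : Module.finrank ℂ (Set.powersetCard (Fin (n + 1)) (k + 1) → ℂ) =
      Fintype.card (Set.powersetCard (Fin (n + 1)) (k + 1)) := Module.finrank_fintype_fun_eq_card ℂ
  have hpos : 0 < Fintype.card (Set.powersetCard (Fin (n + 1)) (k + 1)) := by
    rw [← Nat.card_eq_fintype_card, Set.powersetCard.card, Nat.card_eq_fintype_card,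
      Fintype.card_fin]
    exact Nat.choose_pos (by omega)
  obtain ⟨Θ, ω, h1, h2, h3, h4⟩ := exists_nochka_weights_of_span P.minors (D := D)
    (by rw [hcard]; exact hpos) (by rw [hcard]; exact P.card_le) (by simpa using P.le_q)
    P.span_eq_top
  rw [hcard] at h3 h4
  refine ⟨Θ, ω, h1, fun i => (h2 i).1, fun i => (h2 i).2, by simpa using h3, fun R hR x hx => ?_⟩
  obtain ⟨B, hBR, hB, hLI, hsum⟩ := h4 R hR x hx
  exact ⟨B, P.mem_bases.2 ⟨hB, hLI⟩, hBR, hsum⟩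

variable {P}

/-- At a given point only forms of a suitable `D`-element set vanish. The weights reduce that set to
a basis, to which the local inequality applies. -/
theorem IsNochkaWeight.sum_mul_order_le {Θ : ℝ} {ω : Fin q → ℝ} (hω : P.IsNochkaWeight Θ ω)
    (hk : k ≤ n) (x : ℂ) :
    ∑ i, ω i * ((analyticOrderNatAt (P.form i) x - (k + 1) * (n - k) : ℕ) : ℝ) +
      Fintype.card (Set.powersetCard (Fin (n + 1)) (k + 1)) * (analyticOrderNatAt P.g x : ℝ) ≤
      analyticOrderNatAt P.wronskian x := by
  obtain ⟨C, hC, -, hoff⟩ := exists_norm_le_off_subset P.minors (D := D) (by simpa using P.le_q)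
    P.span_eq_top
  obtain ⟨R, hR, hRx⟩ := hoff _ (P.H_ne_zero x)
  obtain ⟨B, hB, -, hsum⟩ := hω.exists_basis R hR
    (fun i => ((analyticOrderNatAt (P.form i) x - (k + 1) * (n - k) : ℕ) : ℝ))
    fun i _ => Nat.cast_nonneg _
  have h1 : ∑ i, ω i * ((analyticOrderNatAt (P.form i) x - (k + 1) * (n - k) : ℕ) : ℝ) =
      ∑ i ∈ R, ω i * ((analyticOrderNatAt (P.form i) x - (k + 1) * (n - k) : ℕ) : ℝ) := by
    refine (Finset.sum_subset (subset_univ R) fun i _ hi => ?_).symm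
    have h2 := hRx i hi
    have h3 : P.form i x ≠ 0 := by
      intro h0
      change _ ≤ C * ‖P.form i x‖ at h2
      rw [h0, norm_zero, mul_zero] at h2
      exact P.H_ne_zero x (norm_le_zero_iff.1 h2)
    have h4 : analyticOrderNatAt (P.form i) x = 0 := by
      by_contra h5
      exact h3 ((analyticOrderNatAt_ne_zero_iff (P.differentiable_form i) (P.form_ne_zero i) x).1 h5)
    simp [h4]
  obtain ⟨hBcard, hLI⟩ := P.mem_bases.1 hB
  have h5 := P.sum_sub_order_le hk hBcard hLI x
  rw [hBcard] at h5
  have h6 : ∑ i ∈ B, ((analyticOrderNatAt (P.form i) x - (k + 1) * (n - k) : ℕ) : ℝ) +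
      Fintype.card (Set.powersetCard (Fin (n + 1)) (k + 1)) * (analyticOrderNatAt P.g x : ℝ) ≤
      analyticOrderNatAt P.wronskian x := by exact_mod_cast h5
  rw [h1]
  linarith

/-- The nonnegative quantities `log (C ‖H‖ / ‖form i‖)` are bounded outside a `D`-element set, and
on that set the weights reduce them to a basis `B`. There the product of the forms is rewritten as
the product of their Wronskians divided by a power of `g`, and `Δ` is inserted. -/
theorem IsNochkaWeight.exists_pointwise {Θ : ℝ} {ω : Fin q → ℝ} (hω : P.IsNochkaWeight Θ ω) :
    ∃ C : ℝ, ∀ z, P.g z ≠ 0 → P.wronskian z ≠ 0 → (∀ i, P.form i z ≠ 0) →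
      ∑ i, ω i * (P.logNorm z - Real.log ‖P.form i z‖) ≤
        Fintype.card (Set.powersetCard (Fin (n + 1)) (k + 1)) *
          (P.logNorm z + Real.log ‖P.g z‖) - Real.log ‖P.wronskian z‖ +
        ∑ B ∈ P.bases, Real.posLog ‖P.wronskian z / ∏ i ∈ B, P.formWronskian i z‖ + C := by
  obtain ⟨C, hC, hle, hoff⟩ := exists_norm_le_off_subset P.minors (D := D) (by simpa using P.le_q)
    P.span_eq_top
  refine ⟨Fintype.card (Set.powersetCard (Fin (n + 1)) (k + 1)) * Real.log C +
    (∑ i, ω i) * (2 * |Real.log C|) - (∑ i, ω i) * Real.log C, fun z hg hΔ hh => ?_⟩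
  obtain ⟨R, hR, hRx⟩ := hoff _ (P.H_ne_zero z)
  have hx0 : 0 < ‖fun I => P.H I z‖ := norm_pos_iff.2 (P.H_ne_zero z)
  set x : Fin q → ℝ := fun i => Real.log C + P.logNorm z - Real.log ‖P.form i z‖ with hx
  have hxnn : ∀ i, 0 ≤ x i := fun i => by
    have h1 := Real.log_le_log (norm_pos_iff.2 (hh i)) (hle (fun I => P.H I z) i)
    rw [Real.log_mul hC.ne' hx0.ne'] at h1
    simp only [hx, logNorm]
    linarith
  have hxoff : ∀ i ∉ R, x i ≤ 2 * |Real.log C| := fun i hi => by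
    have h1 := Real.log_le_log hx0 (hRx i hi)
    change _ ≤ Real.log (C * ‖P.form i z‖) at h1
    rw [Real.log_mul hC.ne' (norm_ne_zero_iff.2 (hh i))] at h1
    have h2 := le_abs_self (Real.log C)
    simp only [hx, logNorm]
    linarith
  obtain ⟨B, hB, hBR, hsum⟩ := hω.exists_basis R hR x fun i _ => hxnn i
  have hBcard := (P.mem_bases.1 hB).1
  have h1 : ∑ i, ω i * x i ≤ ∑ i ∈ B, x i + (∑ i, ω i) * (2 * |Real.log C|) := by
    rw [← Finset.sum_add_sum_compl R]
    refine add_le_add hsum ?_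
    calc ∑ i ∈ Rᶜ, ω i * x i ≤ ∑ i ∈ Rᶜ, ω i * (2 * |Real.log C|) :=
          Finset.sum_le_sum fun i hi => mul_le_mul_of_nonneg_left
            (hxoff i (Finset.mem_compl.1 hi)) (hω.nonneg i)
      _ ≤ ∑ i, ω i * (2 * |Real.log C|) :=
          Finset.sum_le_sum_of_subset_of_nonneg (subset_univ _) fun i _ _ =>
            mul_nonneg (hω.nonneg i) (by positivity)
      _ = _ := by rw [Finset.sum_mul]
  have h2 : ∑ i, ω i * x i = ∑ i, ω i * (P.logNorm z - Real.log ‖P.form i z‖) +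
      (∑ i, ω i) * Real.log C := by
    rw [Finset.sum_mul, ← Finset.sum_add_distrib]
    exact Finset.sum_congr rfl fun i _ => by simp only [hx]; ring
  have hprod : ∏ i ∈ B, P.formWronskian i z ≠ 0 := by
    refine Finset.prod_ne_zero_iff.2 fun i _ => ?_
    rw [formWronskian_eq]
    exact mul_ne_zero hg (hh i)
  have h3 : Real.log ‖∏ i ∈ B, P.formWronskian i z‖ =
      #B * Real.log ‖P.g z‖ + ∑ i ∈ B, Real.log ‖P.form i z‖ := by
    rw [norm_prod, Real.log_prod (fun i hi => norm_ne_zero_iff.2 (Finset.prod_ne_zero_iff.1 hprod i hi))]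
    have : ∀ i, Real.log ‖P.formWronskian i z‖ = Real.log ‖P.g z‖ + Real.log ‖P.form i z‖ :=
      fun i => by
        rw [formWronskian_eq, Pi.mul_apply, norm_mul, Real.log_mul (norm_ne_zero_iff.2 hg)
          (norm_ne_zero_iff.2 (hh i))]
    simp only [this, Finset.sum_add_distrib, Finset.sum_const, nsmul_eq_mul]
  have h4 : ∑ i ∈ B, x i = #B * (Real.log C + P.logNorm z) - ∑ i ∈ B, Real.log ‖P.form i z‖ := by
    simp only [hx, Finset.sum_sub_distrib, Finset.sum_const, nsmul_eq_mul]
  -- The basis depends on the point, so its term is bounded by the sum over all finitely many bases.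
  have h5 : Real.log ‖P.wronskian z‖ - Real.log ‖∏ i ∈ B, P.formWronskian i z‖ ≤
      ∑ B ∈ P.bases, Real.posLog ‖P.wronskian z / ∏ i ∈ B, P.formWronskian i z‖ := by
    rw [← Real.log_div (norm_ne_zero_iff.2 hΔ) (norm_ne_zero_iff.2 hprod), ← norm_div]
    exact (le_max_right 0 _).trans (Finset.single_le_sum
      (f := fun B => Real.posLog ‖P.wronskian z / ∏ i ∈ B, P.formWronskian i z‖)
      (fun B _ => Real.posLog_nonneg) hB)
  rw [hBcard] at h3 h4
  nlinarith

theorem IsNochkaWeight.exists_circleAverage_le {Θ : ℝ} {ω : Fin q → ℝ}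
    (hω : P.IsNochkaWeight Θ ω) : ∃ C : ℝ, ∀ r : ℝ, 0 < r →
      (∑ i, ω i - Fintype.card (Set.powersetCard (Fin (n + 1)) (k + 1))) *
          circleAverage P.logNorm 0 r + circleAverage (fun z => Real.log ‖P.wronskian z‖) 0 r ≤
        ∑ i, ω i * circleAverage (fun z => Real.log ‖P.form i z‖) 0 r +
        Fintype.card (Set.powersetCard (Fin (n + 1)) (k + 1)) *
          circleAverage (fun z => Real.log ‖P.g z‖) 0 r +
        ∑ B ∈ P.bases, proximity (fun z => P.wronskian z / ∏ i ∈ B, P.formWronskian i z) ⊤ r +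
        C := by
  obtain ⟨C, hC⟩ := hω.exists_pointwise
  refine ⟨C, fun r hr => ?_⟩
  set d : ℝ := (Fintype.card (Set.powersetCard (Fin (n + 1)) (k + 1)) : ℝ)
  have hu : CircleIntegrable P.logNorm 0 r := P.continuous_logNorm.continuousOn.circleIntegrable'
  have hΔ := circleIntegrable_log_norm_entire P.differentiable_wronskian r
  have hg := circleIntegrable_log_norm_entire P.differentiable_g r
  have hh := fun i => circleIntegrable_log_norm_entire (P.differentiable_form i) r
  have hθ : ∀ B, CircleIntegrable (fun z => Real.posLog
      ‖P.wronskian z / ∏ i ∈ B, P.formWronskian i z‖) 0 r := fun B => by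
    refine MeromorphicOn.circleIntegrable_posLog_norm fun z _ => ?_
    exact (P.differentiable_wronskian.analyticAt z).meromorphicAt.div
      (Differentiable.analyticAt (Differentiable.fun_finsetProd
        fun i _ => P.differentiable_formWronskian i) z).meromorphicAt
  have hu' : CircleIntegrable (fun z => (∑ i, ω i - d) * P.logNorm z) 0 r :=
    IntervalIntegrable.const_mul hu _
  have hg' : CircleIntegrable (fun z => d * Real.log ‖P.g z‖) 0 r :=
    IntervalIntegrable.const_mul hg _
  have hh' : ∀ i, CircleIntegrable (fun z => ω i * Real.log ‖P.form i z‖) 0 r :=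
    fun i => IntervalIntegrable.const_mul (hh i) _
  have hhs : CircleIntegrable (fun z => ∑ i, ω i * Real.log ‖P.form i z‖) 0 r :=
    CircleIntegrable.fun_sum _ fun i _ => hh' i
  have hθs : CircleIntegrable (fun z => ∑ B ∈ P.bases, Real.posLog
      ‖P.wronskian z / ∏ i ∈ B, P.formWronskian i z‖) 0 r :=
    CircleIntegrable.fun_sum _ fun B _ => hθ B
  have h1 : CircleIntegrable (fun z => ∑ i, ω i * Real.log ‖P.form i z‖ +
      d * Real.log ‖P.g z‖) 0 r := hhs.add hg'
  have h2 : CircleIntegrable (fun z => ∑ i, ω i * Real.log ‖P.form i z‖ +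
      d * Real.log ‖P.g z‖ +
      ∑ B ∈ P.bases, Real.posLog ‖P.wronskian z / ∏ i ∈ B, P.formWronskian i z‖) 0 r := h1.add hθs
  have hmono := circleAverage_mono_codiscreteWithin (c := 0) (R := r)
    (u := fun z => (∑ i, ω i - d) * P.logNorm z + Real.log ‖P.wronskian z‖)
    (v := fun z => ∑ i, ω i * Real.log ‖P.form i z‖ + d * Real.log ‖P.g z‖ +
      ∑ B ∈ P.bases, Real.posLog ‖P.wronskian z / ∏ i ∈ B, P.formWronskian i z‖ + C)
    hr.ne' (hu'.add hΔ)
    (h2.add (circleIntegrable_const C 0 r)) ?_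
  · rw [circleAverage_fun_add hu' hΔ,
      circleAverage_fun_add h2 (circleIntegrable_const C 0 r),
      circleAverage_fun_add h1 hθs, circleAverage_fun_add hhs hg',
      circleAverage_fun_sum (fun B _ => hθ B), circleAverage_fun_sum (fun i _ => hh' i),
      circleAverage_const] at hmono
    simp only [← smul_eq_mul, circleAverage_fun_smul] at hmono
    simp only [smul_eq_mul] at hmono
    simpa only [proximity_top] using hmono
  · have h1 : ∀ᶠ z in codiscrete ℂ, P.g z ≠ 0 ∧ P.wronskian z ≠ 0 ∧ ∀ i, P.form i z ≠ 0 :=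
      (eventually_codiscrete_ne_zero P.differentiable_g P.g_ne_zero).and
        ((eventually_codiscrete_ne_zero P.differentiable_wronskian P.wronskian_ne_zero).and
          (eventually_all.2 fun i =>
            eventually_codiscrete_ne_zero (P.differentiable_form i) (P.form_ne_zero i)))
    have h3 : ∀ᶠ z in codiscreteWithin (Metric.sphere (0 : ℂ) |r|),
        P.g z ≠ 0 ∧ P.wronskian z ≠ 0 ∧ ∀ i, P.form i z ≠ 0 :=
      codiscreteWithin_mono (Set.subset_univ _) h1
    refine h3.mono ?_
    rintro z ⟨hg0, hΔ0, hh0⟩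
    have h2 := hC z hg0 hΔ0 hh0
    simp only [mul_sub, Finset.sum_sub_distrib] at h2
    rw [← Finset.sum_mul] at h2
    linarith

variable (P)

/-- Jensen's formula turns every average into a weighted count of zeros. The zeros of `Δ` pay for
the untruncated excess of the forms and for the zeros of `g`; only the truncated counts survive. -/
theorem exists_secondMainEstimate {s : GrowthScale} (hk : k < n)
    (I : Fin (k + 1) → Fin (n + 1)) (hI : entireWronskian (fun s => P.f (I s)) ≠ 0)
    (hctrl : ∀ τ : Fin (k + 1) → Fin (n + 1),
      entireGerm ⟨entireWronskian fun s => P.f (τ s),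
          differentiable_entireWronskian fun _ => P.differentiable_f _⟩ /
        entireGerm ⟨entireWronskian fun s => P.f (I s),
          differentiable_entireWronskian fun _ => P.differentiable_f _⟩ ∈ s.controlled) :
    ∃ φ : ℝ → ℝ, s.IsSmall φ ∧ ∀ r : ℝ, 1 ≤ r →
      ((q : ℝ) - (2 * D - Fintype.card (Set.powersetCard (Fin (n + 1)) (k + 1)))) *
          circleAverage P.logNorm 0 r ≤
        ∑ i, DerivedCurve.countingFunction ((k + 1) * (n - k)) (P.form i) r + φ r := by
  obtain ⟨Θ, ω, hω⟩ := P.exists_isNochkaWeight hk.le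
  obtain ⟨C, hC⟩ := hω.exists_circleAverage_le
  obtain ⟨cg, hcg⟩ := exists_circleAverage_log_norm_eq P.differentiable_g P.g_ne_zero
  obtain ⟨cΔ, hcΔ⟩ := exists_circleAverage_log_norm_eq P.differentiable_wronskian P.wronskian_ne_zero
  choose ch hch using fun i =>
    exists_circleAverage_log_norm_eq (P.differentiable_form i) (P.form_ne_zero i)
  choose cN hcN using fun i =>
    exists_sum_countingWeight_le ((k + 1) * (n - k)) (P.differentiable_form i) (P.form_ne_zero i)
  set d : ℝ := (Fintype.card (Set.powersetCard (Fin (n + 1)) (k + 1)) : ℝ) with hd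
  set c₀ : ℝ := ∑ i, ω i * (cN i + ch i) + d * cg - cΔ + C with hc₀
  refine ⟨fun r => Θ⁻¹ * (∑ B ∈ P.bases, proximity
    (fun z => P.wronskian z / ∏ i ∈ B, P.formWronskian i z) ⊤ r + c₀), ?_, fun r hr => ?_⟩
  · refine GrowthScale.IsSmall.const_mul (GrowthScale.IsSmall.add ?_ (GrowthScale.isSmall_const c₀))
      (inv_nonneg.2 hω.pos.le)
    exact GrowthScale.IsSmall.sum _ fun B hB => P.isSmall_proximity hk I hI hctrl
      (P.mem_bases.1 hB).1 (P.mem_bases.1 hB).2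
  · have hr0 : 0 < r := by linarith
    classical
    -- One finite set for all zeros in the disk, so that the local inequality can be summed over it
    -- with common nonnegative weights.
    set S : Finset ℂ := (finite_zeros_closedBall P.differentiable_g P.g_ne_zero r).toFinset ∪
      (finite_zeros_closedBall P.differentiable_wronskian P.wronskian_ne_zero r).toFinset ∪
      univ.biUnion fun i =>
        (finite_zeros_closedBall (P.differentiable_form i) (P.form_ne_zero i) r).toFinset with hS
    have hSr : ∀ a ∈ S, ‖a‖ ≤ r := by
      intro a ha
      simp only [hS, Finset.mem_union, Set.Finite.mem_toFinset, Set.mem_ofPred_eq,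
        Finset.mem_biUnion, Finset.mem_univ, true_and] at ha
      rcases ha with (h | h) | ⟨i, h⟩ <;> exact h.1
    have hSg : ∀ a, ‖a‖ ≤ r → P.g a = 0 → a ∈ S := fun a h1 h2 => by
      simp only [hS, Finset.mem_union, Set.Finite.mem_toFinset, Set.mem_ofPred_eq]
      exact Or.inl (Or.inl ⟨h1, h2⟩)
    have hSΔ : ∀ a, ‖a‖ ≤ r → P.wronskian a = 0 → a ∈ S := fun a h1 h2 => by
      simp only [hS, Finset.mem_union, Set.Finite.mem_toFinset, Set.mem_ofPred_eq]
      exact Or.inl (Or.inr ⟨h1, h2⟩)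
    have hSh : ∀ i a, ‖a‖ ≤ r → P.form i a = 0 → a ∈ S := fun i a h1 h2 => by
      simp only [hS, Finset.mem_union, Set.Finite.mem_toFinset, Set.mem_ofPred_eq,
        Finset.mem_biUnion, Finset.mem_univ, true_and]
      exact Or.inr ⟨i, h1, h2⟩
    have h1 := hC r hr0
    rw [hcg r hr0 S hSr hSg, hcΔ r hr0 S hSr hSΔ] at h1
    simp only [fun i => hch i r hr0 S hSr (hSh i)] at h1
    have hloc : ∑ a ∈ S, (∑ i, ω i * ((analyticOrderNatAt (P.form i) a - (k + 1) * (n - k) : ℕ) : ℝ) +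
        d * (analyticOrderNatAt P.g a : ℝ)) * countingWeight r a ≤
        ∑ a ∈ S, (analyticOrderNatAt P.wronskian a : ℝ) * countingWeight r a :=
      Finset.sum_le_sum fun a ha => mul_le_mul_of_nonneg_right (hω.sum_mul_order_le hk.le a)
        (countingWeight_nonneg hr (hSr a ha))
    have hsplit : ∑ a ∈ S, (∑ i, ω i *
        ((analyticOrderNatAt (P.form i) a - (k + 1) * (n - k) : ℕ) : ℝ) +
        d * (analyticOrderNatAt P.g a : ℝ)) * countingWeight r a =
        ∑ i, ω i * ∑ a ∈ S, (analyticOrderNatAt (P.form i) a : ℝ) * countingWeight r a -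
        ∑ i, ω i * ∑ a ∈ S, ((min ((k + 1) * (n - k)) (analyticOrderNatAt (P.form i) a) : ℕ) : ℝ) *
          countingWeight r a +
        d * ∑ a ∈ S, (analyticOrderNatAt P.g a : ℝ) * countingWeight r a := by
      rw [← Finset.sum_sub_distrib]
      simp only [← mul_sub, ← Finset.sum_sub_distrib, ← sub_mul, Finset.mul_sum]
      rw [Finset.sum_comm, ← Finset.sum_add_distrib]
      refine Finset.sum_congr rfl fun a _ => ?_
      rw [add_mul, Finset.sum_mul]
      congr 1
      · refine Finset.sum_congr rfl fun i _ => ?_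
        have : ((analyticOrderNatAt (P.form i) a - (k + 1) * (n - k) : ℕ) : ℝ) =
            (analyticOrderNatAt (P.form i) a : ℝ) -
            ((min ((k + 1) * (n - k)) (analyticOrderNatAt (P.form i) a) : ℕ) : ℝ) := by
          rw [eq_sub_iff_add_eq]
          norm_cast
          omega
        rw [this]
        ring
      · ring
    -- The bound `ω i ≤ Θ` is used only here; after division by `Θ` each truncated counting function
    -- appears with coefficient one.
    have hN : ∑ i, ω i * ∑ a ∈ S,
        ((min ((k + 1) * (n - k)) (analyticOrderNatAt (P.form i) a) : ℕ) : ℝ) *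
          countingWeight r a ≤
        Θ * ∑ i, DerivedCurve.countingFunction ((k + 1) * (n - k)) (P.form i) r +
          ∑ i, ω i * cN i := by
      rw [Finset.mul_sum, ← Finset.sum_add_distrib]
      refine Finset.sum_le_sum fun i _ => ?_
      have h2 := mul_le_mul_of_nonneg_left (hcN i r hr S hSr (hSh i)) (hω.nonneg i)
      have h3 := mul_le_mul_of_nonneg_right (hω.le i)
        (countingFunction_nonneg (m := (k + 1) * (n - k)) (h := P.form i) hr)
      linarith
    have hch' : ∑ i, ω i * (∑ a ∈ S, (analyticOrderNatAt (P.form i) a : ℝ) * countingWeight r a +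
        ch i) = ∑ i, ω i * ∑ a ∈ S, (analyticOrderNatAt (P.form i) a : ℝ) * countingWeight r a +
        ∑ i, ω i * ch i := by
      rw [← Finset.sum_add_distrib]
      exact Finset.sum_congr rfl fun i _ => mul_add _ _ _
    have hc₀' : c₀ = ∑ i, ω i * cN i + ∑ i, ω i * ch i + d * cg - cΔ + C := by
      rw [hc₀, ← Finset.sum_add_distrib]
      simp only [mul_add]
    -- The total weight minus `d` is `Θ (q - 2 D + d)`, which yields the coefficient of the order
    -- function.
    rw [hω.sum_eq, add_sub_cancel_right, hch'] at h1
    have h4 : Θ * (((q : ℝ) - (2 * D - d)) * circleAverage P.logNorm 0 r) ≤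
        Θ * ∑ i, DerivedCurve.countingFunction ((k + 1) * (n - k)) (P.form i) r +
        (∑ B ∈ P.bases, proximity (fun z => P.wronskian z / ∏ i ∈ B, P.formWronskian i z) ⊤ r +
          c₀) := by
      rw [hc₀']
      linarith
    have h5 := mul_le_mul_of_nonneg_left h4 (inv_nonneg.2 hω.pos.le)
    rw [mul_add, inv_mul_cancel_left₀ hω.pos.ne', inv_mul_cancel_left₀ hω.pos.ne'] at h5
    exact h5

end PluckerSystem
end SecondMainEstimate

/-! ### Growth of the derived curve and of quotients of its coordinates. -/

section Growth
open Filter Topology Finset ValueDistribution Real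
open scoped Matrix

/-- Poles of the quotient are zeros of `H`, counted by the average of `log ‖H‖`. The same average
occurs with the opposite sign in the bound for the proximity function, and the two cancel. -/
theorem exists_characteristic_div_le {K H : ℂ → ℂ} (hK : Differentiable ℂ K)
    (hH : Differentiable ℂ H) (hK0 : K ≠ 0) (hH0 : H ≠ 0) {u : ℂ → ℝ} (hu : Continuous u)
    {C : ℝ} (hKu : ∀ z, K z ≠ 0 → Real.log ‖K z‖ ≤ u z + C)
    (hHu : ∀ z, H z ≠ 0 → Real.log ‖H z‖ ≤ u z + C) :
    ∃ c : ℝ, ∀ r : ℝ, 1 ≤ r →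
      characteristic (fun z => K z / H z) ⊤ r ≤ circleAverage u 0 r + c := by
  refine ⟨C - Real.log ‖meromorphicTrailingCoeffAt H 0‖, fun r hr => ?_⟩
  have hr0 : r ≠ 0 := by linarith
  have hmer : Meromorphic fun z => K z / H z := fun z =>
    (hK.analyticAt z).meromorphicAt.div (hH.analyticAt z).meromorphicAt
  have hiu : CircleIntegrable u 0 r := hu.continuousOn.circleIntegrable'
  have hiH := circleIntegrable_log_norm_entire hH r
  have huC : CircleIntegrable (fun z => u z + C) 0 r := hiu.add (circleIntegrable_const C 0 r)
  have hprox : proximity (fun z => K z / H z) ⊤ r ≤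
      circleAverage u 0 r + C - circleAverage (fun z => Real.log ‖H z‖) 0 r := by
    rw [proximity_top]
    have h1 := circleAverage_mono_codiscreteWithin (c := 0) (R := r)
      (u := fun z => Real.posLog ‖K z / H z‖)
      (v := fun z => (u z + C) - Real.log ‖H z‖) hr0
      (MeromorphicOn.circleIntegrable_posLog_norm fun z _ => hmer z) (huC.sub hiH) ?_
    · rw [circleAverage_fun_sub huC hiH, circleAverage_fun_add hiu (circleIntegrable_const C 0 r),
        circleAverage_const] at h1
      exact h1
    · have h2 : ∀ᶠ z in codiscrete ℂ, K z ≠ 0 ∧ H z ≠ 0 :=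
        (eventually_codiscrete_ne_zero hK hK0).and (eventually_codiscrete_ne_zero hH hH0)
      have h3 : ∀ᶠ z in codiscreteWithin (Metric.sphere (0 : ℂ) |r|), K z ≠ 0 ∧ H z ≠ 0 :=
        codiscreteWithin_mono (Set.subset_univ _) h2
      refine h3.mono ?_
      rintro z ⟨hKz, hHz⟩
      have h4 := hKu z hKz
      have h5 := hHu z hHz
      simp only [Real.posLog_apply]
      rw [norm_div, Real.log_div (norm_ne_zero_iff.2 hKz) (norm_ne_zero_iff.2 hHz)]
      exact max_le (by linarith) (by linarith)
  have hcount : logCounting (fun z => K z / H z) ⊤ r ≤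
      circleAverage (fun z => Real.log ‖H z‖) 0 r - Real.log ‖meromorphicTrailingCoeffAt H 0‖ := by
    rw [← Function.locallyFinsuppWithin.logCounting_divisor_eq_circleAverage_sub_const
      (meromorphic_of_entire hH) hr0, logCounting_top]
    refine Function.locallyFinsuppWithin.logCounting_le (fun a => ?_) hr
    rw [divisor_entire_apply hH, Function.locallyFinsuppWithin.negPart_apply,
      MeromorphicOn.divisor_apply (fun z _ => hmer z) (Set.mem_univ a)]
    have h1 : meromorphicOrderAt (fun z => K z / H z) a =
        ((analyticOrderNatAt K a : ℤ) - (analyticOrderNatAt H a : ℤ) : ℤ) := by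
      have h2 : (fun z => K z / H z) = K * H⁻¹ := by
        funext z; simp [div_eq_mul_inv]
      rw [h2, meromorphicOrderAt_mul (hK.analyticAt a).meromorphicAt
        (hH.analyticAt a).meromorphicAt.inv, meromorphicOrderAt_inv,
        (hK.analyticAt a).meromorphicOrderAt_eq, (hH.analyticAt a).meromorphicOrderAt_eq,
        ← natCast_analyticOrderNatAt_of_entire hK hK0, ← natCast_analyticOrderNatAt_of_entire hH hH0]
      rw [sub_eq_add_neg]
      rfl
    rw [h1, WithTop.untop₀_coe, negPart_def]
    have h3 : -((analyticOrderNatAt K a : ℤ) - analyticOrderNatAt H a) ≤ analyticOrderNatAt H a := by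
      omega
    have h4 : (0 : ℤ) ≤ analyticOrderNatAt H a := by omega
    exact sup_le h3 h4
  change proximity _ ⊤ r + logCounting _ ⊤ r ≤ _
  linarith

/-- By Jensen's formula a single zero already contributes `log r`, up to a constant. -/
theorem exists_log_le_circleAverage {K : ℂ → ℂ} (hK : Differentiable ℂ K) (hK0 : K ≠ 0) {z₀ : ℂ}
    (hz₀ : K z₀ = 0) {u : ℂ → ℝ} (hu : Continuous u) {C : ℝ}
    (hKu : ∀ z, K z ≠ 0 → Real.log ‖K z‖ ≤ u z + C) :
    ∃ (c R : ℝ), ∀ r : ℝ, R ≤ r → Real.log r ≤ circleAverage u 0 r + c := by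
  obtain ⟨c, hc⟩ := exists_circleAverage_log_norm_eq hK hK0
  refine ⟨C - c + Real.log (max 1 ‖z₀‖), max 1 ‖z₀‖, fun r hr => ?_⟩
  have hr1 : 1 ≤ r := (le_max_left _ _).trans hr
  have hr0 : 0 < r := by linarith
  have hz₀r : ‖z₀‖ ≤ r := (le_max_right _ _).trans hr
  set S := (finite_zeros_closedBall hK hK0 r).toFinset with hS
  have h1 := hc r hr0 S (fun a ha => ((Set.Finite.mem_toFinset _).1 ha).1)
    (fun a h1 h2 => (Set.Finite.mem_toFinset _).2 ⟨h1, h2⟩)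
  have hiu : CircleIntegrable u 0 r := hu.continuousOn.circleIntegrable'
  have huC : CircleIntegrable (fun z => u z + C) 0 r := hiu.add (circleIntegrable_const C 0 r)
  have h2 : circleAverage (fun z => Real.log ‖K z‖) 0 r ≤ circleAverage u 0 r + C := by
    have h3 := circleAverage_mono_codiscreteWithin (c := 0) (R := r)
      (u := fun z => Real.log ‖K z‖) (v := fun z => u z + C) hr0.ne'
      (circleIntegrable_log_norm_entire hK r) huC
      (Eventually.mono (codiscreteWithin_mono (Set.subset_univ _)
        (eventually_codiscrete_ne_zero hK hK0)) hKu)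
    rwa [circleAverage_fun_add hiu (circleIntegrable_const C 0 r), circleAverage_const] at h3
  have h3 : countingWeight r z₀ ≤
      ∑ a ∈ S, (analyticOrderNatAt K a : ℝ) * countingWeight r a := by
    have h4 : (analyticOrderNatAt K z₀ : ℝ) * countingWeight r z₀ ≤
        ∑ a ∈ S, (analyticOrderNatAt K a : ℝ) * countingWeight r a :=
      Finset.single_le_sum (f := fun a => (analyticOrderNatAt K a : ℝ) * countingWeight r a)
        (fun a ha => mul_nonneg (Nat.cast_nonneg _)
          (countingWeight_nonneg hr1 ((Set.Finite.mem_toFinset _).1 ha).1))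
        ((Set.Finite.mem_toFinset _).2 ⟨hz₀r, hz₀⟩)
    refine le_trans ?_ h4
    have h5 : (1 : ℝ) ≤ analyticOrderNatAt K z₀ := by
      exact_mod_cast Nat.one_le_iff_ne_zero.2 ((analyticOrderNatAt_ne_zero_iff hK hK0 z₀).2 hz₀)
    exact le_mul_of_one_le_left (countingWeight_nonneg hr1 hz₀r) h5
  have h6 : Real.log r - Real.log (max 1 ‖z₀‖) ≤ countingWeight r z₀ := by
    rw [countingWeight]
    split_ifs with h
    · have := Real.log_nonneg (le_max_left 1 ‖z₀‖)
      linarith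
    · rw [Real.log_mul hr0.ne' (inv_ne_zero (norm_ne_zero_iff.2 h)), Real.log_inv]
      have := Real.log_le_log (norm_pos_iff.2 h) (le_max_right 1 ‖z₀‖)
      linarith
  linarith

namespace PluckerSystem
variable {n k q D : ℕ} (P : PluckerSystem n k q D)

/-- The coordinate of the reduced representation attached to a sequence of indices. -/
noncomputable def coordinate (τ : Fin (k + 1) → Fin (n + 1)) (z : ℂ) : ℂ :=
  ∑ I, P.H I z * (((1 : Matrix (Fin (n + 1)) (Fin (n + 1)) ℂ).submatrix τ id).submatrix id
    (subsetEnum I)).det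

theorem differentiable_coordinate (τ : Fin (k + 1) → Fin (n + 1)) :
    Differentiable ℂ (P.coordinate τ) :=
  Differentiable.fun_sum fun I _ => (P.differentiable_H I).mul_const _

theorem entireWronskian_eq_coordinate (τ : Fin (k + 1) → Fin (n + 1)) :
    entireWronskian (fun s => P.f (τ s)) = P.g * P.coordinate τ := by
  funext z
  have h1 := entireWronskian_combination P.differentiable_f
    ((1 : Matrix (Fin (n + 1)) (Fin (n + 1)) ℂ).submatrix τ id) z
  have h2 : (fun s z => ∑ i, (1 : Matrix (Fin (n + 1)) (Fin (n + 1)) ℂ).submatrix τ id s i *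
      P.f i z) = fun s => P.f (τ s) := by
    funext s z
    simp [Matrix.one_apply]
  rw [h2] at h1
  rw [h1, Pi.mul_apply, coordinate, Finset.mul_sum]
  exact Finset.sum_congr rfl fun I _ => by rw [P.wronskian_eq, mul_assoc]

theorem exists_log_norm_combination_le (c : Set.powersetCard (Fin (n + 1)) (k + 1) → ℂ) :
    ∃ C : ℝ, ∀ z, ∑ I, P.H I z * c I ≠ 0 →
      Real.log ‖∑ I, P.H I z * c I‖ ≤ P.logNorm z + C := by
  refine ⟨Real.log (1 + ∑ I, ‖c I‖), fun z hz => ?_⟩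
  have hx0 : 0 < ‖fun I => P.H I z‖ := norm_pos_iff.2 (P.H_ne_zero z)
  have hc : 0 < 1 + ∑ I, ‖c I‖ := by positivity
  rw [logNorm, ← Real.log_mul hx0.ne' hc.ne']
  refine Real.log_le_log (norm_pos_iff.2 hz) ?_
  calc ‖∑ I, P.H I z * c I‖ ≤ ∑ I, ‖fun I => P.H I z‖ * ‖c I‖ := by
        refine (norm_sum_le _ _).trans (Finset.sum_le_sum fun I _ => ?_)
        rw [norm_mul]
        exact mul_le_mul_of_nonneg_right (norm_le_pi_norm (fun I => P.H I z) I) (norm_nonneg _)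
    _ ≤ _ := by
      rw [← Finset.mul_sum]
      gcongr
      linarith

theorem exists_wronskian_ne_zero (hk : k ≤ n) : ∃ I : Fin (k + 1) → Fin (n + 1),
    entireWronskian (fun s => P.f (I s)) ≠ 0 :=
  ⟨Fin.castLE (Nat.succ_le_succ hk), entireWronskian_ne_zero (fun _ => P.differentiable_f _)
    (P.linearIndependent_f.comp _ (Fin.castLE_injective _))⟩

theorem coordinate_ne_zero {τ : Fin (k + 1) → Fin (n + 1)}
    (h : entireWronskian (fun s => P.f (τ s)) ≠ 0) : P.coordinate τ ≠ 0 := by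
  intro h0
  rw [entireWronskian_eq_coordinate, h0, mul_zero] at h
  exact h rfl

theorem entireGerm_wronskian_div (τ I : Fin (k + 1) → Fin (n + 1)) :
    entireGerm ⟨entireWronskian fun s => P.f (τ s),
        differentiable_entireWronskian fun _ => P.differentiable_f _⟩ /
      entireGerm ⟨entireWronskian fun s => P.f (I s),
        differentiable_entireWronskian fun _ => P.differentiable_f _⟩ =
    ((meromorphic_of_entire (P.differentiable_coordinate τ)).div
      (meromorphic_of_entire (P.differentiable_coordinate I))).germ := by
  have h1 : ∀ τ : Fin (k + 1) → Fin (n + 1), entireGerm ⟨entireWronskian fun s => P.f (τ s),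
      differentiable_entireWronskian fun _ => P.differentiable_f _⟩ =
      entireGerm ⟨P.g, P.differentiable_g⟩ *
        entireGerm ⟨P.coordinate τ, P.differentiable_coordinate τ⟩ := fun τ => by
    rw [← map_mul]
    congr 1
    exact Subtype.ext (P.entireWronskian_eq_coordinate τ)
  rw [h1, h1, mul_div_mul_left _ _ (entireGerm_ne_zero P.differentiable_g P.g_ne_zero),
    entireGerm_mk, entireGerm_mk, MerField.germ_div]

/-- For `k < n` some quotient of two coordinates is not constant. Subtracting its value at a point
yields a nonzero combination of the coordinates with a zero there, and `exists_log_le_circleAverage`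
applies. -/
theorem exists_log_le (hk : k < n) : ∃ (c R : ℝ), ∀ r : ℝ, R ≤ r →
    Real.log r ≤ circleAverage P.logNorm 0 r + c := by
  obtain ⟨I, hI⟩ := P.exists_wronskian_ne_zero hk.le
  set φ : Fin (n + 1) → MerField := fun i => entireGerm ⟨P.f i, P.differentiable_f i⟩ with hφ
  have hW0 : wronskianDet MerField.derivation φ ≠ 0 := by
    rw [wronskianDet_entireGerm P.f P.differentiable_f]
    exact entireGerm_ne_zero _ (entireWronskian_ne_zero P.differentiable_f P.linearIndependent_f)
  have hWτ : ∀ τ : Fin (k + 1) → Fin (n + 1), wronskianDet MerField.derivation (φ ∘ τ) =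
      entireGerm ⟨entireWronskian fun s => P.f (τ s),
        differentiable_entireWronskian fun _ => P.differentiable_f _⟩ :=
    fun τ => wronskianDet_entireGerm (fun s => P.f (τ s)) fun s => P.differentiable_f _
  obtain ⟨τ, hτ⟩ := exists_derivation_ratio_ne_zero hk φ hW0 I
    (by rw [hWτ]; exact entireGerm_ne_zero _ hI)
  rw [hWτ, hWτ, entireGerm_wronskian_div] at hτ
  obtain ⟨z₀, hz₀⟩ := Function.ne_iff.1 (P.coordinate_ne_zero hI)
  set b := P.coordinate τ z₀ / P.coordinate I z₀ with hb
  set K : ℂ → ℂ := fun z => P.coordinate τ z - b * P.coordinate I z with hK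
  have hKd : Differentiable ℂ K :=
    (P.differentiable_coordinate τ).sub ((P.differentiable_coordinate I).const_mul b)
  have hKz : K z₀ = 0 := by
    simp only [hK, hb]
    rw [div_mul_cancel₀ _ hz₀, sub_self]
  have hK0 : K ≠ 0 := by
    intro h0
    apply hτ
    have h1 : ((meromorphic_of_entire (P.differentiable_coordinate τ)).div
        (meromorphic_of_entire (P.differentiable_coordinate I))).germ = MerField.const b := by
      refine (MerField.germ_eq_iff _ (Meromorphic.const b)).2 ?_
      filter_upwards [eventually_codiscrete_ne_zero (P.differentiable_coordinate I)
        (P.coordinate_ne_zero hI)] with z hz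
      have := congrFun h0 z
      simp only [hK, Pi.zero_apply, sub_eq_zero] at this
      rw [Pi.div_apply, this, mul_div_assoc, div_self hz, mul_one]
    rw [h1, MerField.derivation_const]
  have hKsum : ∀ z, K z = ∑ J, P.H J z *
      ((((1 : Matrix (Fin (n + 1)) (Fin (n + 1)) ℂ).submatrix τ id).submatrix id
        (subsetEnum J)).det - b * (((1 : Matrix (Fin (n + 1)) (Fin (n + 1)) ℂ).submatrix I
        id).submatrix id (subsetEnum J)).det) := fun z => by
    simp only [hK, coordinate, Finset.mul_sum, ← Finset.sum_sub_distrib]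
    exact Finset.sum_congr rfl fun J _ => by ring
  obtain ⟨C, hC⟩ := P.exists_log_norm_combination_le fun J =>
      (((1 : Matrix (Fin (n + 1)) (Fin (n + 1)) ℂ).submatrix τ id).submatrix id
        (subsetEnum J)).det - b * (((1 : Matrix (Fin (n + 1)) (Fin (n + 1)) ℂ).submatrix I
        id).submatrix id (subsetEnum J)).det
  exact exists_log_le_circleAverage hKd hK0 hKz P.continuous_logNorm (C := C) fun z hz => by
    rw [hKsum] at hz ⊢
    exact hC z hz

theorem ratio_mem_controlled {s : GrowthScale} (hs : s.IsBounded (circleAverage P.logNorm 0))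
    (τ I : Fin (k + 1) → Fin (n + 1)) (hI : entireWronskian (fun s => P.f (I s)) ≠ 0) :
    entireGerm ⟨entireWronskian fun s => P.f (τ s),
        differentiable_entireWronskian fun _ => P.differentiable_f _⟩ /
      entireGerm ⟨entireWronskian fun s => P.f (I s),
        differentiable_entireWronskian fun _ => P.differentiable_f _⟩ ∈ s.controlled := by
  by_cases hτ : entireWronskian (fun s => P.f (τ s)) = 0
  · have h1 : (⟨entireWronskian fun s => P.f (τ s),
        differentiable_entireWronskian fun _ => P.differentiable_f _⟩ : entireRing) = 0 :=
      Subtype.ext hτ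
    rw [h1, map_zero, zero_div]
    exact s.controlled.zero_mem
  rw [entireGerm_wronskian_div, GrowthScale.germ_mem_controlled_iff]
  obtain ⟨C₁, hC₁⟩ := P.exists_log_norm_combination_le fun J =>
    (((1 : Matrix (Fin (n + 1)) (Fin (n + 1)) ℂ).submatrix τ id).submatrix id (subsetEnum J)).det
  obtain ⟨C₂, hC₂⟩ := P.exists_log_norm_combination_le fun J =>
    (((1 : Matrix (Fin (n + 1)) (Fin (n + 1)) ℂ).submatrix I id).submatrix id (subsetEnum J)).det
  obtain ⟨c, hc⟩ := exists_characteristic_div_le (P.differentiable_coordinate τ)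
    (P.differentiable_coordinate I) (P.coordinate_ne_zero hτ) (P.coordinate_ne_zero hI)
    P.continuous_logNorm (C := max C₁ C₂)
    (fun z hz => (hC₁ z hz).trans (by linarith [le_max_left C₁ C₂]))
    (fun z hz => (hC₂ z hz).trans (by linarith [le_max_right C₁ C₂]))
  refine (hs.add (GrowthScale.isBounded_const c)).mono ?_
  filter_upwards [GrowthScale.eventually_ge (s := s) 1] with r hr
  exact hc r hr

/-- The second main estimate for a scale that dominates the order function. -/
theorem exists_secondMainEstimate_of_isBounded {s : GrowthScale} (hk : k < n)
    (hs : s.IsBounded (circleAverage P.logNorm 0)) :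
    ∃ φ : ℝ → ℝ, s.IsSmall φ ∧ ∀ r : ℝ, 1 ≤ r →
      ((q : ℝ) - (2 * D - Fintype.card (Set.powersetCard (Fin (n + 1)) (k + 1)))) *
          circleAverage P.logNorm 0 r ≤
        ∑ i, DerivedCurve.countingFunction ((k + 1) * (n - k)) (P.form i) r + φ r := by
  obtain ⟨I, hI⟩ := P.exists_wronskian_ne_zero hk.le
  exact P.exists_secondMainEstimate hk I hI fun τ => P.ratio_mem_controlled hs τ I hI

end PluckerSystem
end Growth

/-! ### Reduction to the linear span of the curve. -/

section Reduction
open Filter Topology Finset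
open scoped Matrix LinearAlgebra.Projectivization
open DerivedCurve

/-- Near each point the factor is a quotient of values of one linear functional that does not vanish
there, hence it is holomorphic. -/
theorem DerivedCurve.IsReducedRep.exists_smul_eq {W : Type*} [AddCommGroup W] [Module ℂ W]
    {F : ℂ → ℙ ℂ W} {G₀ G : ℂ → W} (h₀ : IsReducedRep F G₀) (h : IsReducedRep F G) :
    ∃ u : ℂ → ℂ, Differentiable ℂ u ∧ (∀ z, u z ≠ 0) ∧ ∀ z, G₀ z = u z • G z := by
  have h1 : ∀ z, ∃ a : ℂ, a • G z = G₀ z := fun z => by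
    obtain ⟨h2, h3⟩ := h₀.2 z
    obtain ⟨h4, h5⟩ := h.2 z
    exact (Projectivization.mk_eq_mk_iff' ℂ _ _ h2 h4).1 (h3.symm.trans h5)
  choose u hu using h1
  refine ⟨u, fun z₀ => ?_, fun z hz => ?_, fun z => (hu z).symm⟩
  · obtain ⟨φ, hφ⟩ : ∃ φ : Module.Dual ℂ W, φ (G z₀) ≠ 0 := by
      by_contra! hall
      exact (h.2 z₀).choose ((Module.forall_dual_apply_eq_zero_iff ℂ _).1 hall)
    have hd := h.1 φ
    have hev : u =ᶠ[𝓝 z₀] fun z => φ (G₀ z) / φ (G z) := by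
      filter_upwards [hd.continuous.continuousAt.eventually_ne hφ] with z hz
      rw [← hu z, map_smul, smul_eq_mul, mul_div_assoc, div_self hz, mul_one]
    exact ((h₀.1 φ z₀).div (hd z₀) hφ).congr_of_eventuallyEq hev
  · have := hu z
    rw [hz, zero_smul] at this
    exact (h₀.2 z).choose this.symm

theorem DerivedCurve.IsDerivedCurve.exists_factor {N k : ℕ} {f : ℂ → ℙ ℂ (Fin (N + 1) → ℂ)}
    {F : ℂ → ℙ ℂ (KVec N k)} (hF : IsDerivedCurve k f F) {G : ℂ → KVec N k}
    (hG : IsReducedRep F G) :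
    ∃ (Ft : ℂ → Fin (N + 1) → ℂ) (g : ℂ → ℂ), IsReducedRep f Ft ∧ Differentiable ℂ g ∧ g ≠ 0 ∧
      ∀ z, wronskianLift k Ft z = g z • G z := by
  obtain ⟨Ft, g, G₀, hFt, hg, ⟨z₀, hz₀⟩, hG₀, h⟩ := hF
  obtain ⟨u, hu, hu0, huG⟩ := hG₀.exists_smul_eq hG
  refine ⟨Ft, g * u, hFt, hg.mul hu, Function.ne_iff.2 ⟨z₀, mul_ne_zero hz₀ (hu0 z₀)⟩, fun z => ?_⟩
  rw [h, huG, smul_smul]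
  rfl

theorem iteratedDeriv_sum_smul {m : ℕ} {W : Type*} [NormedAddCommGroup W] [NormedSpace ℂ W]
    {f : Fin m → ℂ → ℂ} (hf : ∀ j, Differentiable ℂ (f j)) (b : Fin m → W) (l : ℕ) (z : ℂ) :
    iteratedDeriv l (fun z => ∑ j, f j z • b j) z = ∑ j, iteratedDeriv l (f j) z • b j := by
  induction l generalizing z with
  | zero => simp
  | succ l ih =>
    rw [iteratedDeriv_succ, show iteratedDeriv l (fun z => ∑ j, f j z • b j) =
      fun z => ∑ j, iteratedDeriv l (f j) z • b j from funext ih]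
    have h1 : HasDerivAt (fun z => ∑ j, iteratedDeriv l (f j) z • b j)
        (∑ j, iteratedDeriv (l + 1) (f j) z • b j) z := by
      refine HasDerivAt.fun_sum fun j _ => HasDerivAt.smul_const ?_ (b j)
      rw [iteratedDeriv_succ]
      exact ((hf j).iteratedDeriv_complex l z).hasDerivAt
    exact h1.deriv

theorem pluckerBasis_repr_ιMulti {n k : ℕ} (v : Fin (k + 1) → Fin (n + 1) → ℂ)
    (I : Set.powersetCard (Fin (n + 1)) (k + 1)) :
    (pluckerBasis n k).repr (exteriorPower.ιMulti ℂ (k + 1) v) I =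
      (Matrix.of fun l s => v l (subsetEnum I s)).det := by
  rw [pluckerBasis, exteriorPower.basis_repr_apply, exteriorPower.ιMultiDual_apply_ιMulti]
  rfl

theorem pluckerBasis_apply {n k : ℕ} (I : Set.powersetCard (Fin (n + 1)) (k + 1)) :
    pluckerBasis n k I = exteriorPower.ιMulti ℂ (k + 1)
      fun s => (Pi.single (subsetEnum I s) 1 : Fin (n + 1) → ℂ) := by
  rw [pluckerBasis, exteriorPower.basis_apply, exteriorPower.ιMulti_family]
  congr 1
  ext1 s
  exact Pi.basisFun_apply ℂ _ _

/-- Coordinates of a curve in its linear span. -/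
theorem exists_span_coordinates {N n k : ℕ} {f : ℂ → ℙ ℂ (Fin (N + 1) → ℂ)}
    {L : Submodule ℂ (Fin (N + 1) → ℂ)} (hL : IsLinearSpan f L)
    (hn : Module.finrank ℂ L = n + 1) {F : ℂ → ℙ ℂ (KVec N k)} (hF : IsDerivedCurve k f F)
    {G : ℂ → KVec N k} (hG : IsReducedRep F G) :
    ∃ (B : (Fin (n + 1) → ℂ) →ₗ[ℂ] (Fin (N + 1) → ℂ))
      (β : (Fin (N + 1) → ℂ) →ₗ[ℂ] (Fin (n + 1) → ℂ)) (φ : Fin (n + 1) → ℂ → ℂ) (g : ℂ → ℂ),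
      β ∘ₗ B = LinearMap.id ∧ LinearMap.range B = L ∧ (∀ j, Differentiable ℂ (φ j)) ∧
      LinearIndependent ℂ φ ∧ Differentiable ℂ g ∧ g ≠ 0 ∧
      (∀ I z, entireWronskian (fun s => φ (subsetEnum I s)) z =
        g z * (pluckerBasis n k).repr (exteriorPower.map (k + 1) β (G z)) I) ∧
      ∀ z, exteriorPower.map (k + 1) B (exteriorPower.map (k + 1) β (G z)) = G z := by
  obtain ⟨Ft, g, hFt, hg, hg0, hlift⟩ := hF.exists_factor hG
  set b : Module.Basis (Fin (n + 1)) ℂ L := Module.finBasisOfFinrankEq ℂ L hn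
  set B : (Fin (n + 1) → ℂ) →ₗ[ℂ] (Fin (N + 1) → ℂ) :=
    L.subtype ∘ₗ b.equivFun.symm.toLinearMap with hB
  have hBinj : LinearMap.ker B = ⊥ := by
    rw [LinearMap.ker_eq_bot]
    exact L.injective_subtype.comp b.equivFun.symm.injective
  obtain ⟨β, hβ⟩ := B.exists_leftInverse_of_injective hBinj
  have hrange : LinearMap.range B = L := by
    rw [hB, LinearMap.range_comp_of_range_eq_top _ (LinearEquiv.range _), Submodule.range_subtype]
  have hFtL : ∀ M : Submodule ℂ (Fin (N + 1) → ℂ), (∀ z, Ft z ∈ M) ↔ ∀ z, (f z).submodule ≤ M := by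
    intro M
    refine forall_congr' fun z => ?_
    obtain ⟨h0, h1⟩ := hFt.2 z
    rw [h1, Projectivization.submodule_mk, Submodule.span_singleton_le_iff_mem]
  have hFtmem : ∀ z, Ft z ∈ L := (hFtL L).2 hL.1
  have hBβ : ∀ x ∈ L, B (β x) = x := by
    intro x hx
    rw [← hrange] at hx
    obtain ⟨y, rfl⟩ := hx
    rw [← LinearMap.comp_apply β B y, hβ, LinearMap.id_apply]
  set φ : Fin (n + 1) → ℂ → ℂ := fun j z => β (Ft z) j with hφ
  have hφd : ∀ j, Differentiable ℂ (φ j) := fun j => hFt.1 (LinearMap.proj j ∘ₗ β)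
  have hFtsum : Ft = fun z => ∑ j, φ j z • B (Pi.single j 1) := by
    funext z
    rw [← hBβ _ (hFtmem z)]
    simp only [← map_smul, ← map_sum]
    congr 1
    ext i
    simp [hφ, Pi.single_apply]
  have hderiv : ∀ l z, iteratedDeriv l Ft z = B fun j => iteratedDeriv l (φ j) z := by
    intro l z
    rw [hFtsum, iteratedDeriv_sum_smul hφd]
    simp only [← map_smul, ← map_sum]
    congr 1
    ext i
    simp [Pi.single_apply]
  have hβderiv : ∀ l z, β (iteratedDeriv l Ft z) = fun j => iteratedDeriv l (φ j) z := by
    intro l z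
    rw [hderiv, ← LinearMap.comp_apply β B, hβ, LinearMap.id_apply]
  refine ⟨B, β, φ, g, hβ, hrange, hφd, ?_, hg, hg0, fun I z => ?_, fun z => ?_⟩
  · rw [Fintype.linearIndependent_iff]
    intro c hc
    -- A linear relation among the coordinates puts the curve into the subspace `M`. By minimality
    -- `L ≤ M`, and evaluation on the basis of `L` kills all coefficients.
    set M := LinearMap.ker ((∑ j, c j • LinearMap.proj (R := ℂ) (φ := fun _ : Fin (n + 1) => ℂ) j) ∘ₗ β)
      with hM
    have hFtM : ∀ z, Ft z ∈ M := fun z => by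
      have := congrFun hc z
      simpa [hM, hφ] using this
    have hLM : L ≤ M := hL.2 ((hFtL M).1 hFtM)
    intro i
    have h1 : B (Pi.single i 1) ∈ M := hLM (hrange ▸ LinearMap.mem_range_self B _)
    have h2 : β (B (Pi.single i 1)) = Pi.single i 1 := by
      rw [← LinearMap.comp_apply β B, hβ, LinearMap.id_apply]
    rw [hM, LinearMap.mem_ker, LinearMap.comp_apply, h2] at h1
    simpa [Pi.single_apply] using h1
  · rw [← smul_eq_mul, ← Finsupp.smul_apply, ← map_smul, ← map_smul, ← hlift, wronskianLift,
      exteriorPower.map_apply_ιMulti, pluckerBasis_repr_ιMulti, entireWronskian]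
    congr 1
    ext1 l s
    simp only [wronskianMatrix, Matrix.of_apply, Function.comp_apply, hβderiv]
  · rw [← sub_eq_zero, ← Module.forall_dual_apply_eq_zero_iff ℂ]
    intro ψ
    -- The identity is clear for the lifted Wronskian, whose factors lie in `L`. It passes to `G`
    -- wherever `g` does not vanish, and everywhere by continuity.
    set T : KVec N k →ₗ[ℂ] KVec N k :=
      exteriorPower.map (k + 1) B ∘ₗ exteriorPower.map (k + 1) β - LinearMap.id with hT
    have h1 : Differentiable ℂ fun z => ψ (T (G z)) := hG.1 (ψ ∘ₗ T)
    have h2 : (fun z => ψ (T (G z))) = 0 := by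
      refine eq_zero_of_eventually_codiscrete h1.continuous ?_
      filter_upwards [eventually_codiscrete_ne_zero hg hg0] with z hz
      have h3 : T (wronskianLift k Ft z) = 0 := by
        rw [hT, LinearMap.sub_apply, LinearMap.comp_apply, wronskianLift,
          exteriorPower.map_apply_ιMulti, exteriorPower.map_apply_ιMulti, LinearMap.id_apply,
          sub_eq_zero]
        congr 1
        ext1 l
        simp only [Function.comp_apply, hβderiv]
        rw [hderiv]
      rw [hlift, map_smul, smul_eq_zero] at h3
      rw [h3.resolve_left hz, map_zero]
      rfl
    exact congrFun h2 z

end Reduction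

/-! ### Comparison and growth of order functions. -/

section OrderFunctions
open Filter Topology Finset Real
open scoped Matrix LinearAlgebra.Projectivization
open DerivedCurve

theorem norm_coordinates_pos {ι W : Type*} [Fintype ι] [AddCommGroup W] [Module ℂ W]
    (b : Module.Basis ι ℂ W) {x : W} (hx : x ≠ 0) : 0 < ‖(fun i => b.repr x i : ι → ℂ)‖ :=
  norm_pos_iff.2 fun h => hx <| b.repr.map_eq_zero_iff.1 <| Finsupp.ext fun i => congrFun h i

theorem exists_log_norm_coordinates_map_le {ι ι' W W' : Type*} [Fintype ι] [Fintype ι']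
    [AddCommGroup W] [Module ℂ W] [AddCommGroup W'] [Module ℂ W'] (b : Module.Basis ι ℂ W)
    (b' : Module.Basis ι' ℂ W') (u : W →ₗ[ℂ] W') : ∃ c : ℝ, ∀ x, u x ≠ 0 →
      log ‖(fun i => b'.repr (u x) i : ι' → ℂ)‖ ≤ log ‖(fun i => b.repr x i : ι → ℂ)‖ + c := by
  set v : (ι → ℂ) →L[ℂ] (ι' → ℂ) := LinearMap.toContinuousLinearMap
    (b'.equivFun.toLinearMap ∘ₗ u ∘ₗ b.equivFun.symm.toLinearMap) with hv
  refine ⟨log (‖v‖ + 1), fun x hx => ?_⟩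
  have hx0 : x ≠ 0 := fun h => hx (by rw [h, map_zero])
  have h1 : (fun i => b'.repr (u x) i : ι' → ℂ) = v (fun i => b.repr x i : ι → ℂ) := by
    have h2 : (fun i => b.repr x i : ι → ℂ) = b.equivFun x := rfl
    rw [hv, h2]
    simp only [LinearMap.coe_toContinuousLinearMap', LinearMap.comp_apply,
      LinearEquiv.coe_coe, LinearEquiv.symm_apply_apply]
    rfl
  have h3 := norm_coordinates_pos b' hx
  have h4 := norm_coordinates_pos b hx0
  rw [← log_mul h4.ne' (by positivity)]
  refine log_le_log h3 ?_
  rw [h1, mul_comm]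
  refine (v.le_opNorm _).trans ?_
  gcongr
  linarith

theorem continuous_log_norm_coordinates {ι W : Type*} [Fintype ι] [AddCommGroup W] [Module ℂ W]
    (b : Module.Basis ι ℂ W) {G : ℂ → W}
    (hd : ∀ φ : Module.Dual ℂ W, Differentiable ℂ fun z => φ (G z)) (h0 : ∀ z, G z ≠ 0) :
    Continuous fun z => log ‖(fun i => b.repr (G z) i : ι → ℂ)‖ := by
  refine Continuous.log ?_ fun z => (norm_coordinates_pos b (h0 z)).ne'
  exact (continuous_pi fun i => (hd (b.coord i)).continuous).norm

theorem exists_orderFunction_map_le {ι ι' W W' : Type*} [Fintype ι] [Fintype ι']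
    [AddCommGroup W] [Module ℂ W] [AddCommGroup W'] [Module ℂ W'] (b : Module.Basis ι ℂ W)
    (b' : Module.Basis ι' ℂ W') (u : W →ₗ[ℂ] W') {G : ℂ → W}
    (hd : ∀ φ : Module.Dual ℂ W, Differentiable ℂ fun z => φ (G z)) (h0 : ∀ z, u (G z) ≠ 0) :
    ∃ c : ℝ, ∀ r, orderFunction b' (fun z => u (G z)) r ≤ orderFunction b G r + c := by
  obtain ⟨c, hc⟩ := exists_log_norm_coordinates_map_le b b' u
  refine ⟨c, fun r => ?_⟩
  have h1 := continuous_log_norm_coordinates b hd fun z h => h0 z (by rw [h, map_zero])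
  have h2 := continuous_log_norm_coordinates b' (fun φ => hd (φ ∘ₗ u)) h0
  have h3 := h1.continuousOn.circleIntegrable' (c := 0) (R := r)
  have h4 := h2.continuousOn.circleIntegrable' (c := 0) (R := r)
  have h5 : CircleIntegrable (fun _ : ℂ => c) 0 r := circleIntegrable_const _ _ _
  calc orderFunction b' (fun z => u (G z)) r
      ≤ circleAverage (fun z => log ‖(fun i => b.repr (G z) i : ι → ℂ)‖ + c) 0 r :=
        circleAverage_mono h4 (h3.add h5) fun z _ => hc _ (h0 z)
    _ = _ := by
      rw [circleAverage_fun_add h3 h5, circleAverage_const]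
      rfl

/-- Jensen's formula for one coordinate that is not identically zero bounds the order function from
below for `r ≥ 1`. -/
theorem exists_le_orderFunction {ι W : Type*} [Fintype ι] [AddCommGroup W] [Module ℂ W]
    (b : Module.Basis ι ℂ W) {G : ℂ → W}
    (hd : ∀ φ : Module.Dual ℂ W, Differentiable ℂ fun z => φ (G z)) (h0 : ∀ z, G z ≠ 0) :
    ∃ c : ℝ, ∀ r, 1 ≤ r → c ≤ orderFunction b G r := by
  obtain ⟨i, hi⟩ : ∃ i, b.repr (G 0) i ≠ 0 := by
    by_contra! h
    exact h0 0 (b.repr.map_eq_zero_iff.1 (Finsupp.ext h))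
  have hd1 : Differentiable ℂ fun z => b.repr (G z) i := hd (b.coord i)
  have hne : (fun z => b.repr (G z) i) ≠ 0 := Function.ne_iff.2 ⟨0, hi⟩
  obtain ⟨c, hc⟩ := exists_circleAverage_log_norm_eq hd1 hne
  refine ⟨c, fun r hr => ?_⟩
  have hfin := finite_zeros_closedBall hd1 hne r
  have h1 := hc r (by linarith) hfin.toFinset (fun a ha => (hfin.mem_toFinset.1 ha).1)
    fun a ha ha' => hfin.mem_toFinset.2 ⟨ha, ha'⟩
  have h2 : 0 ≤ ∑ a ∈ hfin.toFinset, (analyticOrderNatAt (fun z => b.repr (G z) i) a : ℝ) *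
      countingWeight r a := sum_nonneg fun a ha =>
    mul_nonneg (Nat.cast_nonneg _) (countingWeight_nonneg hr (hfin.mem_toFinset.1 ha).1)
  have h3 : circleAverage (fun z => log ‖b.repr (G z) i‖) 0 r ≤ orderFunction b G r := by
    refine circleAverage_mono_codiscreteWithin (by linarith)
      (circleIntegrable_log_norm_entire hd1 r)
      ((continuous_log_norm_coordinates b hd h0).continuousOn.circleIntegrable') ?_
    filter_upwards [codiscreteWithin_mono (Set.subset_univ _)
      (eventually_codiscrete_ne_zero hd1 hne)] with z hz
    exact log_le_log (norm_pos_iff.2 hz) (norm_le_pi_norm (fun i => b.repr (G z) i : ι → ℂ) i)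
  linarith

theorem exists_abs_orderFunction_le {ι W : Type*} [Fintype ι] [AddCommGroup W] [Module ℂ W]
    (b : Module.Basis ι ℂ W) {G : ℂ → W}
    (hd : ∀ φ : Module.Dual ℂ W, Differentiable ℂ fun z => φ (G z)) (h0 : ∀ z, G z ≠ 0) (R : ℝ) :
    ∃ c : ℝ, ∀ r, 0 ≤ r → r ≤ R → |orderFunction b G r| ≤ c := by
  have h1 := continuous_log_norm_coordinates b hd h0
  obtain ⟨c, hc⟩ := (isCompact_closedBall (0 : ℂ) R).exists_bound_of_continuousOn h1.continuousOn
  refine ⟨c, fun r hr hrR => ?_⟩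
  have h2 : ∀ z ∈ Metric.sphere (0 : ℂ) |r|, |log ‖(fun i => b.repr (G z) i : ι → ℂ)‖| ≤ c :=
    fun z hz => hc z (by
      rw [mem_sphere_zero_iff_norm, abs_of_nonneg hr] at hz
      rw [mem_closedBall_zero_iff]; linarith)
  have h3 := h1.continuousOn.circleIntegrable' (c := 0) (R := r)
  exact abs_circleAverage_le_circleAverage_abs.trans
    (circleAverage_mono_on_of_le_circle h3.abs h2)

/-- An arbitrary reduced representation differs from the polynomial one by a zero-free factor, whose
logarithmic average is constant. -/
theorem exists_orderFunction_le_log_of_isRationalCurve {ι W : Type*} [Fintype ι] [AddCommGroup W]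
    [Module ℂ W] (b : Module.Basis ι ℂ W) {F : ℂ → ℙ ℂ W} (hF : IsRationalCurve F)
    {G : ℂ → W} (hG : IsReducedRep F G) :
    ∃ c d : ℝ, ∀ r, 1 ≤ r → orderFunction b G r ≤ c + d * log r := by
  obtain ⟨m, w, hw⟩ := hF
  set Q : ℂ → W := fun z => ∑ j ∈ range (m + 1), z ^ j • w j with hQ
  have hQr : IsReducedRep F Q := by
    refine ⟨fun φ => ?_, hw⟩
    have h1 : (fun z => φ (Q z)) = fun z => ∑ j ∈ range (m + 1), z ^ j * φ (w j) := by
      funext z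
      simp [hQ]
    rw [h1]
    fun_prop
  obtain ⟨u, hu, hu0, huG⟩ := hG.exists_smul_eq hQr
  obtain ⟨c, hc⟩ := exists_circleAverage_log_norm_eq hu (Function.ne_iff.2 ⟨0, hu0 0⟩)
  set K : ℝ := ∑ j ∈ range (m + 1), ‖(fun i => b.repr (w j) i : ι → ℂ)‖ with hK
  have hK0 : 0 ≤ K := sum_nonneg fun _ _ => norm_nonneg _
  have hQn : ∀ r, 1 ≤ r → ∀ z : ℂ, ‖z‖ = r → ‖(fun i => b.repr (Q z) i : ι → ℂ)‖ ≤ (K + 1) * r ^ m := by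
    intro r hr z hz
    have h1 : (fun i => b.repr (Q z) i : ι → ℂ) =
        ∑ j ∈ range (m + 1), z ^ j • (fun i => b.repr (w j) i : ι → ℂ) := by
      funext i
      simp [hQ]
    rw [h1]
    have h2 : K * r ^ m ≤ (K + 1) * r ^ m := by gcongr; linarith
    refine (norm_sum_le _ _).trans (le_trans ?_ h2)
    rw [hK, sum_mul]
    refine sum_le_sum fun j hj => ?_
    rw [norm_smul, norm_pow, hz, mul_comm]
    gcongr
    exact Nat.lt_succ_iff.1 (mem_range.1 hj)
  refine ⟨c + log (K + 1), m, fun r hr => ?_⟩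
  have hr0 : 0 < r := by linarith
  have h1 := hc r hr0 ∅ (by simp) fun a _ ha => absurd ha (hu0 a)
  rw [sum_empty, zero_add] at h1
  have hu2 := circleIntegrable_log_norm_entire hu r
  have h5 : CircleIntegrable (fun _ : ℂ => log (K + 1) + m * log r) 0 r :=
    circleIntegrable_const _ _ _
  calc orderFunction b G r
      ≤ circleAverage (fun z => log ‖u z‖ + (log (K + 1) + m * log r)) 0 r := by
        refine circleAverage_mono ((continuous_log_norm_coordinates b hG.1 fun z =>
          (hG.2 z).choose).continuousOn.circleIntegrable') (hu2.add h5) fun z hz => ?_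
        rw [mem_sphere_zero_iff_norm, abs_of_pos hr0] at hz
        have h6 : (fun i => b.repr (G z) i : ι → ℂ) = u z • (fun i => b.repr (Q z) i : ι → ℂ) := by
          funext i
          simp [huG]
        have h7 := norm_coordinates_pos b (hw z).choose
        rw [h6, norm_smul, log_mul (norm_ne_zero_iff.2 (hu0 z)) h7.ne', ← log_pow,
          ← log_mul (add_pos_of_nonneg_of_pos hK0 one_pos).ne' (pow_pos hr0 m).ne']
        exact add_le_add_right (log_le_log h7 (hQn r hr z hz)) _
    _ = _ := by
      rw [circleAverage_fun_add hu2 h5, circleAverage_const, h1]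
      ring

end OrderFunctions

/-! ### The Plücker system attached to a derived curve and decomposable hyperplanes. -/

section Construction
open Filter Topology Finset
open scoped Matrix LinearAlgebra.Projectivization
open DerivedCurve

theorem card_powersetCard_fin (n k : ℕ) :
    Fintype.card (Set.powersetCard (Fin (n + 1)) (k + 1)) = (n + 1).choose (k + 1) := by
  rw [← Nat.card_eq_fintype_card, Set.powersetCard.card, Nat.card_eq_fintype_card,
    Fintype.card_fin]

theorem finrank_KVec (N k : ℕ) : Module.finrank ℂ (KVec N k) = (N + 1).choose (k + 1) := by
  rw [Module.finrank_eq_card_basis (pluckerBasis N k), card_powersetCard_fin]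

/-- The value of a decomposable form on a vector of a subspace with parametrization `B`. -/
theorem pairingDual_ιMulti_map_eq_sum {N n k : ℕ} (α : Fin (k + 1) → Module.Dual ℂ (Fin (N + 1) → ℂ))
    (B : (Fin (n + 1) → ℂ) →ₗ[ℂ] (Fin (N + 1) → ℂ)) (y : KVec n k) :
    exteriorPower.pairingDual ℂ (Fin (N + 1) → ℂ) (k + 1) (exteriorPower.ιMulti ℂ (k + 1) α)
        (exteriorPower.map (k + 1) B y) =
      ∑ I, (pluckerBasis n k).repr y I *
        ((Matrix.of fun s j => α s (B (Pi.single j 1))).submatrix id (subsetEnum I)).det := by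
  conv_lhs => rw [← (pluckerBasis n k).sum_repr y]
  simp only [map_sum, map_smul, smul_eq_mul]
  refine sum_congr rfl fun I _ => ?_
  rw [pluckerBasis_apply, exteriorPower.map_apply_ιMulti, exteriorPower.pairingDual_ιMulti_ιMulti,
    ← Matrix.det_transpose]
  rfl

theorem exists_pluckerSystem {N n k q : ℕ} {f : ℂ → ℙ ℂ (Fin (N + 1) → ℂ)}
    {L : Submodule ℂ (Fin (N + 1) → ℂ)} (hL : IsLinearSpan f L)
    (hn : Module.finrank ℂ L = n + 1) {A : Fin q → Module.Dual ℂ (KVec N k)}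
    (hdec : ∀ i, IsDecomposableForm (A i)) (hgen : InGeneralPosition A)
    (hnot : ∀ i, ¬ LinearMap.range (exteriorPower.map (k + 1) L.subtype) ≤ LinearMap.ker (A i))
    {F : ℂ → ℙ ℂ (KVec N k)} (hF : IsDerivedCurve k f F) {G : ℂ → KVec N k}
    (hG : IsReducedRep F G) (hq : (N + 1).choose (k + 1) ≤ q) :
    ∃ (B : (Fin (n + 1) → ℂ) →ₗ[ℂ] (Fin (N + 1) → ℂ))
      (β : (Fin (N + 1) → ℂ) →ₗ[ℂ] (Fin (n + 1) → ℂ))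
      (P : PluckerSystem n k q ((N + 1).choose (k + 1))),
      (∀ z, exteriorPower.map (k + 1) B (exteriorPower.map (k + 1) β (G z)) = G z) ∧
      (∀ I z, P.H I z = (pluckerBasis n k).repr (exteriorPower.map (k + 1) β (G z)) I) ∧
      ∀ i, P.form i = fun z => A i (G z) := by
  obtain ⟨B, β, φ, g, hβB, hrange, hφ, hφLI, hg, hg0, hw, hBβ⟩ := exists_span_coordinates hL hn hF hG
  choose hA0 α hα using hdec
  have hform : ∀ i y, A i (exteriorPower.map (k + 1) B y) = ∑ I, (pluckerBasis n k).repr y I *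
      ((Matrix.of fun s j => α i s (B (Pi.single j 1))).submatrix id (subsetEnum I)).det :=
    fun i y => by rw [hα i, pairingDual_ιMulti_map_eq_sum]
  have hinj : Function.Injective (exteriorPower.map (k + 1) B) := exteriorPower.map_injective β hβB
  have hnN : n ≤ N := by
    have h1 := L.finrank_le
    rw [hn, Module.finrank_fin_fun] at h1
    omega
  refine ⟨B, β,
    { f := φ
      differentiable_f := hφ
      linearIndependent_f := hφLI
      g := g
      differentiable_g := hg
      g_ne_zero := hg0
      H := fun I z => (pluckerBasis n k).repr (exteriorPower.map (k + 1) β (G z)) I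
      differentiable_H := fun I => hG.1 ((pluckerBasis n k).coord I ∘ₗ exteriorPower.map (k + 1) β)
      wronskian_eq := hw
      H_ne_zero := fun z h => ?_
      a := fun i => Matrix.of fun s j => α i s (B (Pi.single j 1))
      minors_ne_zero := fun i h => ?_
      card_le := ?_
      le_q := hq
      span_eq_top := fun S hS => ?_ }, hBβ, fun I z => rfl, fun i => funext fun z => ?_⟩
  · have h1 : exteriorPower.map (k + 1) β (G z) = 0 :=
      (pluckerBasis n k).repr.map_eq_zero_iff.1 (Finsupp.ext fun I => congrFun h I)
    refine (hG.2 z).choose ?_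
    rw [← hBβ z, h1, map_zero]
  -- If all minors vanished, the form would vanish on the image of `Λ^{k+1} B`, which contains that
  -- of `Λ^{k+1} L`.
  · refine hnot i ?_
    have h1 : L.subtype = B ∘ₗ (β ∘ₗ L.subtype) := by
      ext1 ⟨x, hx⟩
      rw [← hrange] at hx
      obtain ⟨y, rfl⟩ := hx
      have h2 : β (B y) = y := LinearMap.congr_fun hβB y
      simp [h2]
    rintro _ ⟨x, rfl⟩
    rw [LinearMap.mem_ker, h1, exteriorPower.map_comp, LinearMap.comp_apply, hform]
    exact sum_eq_zero fun I _ => mul_eq_zero_of_right _ (congrFun h I)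
  · rw [card_powersetCard_fin]
    exact Nat.choose_le_choose _ (by omega)
  -- A functional annihilating `D` of the coordinate vectors is a vector `y` whose image lies on `D`
  -- of the hyperplanes. General position makes the image zero, and `Λ^{k+1} B` is injective.
  · by_contra hne
    obtain ⟨ψ, hψ0, hψ⟩ := Submodule.exists_le_ker_of_lt_top _ (lt_top_iff_ne_top.2 hne)
    set y : KVec n k := ∑ I, ψ (Pi.single I 1) • pluckerBasis n k I with hy
    have hrepr : ∀ I, (pluckerBasis n k).repr y I = ψ (Pi.single I 1) := fun I => by
      rw [hy, Module.Basis.repr_sum_self]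
    have hψsum : ∀ x : Set.powersetCard (Fin (n + 1)) (k + 1) → ℂ,
        ψ x = ∑ I, ψ (Pi.single I 1) * x I := fun x => by
      rw [LinearMap.pi_apply_eq_sum_univ ψ x]
      refine sum_congr rfl fun I _ => ?_
      rw [smul_eq_mul, mul_comm]
      congr 2
      funext J
      simp [Pi.single_apply, eq_comm]
    have h1 : exteriorPower.map (k + 1) B y = 0 := by
      refine hgen S (by rw [hS, finrank_KVec]) _ fun i hi => ?_
      rw [hform]
      simp only [hrepr]
      rw [← hψsum]
      exact hψ (Submodule.subset_span ⟨i, hi, rfl⟩)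
    have h2 : y = 0 := hinj (by rw [h1, map_zero])
    refine hψ0 (LinearMap.ext fun x => ?_)
    rw [hψsum]
    exact sum_eq_zero fun I _ => by rw [← hrepr, h2]; simp
  · conv_rhs => rw [← hBβ z, hform]
    rfl

end Construction

/-! ### Admissible error terms, and the degenerate case `k = n`. -/

section ErrorTerms
open Filter Topology Finset Real MeasureTheory
open scoped Matrix LinearAlgebra.Projectivization
open DerivedCurve

theorem isErrorTerm_max_of_le {W : Type*} [AddCommGroup W] [Module ℂ W] {F : ℂ → ℙ ℂ W}
    {T E : ℝ → ℝ} (h : ∃ c : ℝ, ∀ r, 1 < r → E r ≤ c) :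
    IsErrorTerm F T fun r => max 0 (E r) := by
  obtain ⟨c, hc⟩ := h
  -- Beyond the exponential of `max 0 c / ε` the constant is below `ε log r`, so a bounded interval
  -- serves as exceptional set.
  refine ⟨⟨0, fun ε hε => ⟨Set.Ioc 1 (exp (max 0 c / ε)), by simp, fun r hr hrE => ?_⟩⟩,
    fun _ => ⟨max 0 c, fun r hr => ?_⟩⟩
  · have h1 : exp (max 0 c / ε) ≤ r := by
      by_contra! h2
      exact hrE ⟨hr, h2.le⟩
    have h2 := (le_log_iff_exp_le (by linarith)).2 h1
    rw [div_le_iff₀ hε] at h2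
    have h3 : max 0 (E r) ≤ max 0 c := max_le_max le_rfl (hc r hr)
    linarith
  · rw [abs_of_nonneg (le_max_left _ _)]
    exact max_le_max le_rfl (hc r hr)

theorem isErrorTerm_max_of_isSmall {W : Type*} [AddCommGroup W] [Module ℂ W] {F : ℂ → ℙ ℂ W}
    {T E φ : ℝ → ℝ} (hT : ∃ c : ℝ, 0 < c ∧ ∀ᶠ r in atTop, c * Real.log r ≤ T r)
    (hφ : (GrowthScale.ofOrder T hT).IsSmall φ) (hE : ∀ r, 1 ≤ r → E r ≤ φ r)
    (hF : IsRationalCurve F → ∃ c : ℝ, ∀ r, 1 < r → E r ≤ c) :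
    IsErrorTerm F T fun r => max 0 (E r) := by
  refine ⟨?_, fun hF' => (isErrorTerm_max_of_le (F := F) (T := T) (hF hF')).2 hF'⟩
  obtain ⟨C, hC⟩ := hφ
  refine ⟨|C|, fun ε hε => ?_⟩
  have h1 : ∀ᶠ r in (volume.restrict (Set.Ioi (1 : ℝ))).cofinite,
      max 0 (E r) ≤ |C| * Real.log (T r) + ε * Real.log r := by
    filter_upwards [hC ε hε, (GrowthScale.ofOrder T hT).small_nonneg,
      (GrowthScale.ofOrder T hT).negligible_nonneg,
      GrowthScale.eventually_ge (s := GrowthScale.ofOrder T hT) 1] with r h2 h3 h4 h5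
    change φ r ≤ C * Real.log (T r) + ε * Real.log r at h2
    change 0 ≤ Real.log (T r) at h3
    change 0 ≤ Real.log r at h4
    refine max_le (by positivity) ((hE r h5).trans (h2.trans ?_))
    gcongr
    exact le_abs_self C
  have h2 := Measure.mem_cofinite.1 h1
  rw [Measure.restrict_apply' measurableSet_Ioi] at h2
  refine ⟨_, h2, fun r hr hrE => ?_⟩
  by_contra h3
  exact hrE ⟨h3, hr⟩

/-- For `k = n` the space `Λ^{n+1} L` is a line. A reduced representation then has a single
zero-free coordinate, whose logarithmic average is constant by Jensen's formula. -/
theorem exists_orderFunction_le_of_eq {N n : ℕ} {f : ℂ → ℙ ℂ (Fin (N + 1) → ℂ)}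
    {L : Submodule ℂ (Fin (N + 1) → ℂ)} (hL : IsLinearSpan f L)
    (hn : Module.finrank ℂ L = n + 1) {F : ℂ → ℙ ℂ (KVec N n)} (hF : IsDerivedCurve n f F)
    {G : ℂ → KVec N n} (hG : IsReducedRep F G) :
    ∃ c : ℝ, ∀ r, 1 ≤ r → orderFunction (pluckerBasis N n) G r ≤ c := by
  obtain ⟨B, β, φ, g, -, -, -, -, -, -, -, hBβ⟩ := exists_span_coordinates hL hn hF hG
  set b := exteriorPower.map (n + 1) β with hb
  have hd : ∀ ψ : Module.Dual ℂ (KVec n n), Differentiable ℂ fun z => ψ (b (G z)) :=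
    fun ψ => hG.1 (ψ ∘ₗ b)
  have hB0 : ∀ z, exteriorPower.map (n + 1) B (b (G z)) ≠ 0 := fun z => by
    rw [hBβ]; exact (hG.2 z).choose
  have hb0 : ∀ z, b (G z) ≠ 0 := fun z h => hB0 z (by rw [h, map_zero])
  obtain ⟨c₁, hc₁⟩ := exists_orderFunction_map_le (pluckerBasis n n) (pluckerBasis N n)
    (exteriorPower.map (n + 1) B) hd hB0
  simp only [hBβ] at hc₁
  obtain ⟨I, hI⟩ : ∃ I : Set.powersetCard (Fin (n + 1)) (n + 1), ∀ J, J = I := by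
    refine Fintype.card_eq_one_iff.1 ?_
    rw [card_powersetCard_fin, Nat.choose_self]
  have hI0 : ∀ z, (pluckerBasis n n).repr (b (G z)) I ≠ 0 := fun z h =>
    hb0 z ((pluckerBasis n n).repr.map_eq_zero_iff.1 (Finsupp.ext fun J => by rw [hI J, h]; rfl))
  obtain ⟨c₂, hc₂⟩ := exists_circleAverage_log_norm_eq (hd ((pluckerBasis n n).coord I))
    (Function.ne_iff.2 ⟨0, hI0 0⟩)
  refine ⟨c₂ + c₁, fun r hr => (hc₁ r).trans ?_⟩
  have h1 := hc₂ r (by linarith) ∅ (by simp) fun a _ ha => absurd ha (hI0 a)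
  rw [sum_empty, zero_add] at h1
  have h2 : orderFunction (pluckerBasis n n) (fun z => b (G z)) r =
      circleAverage (fun z => log ‖(pluckerBasis n n).coord I (b (G z))‖) 0 r := by
    have : Unique (Set.powersetCard (Fin (n + 1)) (n + 1)) := ⟨⟨I⟩, hI⟩
    refine congrArg (fun u => circleAverage u 0 r) (funext fun z => ?_)
    congr 1
    refine le_antisymm ((pi_norm_le_iff_of_nonneg (norm_nonneg _)).2 fun J => by rw [hI J]; rfl) ?_
    exact norm_le_pi_norm (fun J => (pluckerBasis n n).repr (b (G z)) J) I
  rw [h2, h1, add_comm]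

end ErrorTerms

/-! ### The second main theorem for derived curves. -/

section MainTheorem
open Filter Topology Finset Real MeasureTheory
open scoped Matrix LinearAlgebra.Projectivization
open DerivedCurve

/-- The second main theorem for a system whose coordinates are comparable with a curve `G`. -/
theorem PluckerSystem.isErrorTerm {n k q D : ℕ} (P : PluckerSystem n k q D) (hk : k < n)
    {ι W : Type*} [Fintype ι] [AddCommGroup W] [Module ℂ W] (b : Module.Basis ι ℂ W)
    {F : ℂ → ℙ ℂ W} {G : ℂ → W} (hG : IsReducedRep F G) {c₁ c₂ : ℝ}
    (hc₁ : ∀ r, orderFunction b G r ≤ circleAverage P.logNorm 0 r + c₁)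
    (hc₂ : ∀ r, circleAverage P.logNorm 0 r ≤ orderFunction b G r + c₂) {κ : ℝ} (hκ : 0 ≤ κ)
    (hκe : κ = q - (2 * D - Fintype.card (Set.powersetCard (Fin (n + 1)) (k + 1)))) :
    IsErrorTerm F (orderFunction b G) fun r => max 0 (κ * orderFunction b G r -
      ∑ i, countingFunction ((k + 1) * (n - k)) (P.form i) r) := by
  set T := orderFunction b G with hTdef
  set Z : ℝ → ℝ := fun r => ∑ i, countingFunction ((k + 1) * (n - k)) (P.form i) r with hZ
  have hZ0 : ∀ r, 1 ≤ r → 0 ≤ Z r := fun r hr => sum_nonneg fun i _ => countingFunction_nonneg hr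
  have hcompare : ∀ {φ : ℝ → ℝ}, (∀ r : ℝ, 1 ≤ r →
      ((q : ℝ) - (2 * D - Fintype.card (Set.powersetCard (Fin (n + 1)) (k + 1)))) *
        circleAverage P.logNorm 0 r ≤ Z r + φ r) →
      ∀ r, 1 ≤ r → κ * T r - Z r ≤ φ r + κ * c₁ := fun h r hr => by
    have h1 := h r hr
    have h2 := mul_le_mul_of_nonneg_left (hc₁ r) hκ
    rw [← hκe] at h1
    linarith
  -- The lower bound `log r - O(1)` gives the factor `1 / 2`, the other half of `log r` absorbing
  -- the constants.
  have hT : ∃ c : ℝ, 0 < c ∧ ∀ᶠ r in atTop, c * Real.log r ≤ T r := by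
    obtain ⟨c, R, hc⟩ := P.exists_log_le hk
    refine ⟨1 / 2, by norm_num, ?_⟩
    filter_upwards [eventually_ge_atTop R, tendsto_log_atTop.eventually_ge_atTop (2 * (c + c₂))]
      with r h1 h2
    linarith [hc r h1, hc₂ r]
  have hs : (GrowthScale.ofOrder T hT).IsBounded (circleAverage P.logNorm 0) := by
    have h1 : (GrowthScale.ofOrder T hT).IsBounded T :=
      ⟨1, Eventually.of_forall fun r => (one_mul (T r)).ge⟩
    exact (h1.add (GrowthScale.isBounded_const c₂)).mono (Eventually.of_forall hc₂)
  obtain ⟨φ, hφ, hmain⟩ := P.exists_secondMainEstimate_of_isBounded hk hs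
  refine isErrorTerm_max_of_isSmall hT (hφ.add (GrowthScale.isSmall_const (κ * c₁)))
    (hcompare hmain) fun hF => ?_
  -- For a rational curve the order function is `O(log r)`, so the estimate is repeated in the
  -- rational scale, where small means bounded and no exceptional set occurs.
  obtain ⟨c, d, hcd⟩ := exists_orderFunction_le_log_of_isRationalCurve b hF hG
  have hs' : GrowthScale.rational.IsBounded (circleAverage P.logNorm 0) := by
    have h1 : GrowthScale.rational.IsBounded fun r => d * Real.log r :=
      ⟨d, Eventually.of_forall fun r => le_rfl⟩
    refine ((GrowthScale.isBounded_const (c + c₂)).add h1).mono ?_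
    filter_upwards [GrowthScale.eventually_ge 1] with r hr
    linarith [hcd r hr, hc₂ r]
  obtain ⟨ψ, ⟨C, hψ⟩, hmain'⟩ := P.exists_secondMainEstimate_of_isBounded hk hs'
  obtain ⟨R, hR⟩ := eventually_atTop.1 (hψ 1 one_pos)
  obtain ⟨M, hM⟩ := exists_abs_orderFunction_le b hG.1 (fun z => (hG.2 z).choose) R
  -- The first constant serves for `r ≥ R`. On the bounded range below `R` the order function itself
  -- is bounded and the counting functions are nonnegative.
  refine ⟨max (C + κ * c₁) (κ * M), fun r hr => ?_⟩
  rcases le_total R r with h | h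
  · have h1 : ψ r ≤ C * 1 + 1 * 0 := hR r h
    refine le_max_of_le_left ((hcompare hmain' r hr.le).trans ?_)
    linarith
  · have h1 := mul_le_mul_of_nonneg_left ((le_abs_self _).trans (hM r (by linarith) h)) hκ
    exact le_max_of_le_right (by linarith [hZ0 r hr.le])

end MainTheorem


theorem theorem1 (N n k q : ℕ) (hkn : k ≤ n)
    -- an entire curve in `ℙ^N` whose linear span `ℙ(L)` has dimension `n`
    (f : ℂ → ℙ ℂ (Fin (N + 1) → ℂ)) (hf : DerivedCurve.IsEntireCurve f)
    (L : Submodule ℂ (Fin (N + 1) → ℂ)) (hL : DerivedCurve.IsLinearSpan f L)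
    (hn : Module.finrank ℂ L = n + 1)
    -- decomposable hyperplanes in general position, none containing `ℙ(Λ^{k+1} L)`
    (A : Fin q → Module.Dual ℂ (DerivedCurve.KVec N k))
    (hdec : ∀ i, DerivedCurve.IsDecomposableForm (A i))
    (hgen : DerivedCurve.InGeneralPosition A)
    (hnot : ∀ i, ¬ LinearMap.range (exteriorPower.map (k + 1) L.subtype) ≤ LinearMap.ker (A i))
    -- the `k`-th derived curve and a reduced representation of it
    (F : ℂ → ℙ ℂ (DerivedCurve.KVec N k)) (hF : DerivedCurve.IsDerivedCurve k f F)
    (G : ℂ → DerivedCurve.KVec N k) (hG : DerivedCurve.IsReducedRep F G) :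
    ∃ S : ℝ → ℝ,
      DerivedCurve.IsErrorTerm F
        (DerivedCurve.orderFunction (DerivedCurve.pluckerBasis N k) G) S ∧
      ∀ r : ℝ, 1 < r →
        ((q : ℝ) - 2 * ((N + 1).choose (k + 1) : ℝ) + ((n + 1).choose (k + 1) : ℝ)) *
            DerivedCurve.orderFunction (DerivedCurve.pluckerBasis N k) G r ≤
          ∑ i, DerivedCurve.countingFunction ((k + 1) * (n - k)) (fun z => A i (G z)) r + S r := by
  have hG0 : ∀ z, G z ≠ 0 := fun z => (hG.2 z).choose
  set κ : ℝ := (q : ℝ) - 2 * ((N + 1).choose (k + 1) : ℝ) + ((n + 1).choose (k + 1) : ℝ) with hκ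
  set T := DerivedCurve.orderFunction (DerivedCurve.pluckerBasis N k) G with hT
  set Z : ℝ → ℝ := fun r => ∑ i, DerivedCurve.countingFunction ((k + 1) * (n - k))
    (fun z => A i (G z)) r with hZ
  -- The error term is taken to be the defect of the inequality itself, so only its size remains to
  -- be proved.
  refine ⟨fun r => max 0 (κ * T r - Z r), ?_, fun r hr => by
    linarith [le_max_right 0 (κ * T r - Z r)]⟩
  have hZ0 : ∀ r, 1 < r → 0 ≤ Z r := fun r hr =>
    Finset.sum_nonneg fun i _ => countingFunction_nonneg hr.le
  obtain ⟨c₀, hc₀⟩ := exists_le_orderFunction (DerivedCurve.pluckerBasis N k) hG.1 hG0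
  rcases le_or_gt κ 0 with hκ0 | hκ0
  · refine isErrorTerm_max_of_le ⟨κ * c₀, fun r hr => ?_⟩
    have h1 := mul_le_mul_of_nonpos_left (hc₀ r hr.le) hκ0
    linarith [hZ0 r hr]
  rcases hkn.eq_or_lt with rfl | hk
  · obtain ⟨c, hc⟩ := exists_orderFunction_le_of_eq hL hn hF hG
    refine isErrorTerm_max_of_le ⟨κ * c, fun r hr => ?_⟩
    have h1 := mul_le_mul_of_nonneg_left (hc r hr.le) hκ0.le
    linarith [hZ0 r hr]
  have hnN : n + 1 ≤ N + 1 := by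
    have h1 := L.finrank_le
    rwa [hn, Module.finrank_fin_fun] at h1
  -- A positive `κ` means `q > 2 D - d`, and `d ≤ D`. There are thus enough forms for general
  -- position to say something.
  have hq : (N + 1).choose (k + 1) ≤ q := by
    have h1 : (((n + 1).choose (k + 1) : ℕ) : ℝ) ≤ ((N + 1).choose (k + 1) : ℕ) :=
      Nat.cast_le.2 (Nat.choose_le_choose _ hnN)
    have h2 : (((N + 1).choose (k + 1) : ℕ) : ℝ) ≤ q := by linarith
    exact_mod_cast h2
  obtain ⟨B, β, P, hBβ, hH, hform⟩ := exists_pluckerSystem hL hn hdec hgen hnot hF hG hq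
  have hlog : ∀ r, Real.circleAverage P.logNorm 0 r =
      DerivedCurve.orderFunction (DerivedCurve.pluckerBasis n k)
        (fun z => exteriorPower.map (k + 1) β (G z)) r := fun r => by
    refine congrArg (fun u => Real.circleAverage u 0 r) (funext fun z => ?_)
    simp only [PluckerSystem.logNorm, hH]
  have hB0 : ∀ z, exteriorPower.map (k + 1) B (exteriorPower.map (k + 1) β (G z)) ≠ 0 :=
    fun z => by rw [hBβ]; exact hG0 z
  obtain ⟨c₁, hc₁⟩ := exists_orderFunction_map_le (DerivedCurve.pluckerBasis n k)
    (DerivedCurve.pluckerBasis N k) (exteriorPower.map (k + 1) B)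
    (fun ψ => hG.1 (ψ ∘ₗ exteriorPower.map (k + 1) β)) hB0
  obtain ⟨c₂, hc₂⟩ := exists_orderFunction_map_le (DerivedCurve.pluckerBasis N k)
    (DerivedCurve.pluckerBasis n k) (exteriorPower.map (k + 1) β) hG.1
    fun z h => hB0 z (by rw [h, map_zero])
  have h := P.isErrorTerm hk (DerivedCurve.pluckerBasis N k) hG (c₁ := c₁) (c₂ := c₂)
    (fun r => by simpa only [hBβ, hlog] using hc₁ r) (fun r => by rw [hlog]; exact hc₂ r) hκ0.le
    (by rw [card_powersetCard_fin, hκ]; ring)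
  simpa only [hform] using h
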